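/- **Setting.** Let $B=\{(x,y,z)\in\mathbb R^3: z<0\}$, let $\bar B=\{z\le 0\}$, and identify $\partial B$ with $\mathbb R^2$. Write $\mathbf k$ for the vertical unit vector, $\mathbf V(x,y)=\mathbf v(x,y,0)$ for the trace of a field $\mathbf v$, and $\Phi$ for the restriction of a map $\varphi:\bar B\to\bar B$ to $\partial B$. Let $\Omega_0\subset\mathbb R^2$ be an open set that lies on one side of its boundary, where $\Gamma_0=\partial\Omega_0$ is a finite disjoint union of simple closed regular $C^2$ curves. *Fields.* For $S\subset\mathbb R^2$, a regular field relative to $S$ is a vector field on $\bar B$ that is continuous on $\bar B$, is $C^\infty$ on $\bar B\setminus (S\times\{0\})$, has bounded $z$-derivative and square integrable gradient in $B$, and is $O(|x|^{-2})$ at infinity together with each of its derivatives. Let $\mathcal V_S$ be the set of such fields $\mathbf v$ with $\nabla\cdot\mathbf v=0$ in $B$, $\nabla_\perp\cdot\mathbf V=0$ on $\mathbb R^2\setminus S$, and $\mathbf v\cdot\mathbf k=0$ in $\bar B$. In particular $\mathcal V_\emptyset$ consists of decaying fields in $C^\infty(\bar B,\mathbb R^3)$. *Manifold.* Let $\mathcal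 N$ be the set of homeomorphisms $\varphi$ of $\bar B$ that leave every plane $z=\mathrm{const}$ invariant, are $C^\infty$ diffeomorphisms off $\Gamma_0\times\{0\}$, preserve orientation, volume in $B$ and area on $\partial B$, and map the curves of $\Gamma_0$ to simple closed regular $C^2$ curves. (Everywhere smooth diffeomorphisms with the other properties are included.) *Metric and energy.* For tangent vectors $\mathbf v\circ\varphi$ and $\mathbf w\circ\varphi$ put $g_\varphi(\mathbf v\circ\varphi,\mathbf w\circ\varphi)=\int_B \mathrm{Tr}(\nabla\mathbf v^T\nabla\mathbf w)\,dx$. Put $\mathcal E(\varphi)=\mathrm{Per}(\Phi(\Omega_0))$, the total length of the boundary curves. For $\mathbf v\in\mathcal V_\emptyset$ with flow $\psi_\tau$ on $\bar B$, put $\langle d\mathcal E(\varphi),\mathbf v\circ\varphi\rangle=\frac{d}{d\tau}\mathcal E(\psi_\tau\circ\varphi)\big|_{\tau=0}$. Let $T>0$, and let $\varphi(t)\in\mathcal N$, $0\le t<T$, satisfy $\varphi(0)=\mathrm{Id}$ and $\partial_t\varphi=\mathbf u\circ\varphi$ on $\bar B$, where each $\mathbf u(t)$ is a regular field relative to $\Gamma_t=\Phi_t(\Gamma_0)$.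 Put $\Omega_t=\Phi_t(\Omega_0)$. **Theorem.** The following are equivalent. 1. (*Gradient flow on $\mathcal N$.*) For every $t\in[0,T)$, the velocity $\partial_t\varphi$ is of the form $\mathbf w\circ\varphi$ with $\mathbf w\in\mathcal V_{\Gamma_t}$, and, for every $\mathbf v\in\mathcal V_\emptyset$, the derivative $\langle d\mathcal E(\varphi),\mathbf v\circ\varphi\rangle$ exists and $$g_{\varphi}(\partial_t\varphi,\mathbf v\circ\varphi)=-\langle d\mathcal E(\varphi),\mathbf v\circ\varphi\rangle .$$ 2. (*Constrained ILLSS model.*) There are a pressure $P(t)$, differentiable in $B$, and a locally integrable surface pressure $\Pi(t)$ on $\mathbb R^2$ such that the following hold for every $t\in[0,T)$. - $\Omega_t$ is an open set that lies on one side of its boundary $\Gamma_t$, and $\Gamma_t$ is a finite disjoint union of simple closed regular $C^2$ curves. - $\nabla\cdot\mathbf u=0$ and $\triangle\mathbf u=\nabla P$ in $B$, and $\mathbf u\cdot\mathbf k=0$ in $\bar B$. - The surface velocity $\mathbf U(x,y)=\mathbf u(x,y,0)$ satisfies $\nabla_\perp\cdot\mathbf U=0$ off $\Gamma_t$. - In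 the sense of distributions on $\mathbb R^2$, $$\nabla_\perp\Pi=\mathbf F_s+\mathbf F_l .$$ Here $\mathbf F_s$ is minus the horizontal part of $\partial_z\mathbf u(x,y,0)$. Also $\mathbf F_l=\kappa\,\mathbf n\,\delta_{\Gamma_t}$, where $\mathbf n$ is the outward unit normal of $\Omega_t$, $\kappa$ is the curvature of $\Gamma_t$ (negative for convex $\Omega_t$), and $\delta_{\Gamma_t}$ is arc length measure on $\Gamma_t$. - The points of $\Gamma_t$ are advected by $\mathbf U$. Moreover, in this case $\mathbf u(t)$ is harmonic in $B$ for every $t\in[0,T)$, and 2 holds with $P\equiv 0$. -/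

import Mathlib

open Set Filter Topology MeasureTheory InnerProductSpace
open scoped ContDiff

noncomputable section

namespace Langmuir

/-- The plane `ℝ²`, identified with the surface `z = 0`. -/
abbrev E2 := EuclideanSpace ℝ (Fin 2)

/-- The space `ℝ³` with coordinates `x = x 0`, `y = x 1`, `z = x 2`. -/
abbrev E3 := EuclideanSpace ℝ (Fin 3)

/-- The subfluid domain `B = {z < 0}`. -/
def B : Set E3 := {x | x 2 < 0}

/-- The closure `{z ≤ 0}` of the subfluid domain. -/
def Bbar : Set E3 := {x | x 2 ≤ 0}

/-- The point `(p₀, p₁, z)`. -/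
def lift (p : E2) (z : ℝ) : E3 := !₂[p 0, p 1, z]

/-- The inclusion `(x, y) ↦ (x, y, 0)` of the surface. -/
def emb (p : E2) : E3 := lift p 0

/-- The horizontal part `(x, y)` of a vector `(x, y, z)`. -/
def hor (x : E3) : E2 := !₂[x 0, x 1]

/-- The restriction of a map (or vector field) of the closed half space to the surface `z = 0`,
read in the plane.  It is used for maps and fields that send the surface to horizontal vectors. -/
def surf (f : E3 → E3) (p : E2) : E2 := hor (f (emb p))

/-- The divergence in `ℝ³`. -/
def div3 (v : E3 → E3) (x : E3) : ℝ :=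
  ∑ i, (fderiv ℝ v x (EuclideanSpace.single i 1)) i

/-- The surface divergence `∇_⊥ · V`. -/
def div2 (V : E2 → E2) (p : E2) : ℝ :=
  ∑ i, (fderiv ℝ V p (EuclideanSpace.single i 1)) i

/-! ### Phase domains and their boundary -/

/-- A simple closed regular curve of class `C²`, parametrized with period one. -/
structure IsClosedCurve (c : ℝ → E2) : Prop where
  contDiff : ContDiff ℝ 2 c
  periodic : Function.Periodic c 1
  regular : ∀ s, deriv c s ≠ 0
  simple : InjOn c (Ico 0 1)

/-- The interface made of the curves `γ i`. -/
def interface {m : ℕ} (γ : Fin m → ℝ → E2) : Set E2 := ⋃ i, range (γ i)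

/-- `D` is an open set which lies on one side of its boundary, and the boundary consists of the
disjoint simple closed curves `γ 0, …, γ (m - 1)`. -/
structure IsPhaseDomain {m : ℕ} (D : Set E2) (γ : Fin m → ℝ → E2) : Prop where
  isOpen : IsOpen D
  one_sided : interior (closure D) = D
  curve : ∀ i, IsClosedCurve (γ i)
  disjoint : ∀ i j, i ≠ j → Disjoint (range (γ i)) (range (γ j))
  frontier_eq : frontier D = interface γ

/-- The unit tangent of a curve. -/
def unitTangent (c : ℝ → E2) (s : ℝ) : E2 := ‖deriv c s‖⁻¹ • deriv c s

/-- The unit tangent turned clockwise by a right angle. -/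
def sideNormal (c : ℝ → E2) (s : ℝ) : E2 := !₂[unitTangent c s 1, -unitTangent c s 0]

open Classical in
/-- The unit normal of the boundary curve `c` of `D` that points out of `D`. -/
def outwardNormal (D : Set E2) (c : ℝ → E2) (s : ℝ) : E2 :=
  if ∀ᶠ ε in 𝓝[>] (0 : ℝ), c s + ε • sideNormal c s ∉ D then sideNormal c s
  else -sideNormal c s

/-- The curvature of the boundary curve `c` of `D`, with the sign for which it is negative where
`D` is convex: the outward normal component of the derivative of the unit tangent with respect to
arc length. -/
def curvature (D : Set E2) (c : ℝ → E2) (s : ℝ) : ℝ :=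
  ‖deriv c s‖⁻¹ * inner ℝ (deriv (unitTangent c) s) (outwardNormal D c s)

/-- The line tension `F_l = κ n δ(d)`, a vector-valued distribution on the plane: its value on a
vector field `V` is the integral of `κ n · V` over the boundary with respect to arc length. -/
def lineTension {m : ℕ} (D : Set E2) (γ : Fin m → ℝ → E2) (V : E2 → E2) : ℝ :=
  ∑ i, ∫ s in (0 : ℝ)..1,
    curvature D (γ i) s * inner ℝ (outwardNormal D (γ i) s) (V (γ i s)) * ‖deriv (γ i) s‖

/-- The surface stress `F_s = -u_z(x, y, 0) i - v_z(x, y, 0) j`, with the one-sided `z`-derivative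
at the surface. -/
def surfaceStress (u : E3 → E3) (p : E2) : E2 :=
  -hor (derivWithin (fun z : ℝ => u (lift p z)) (Iic 0) 0)

/-! ### Velocity fields -/

/-- Smooth decaying vector fields on the closed half space, where smoothness up to the surface may
fail at the points of a curve system `S` of the surface; there the field is still continuous, with
bounded `z`-derivative and square integrable gradient.  The field and each of its derivatives are
`O(|x|⁻²)` at infinity.  For `S = ∅` these are the fields in `C^∞` of the closed half space with
this decay (`z_bounded` and `energy` then follow from the other conditions). -/
structure IsRegularField (S : Set E2) (v : E3 → E3) : Prop where
  continuousOn : ContinuousOn v Bbar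
  smooth : ContDiffOn ℝ ∞ v (Bbar \ emb '' S)
  z_bounded : ∃ C, ∀ x ∈ B, ‖fderiv ℝ v x (EuclideanSpace.single 2 1)‖ ≤ C
  energy : IntegrableOn (fun x => ‖fderiv ℝ v x‖ ^ 2) B
  decay : ∀ n : ℕ, ∃ C R : ℝ, ∀ x ∈ Bbar, R ≤ ‖x‖ →
    ‖iteratedFDerivWithin ℝ n v Bbar x‖ ≤ C / (1 + ‖x‖) ^ 2

/-- Eulerian velocity fields tangent to the constrained diffeomorphisms: divergence free, with
divergence free trace on the surface, and horizontal.  For `S = ∅` they span the tangent space at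
the identity; the velocity of an interface flow is allowed to be singular along `S`. -/
structure IsTangentField (S : Set E2) (v : E3 → E3) : Prop where
  regular : IsRegularField S v
  div_free : ∀ x ∈ B, div3 v x = 0
  surface_div_free : ∀ p ∉ S, div2 (surf v) p = 0
  horizontal : ∀ x ∈ Bbar, v x 2 = 0

/-- `ψ` is the flow on the closed half space of the vector field `v`. -/
def IsFlow (v : E3 → E3) (ψ : ℝ → E3 → E3) : Prop :=
  ∀ x ∈ Bbar, ψ 0 x = x ∧
    ∀ τ, ψ τ x ∈ Bbar ∧ HasDerivAt (fun σ => ψ σ x) (v (ψ τ x)) τ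

/-! ### The manifold, the metric and the energy -/

/-- The inverse of a bijection of the closed half space. -/
def inv (φ : E3 → E3) : E3 → E3 := Function.invFunOn φ Bbar

/-- The constrained diffeomorphisms: bijections of the closed half space that leave every
horizontal plane invariant, preserve orientation, volume, and area on the surface, and are smooth
with smooth inverse.  On the interface `γ` in the surface only the following is asked of `φ`: it is
a homeomorphism which maps the curves `γ i` to regular curves of class `C²`.  This holds when `φ`
is smooth everywhere. -/
structure IsConstrainedDiffeo {m : ℕ} (γ : Fin m → ℝ → E2) (φ : E3 → E3) : Prop where
  bijOn : BijOn φ Bbar Bbar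
  continuousOn : ContinuousOn φ Bbar
  continuousOn_inv : ContinuousOn (inv φ) Bbar
  smooth : ContDiffOn ℝ ∞ φ (Bbar \ emb '' interface γ)
  smooth_inv : ContDiffOn ℝ ∞ (inv φ) (Bbar \ φ '' (emb '' interface γ))
  planes : ∀ x ∈ Bbar, φ x 2 = x 2
  volume : ∀ x ∈ B, (fderiv ℝ φ x).det = 1
  area : ∀ p ∉ interface γ, (fderiv ℝ (surf φ) p).det = 1
  curve : ∀ i, IsClosedCurve (fun s => surf φ (γ i s))

/-- The metric `g_φ(ξ, η) = ∫_B Tr(∇vᵀ ∇w)` for tangent vectors `ξ = v ∘ φ`, `η = w ∘ φ`. -/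
def metric (φ ξ η : E3 → E3) : ℝ :=
  ∫ x in B, ∑ i, ∑ j,
    (fderiv ℝ (ξ ∘ inv φ) x (EuclideanSpace.single i 1)) j *
      (fderiv ℝ (η ∘ inv φ) x (EuclideanSpace.single i 1)) j

/-- The energy `Per(Φ(Ω₀))`, where `Φ` is the restriction of `φ` to the surface and `γ` is the
boundary of `Ω₀`: the total length of the boundary curves `Φ ∘ γ i` of `Φ(Ω₀)`. -/
def energy {m : ℕ} (γ : Fin m → ℝ → E2) (φ : E3 → E3) : ℝ :=
  ∑ i, ∫ s in (0 : ℝ)..1, ‖deriv (fun s => surf φ (γ i s)) s‖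

/-- `d = ⟨dE(φ), v ∘ φ⟩`, the derivative at `τ = 0` of the energy along the flow of `v`. -/
def HasEnergyVariation {m : ℕ} (γ : Fin m → ℝ → E2) (φ v : E3 → E3) (d : ℝ) : Prop :=
  ∃ ψ, IsFlow v ψ ∧ HasDerivAt (fun τ => energy γ (ψ τ ∘ φ)) d 0

/-- The velocity `∂_t φ` at time `t` of a path on the time interval `[0, T)`. -/
def velocity (T : ℝ) (φ : ℝ → E3 → E3) (t : ℝ) (x : E3) : E3 :=
  derivWithin (fun s => φ s x) (Ico 0 T) t

/-- The path `φ` of constrained diffeomorphisms is a gradient flow of the energy: at each time its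
velocity is tangent, and `g_φ(∂_t φ, v ∘ φ) = -⟨dE(φ), v ∘ φ⟩` for all smooth tangent vectors. -/
def IsGradientFlow {m : ℕ} (γ : Fin m → ℝ → E2) (T : ℝ) (φ : ℝ → E3 → E3) : Prop :=
  ∀ t ∈ Ico 0 T,
    (∃ w, IsTangentField (surf (φ t) '' interface γ) w ∧
      EqOn (velocity T φ t) (w ∘ φ t) Bbar) ∧
    ∀ v, IsTangentField ∅ v →
      HasEnergyVariation γ (φ t) v (-metric (φ t) (velocity T φ t) (v ∘ φ t))

/-! ### The constrained free boundary model -/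

/-- `∇_⊥ Π = F_s + F_l` in the sense of distributions on the plane. -/
def ForceBalance {m : ℕ} (D : Set E2) (γ : Fin m → ℝ → E2) (u : E3 → E3) (q : E2 → ℝ) : Prop :=
  LocallyIntegrable q ∧
    ∀ V : E2 → E2, ContDiff ℝ ∞ V → HasCompactSupport V →
      -∫ p, q p * div2 V p = (∫ p, inner ℝ (surfaceStress u p) (V p)) + lineTension D γ V

/-- The constrained model on the time interval `[0, T)`.  The unknowns are the domain `D t`, its
boundary curves `Γ i t`, the velocity `u t` and the pressure `P t` in the subfluid, and the surface
pressure `q t`. The surface velocity is the trace `surf (u t)`. -/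
structure IsConstrainedILLSS {m : ℕ} (T : ℝ) (D : ℝ → Set E2) (Γ : Fin m → ℝ → ℝ → E2)
    (u : ℝ → E3 → E3) (P : ℝ → E3 → ℝ) (q : ℝ → E2 → ℝ) : Prop where
  domain : ∀ t ∈ Ico 0 T, IsPhaseDomain (D t) (fun i => Γ i t)
  regular : ∀ t ∈ Ico 0 T, IsRegularField (interface fun i => Γ i t) (u t)
  incompressible : ∀ t ∈ Ico 0 T, ∀ x ∈ B, div3 (u t) x = 0
  pressure : ∀ t ∈ Ico 0 T, DifferentiableOn ℝ (P t) B
  stokes : ∀ t ∈ Ico 0 T, ∀ x ∈ B, Laplacian.laplacian (u t) x = gradient (P t) x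
  horizontal : ∀ t ∈ Ico 0 T, ∀ x ∈ Bbar, u t x 2 = 0
  surface_incompressible : ∀ t ∈ Ico 0 T, ∀ p ∉ interface fun i => Γ i t,
    div2 (surf (u t)) p = 0
  balance : ∀ t ∈ Ico 0 T, ForceBalance (D t) (fun i => Γ i t) (u t) (q t)
  kinematic : ∀ t ∈ Ico 0 T, ∀ i s,
    HasDerivWithinAt (fun r => Γ i r s) (surf (u t) (Γ i t s)) (Ico 0 T) t

end Langmuir

end

/-! ### Coordinates of the half space and integration over its horizontal slices. -/

noncomputable section
namespace Langmuir

/-! ### Coordinates -/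

/-! Time enters only through the advection of the curves, which is built into the flow of `φ`. By
the first variation of length, dE(v) = -∫ κ n·V ds with V the trace of v, the gradient condition at
a fixed time is `IsLengthGradient`: u is tangent, and the Dirichlet form D(u, v) equals the line
tension F_l(V) for every smooth tangent v (`isGradientFlow_iff`). What remains is static: this weak
identity has to be matched with the Stokes equation and the surface force balance.

From the weak identity to the model. A test field with zero trace feels no line tension. Rotated
horizontal gradients supported in B therefore show that the horizontal part of Δu is curl free on
each plane z = const. It is divergence free there, because u is solenoidal without vertical
component, and it decays, so Liouville's theorem gives Δu = 0 (`sum_pd_pd_eq_zero_of_orthogonal`).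
Green's identity (`dirichlet_eq_boundary`) turns D(u, v) into -∫ F_s·V. So F_s + F_l annihilates all
traces, and these include every smooth solenoidal planar field that is O(|p|⁻²) with its derivatives
(`isTangentField_vertExt`). For compactly supported V let W be the convolution of the gradient of
the logarithmic potential with div V. Since div V has mean zero, W and its derivatives are O(|p|⁻²),
and V - W is a field of that kind. Hence F_s + F_l agrees on V and W, and Fubini writes its value on
W as -∫ Π div V with an explicit potential Π (`exists_forceBalance`).

From the model to the weak identity. The vertical component of Δu = ∇P says that P does not depend
on z. Then Δu is constant on vertical lines, and its decay at great depth makes it zero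
(`sum_pd_pd_eq_zero_of_stokes`). Green's identity applies again, and the force balance gives the
identity for compactly supported solenoidal V. A general trace is reached by cutting off its stream
function, which is bounded (`dirichlet_eq_lineTension`).

For the first variation the flow is never differentiated in its initial point. The remainder in
ψ_τ(p) = p + τV(p) + ... is Lipschitz in p with constant O(τ²), so along a curve its derivative
exists almost everywhere and is O(τ²) (`hasDerivAt_length`). -/

/-- The standard basis of `ℝ³`. -/
abbrev e3 (i : Fin 3) : E3 := EuclideanSpace.single i 1

/-- The standard basis of the plane. -/
abbrev e2 (i : Fin 2) : E2 := EuclideanSpace.single i 1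

/-- The inclusion of the surface as a linear map. -/
def embL : E2 →L[ℝ] E3 :=
  LinearMap.toContinuousLinearMap
    { toFun := emb
      map_add' := fun p q => by ext i; fin_cases i <;> simp [emb, lift]
      map_smul' := fun a p => by ext i; fin_cases i <;> simp [emb, lift] }

/-- The horizontal part as a linear map. -/
def horL : E3 →L[ℝ] E2 :=
  LinearMap.toContinuousLinearMap
    { toFun := hor
      map_add' := fun p q => by ext i; fin_cases i <;> simp [hor]
      map_smul' := fun a p => by ext i; fin_cases i <;> simp [hor] }

@[simp] lemma embL_apply (p : E2) : embL p = emb p := rfl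
@[simp] lemma horL_apply (x : E3) : horL x = hor x := rfl

@[simp] lemma lift_zero' (p : E2) (z : ℝ) : lift p z 0 = p 0 := rfl
@[simp] lemma lift_one' (p : E2) (z : ℝ) : lift p z 1 = p 1 := rfl
@[simp] lemma lift_two' (p : E2) (z : ℝ) : lift p z 2 = z := rfl
@[simp] lemma hor_zero' (x : E3) : hor x 0 = x 0 := rfl
@[simp] lemma hor_one' (x : E3) : hor x 1 = x 1 := rfl
@[simp] lemma emb_zero' (p : E2) : emb p 0 = p 0 := rfl
@[simp] lemma emb_one' (p : E2) : emb p 1 = p 1 := rfl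
@[simp] lemma emb_two' (p : E2) : emb p 2 = 0 := rfl

lemma lift_zero_eq (p : E2) : lift p 0 = emb p := rfl

@[simp] lemma hor_lift (p : E2) (z : ℝ) : hor (lift p z) = p := by
  ext i; fin_cases i <;> rfl

@[simp] lemma hor_emb (p : E2) : hor (emb p) = p := hor_lift p 0

lemma lift_hor (x : E3) : lift (hor x) (x 2) = x := by
  ext i; fin_cases i <;> rfl

lemma emb_hor {x : E3} (h : x 2 = 0) : emb (hor x) = x := by
  rw [emb, ← h, lift_hor]

lemma lift_eq (p : E2) (z : ℝ) : lift p z = embL p + z • e3 2 := by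
  ext i; fin_cases i <;> simp

lemma norm_sq_lift (p : E2) (z : ℝ) : ‖lift p z‖ ^ 2 = ‖p‖ ^ 2 + z ^ 2 := by
  simp [EuclideanSpace.norm_sq_eq, Fin.sum_univ_three, lift_zero', lift_one', lift_two']

lemma norm_emb (p : E2) : ‖emb p‖ = ‖p‖ := by
  have h := norm_sq_lift p 0
  rw [lift_zero_eq] at h
  simpa using (sq_eq_sq₀ (norm_nonneg _) (norm_nonneg _)).1 (by simpa using h)

lemma norm_le_norm_lift (p : E2) (z : ℝ) : ‖p‖ ≤ ‖lift p z‖ :=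
  (sq_le_sq₀ (norm_nonneg _) (norm_nonneg _)).1 (by rw [norm_sq_lift]; nlinarith [sq_nonneg z])

lemma abs_le_norm_lift (p : E2) (z : ℝ) : |z| ≤ ‖lift p z‖ :=
  (sq_le_sq₀ (abs_nonneg _) (norm_nonneg _)).1 (by
    rw [norm_sq_lift, sq_abs]; nlinarith [sq_nonneg ‖p‖])

lemma norm_lift_le (p : E2) (z : ℝ) : ‖lift p z‖ ≤ ‖p‖ + |z| :=
  (sq_le_sq₀ (norm_nonneg _) (by positivity)).1 (by
    rw [norm_sq_lift, ← sq_abs z]; nlinarith [norm_nonneg p, abs_nonneg z])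

lemma norm_hor_le (x : E3) : ‖hor x‖ ≤ ‖x‖ := by
  conv_rhs => rw [← lift_hor x]
  exact norm_le_norm_lift _ _

lemma continuous_lift : Continuous fun q : E2 × ℝ => lift q.1 q.2 := by
  simp only [lift_eq]; fun_prop

lemma continuous_emb : Continuous emb := embL.continuous
lemma continuous_hor : Continuous hor := horL.continuous

lemma contDiff_emb {n : WithTop ℕ∞} : ContDiff ℝ n emb := embL.contDiff
lemma contDiff_hor {n : WithTop ℕ∞} : ContDiff ℝ n hor := horL.contDiff

lemma hasDerivAt_lift (p : E2) (z : ℝ) : HasDerivAt (fun z => lift p z) (e3 2) z := by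
  simp only [lift_eq]
  simpa using ((hasDerivAt_id z).smul_const (e3 2)).const_add (embL p)

lemma hasFDerivAt_lift (p : E2) (z : ℝ) : HasFDerivAt (fun p => lift p z) embL p := by
  simp only [lift_eq]
  exact embL.hasFDerivAt.add_const _

lemma hasFDerivAt_hor (x : E3) : HasFDerivAt hor horL x := horL.hasFDerivAt
lemma hasFDerivAt_emb (x : E2) : HasFDerivAt emb embL x := embL.hasFDerivAt

lemma emb_e2_zero : emb (e2 0) = e3 0 := by ext i; fin_cases i <;> simp
lemma emb_e2_one : emb (e2 1) = e3 1 := by ext i; fin_cases i <;> simp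

lemma inner_E3 (a b : E3) : inner ℝ a b = a 0 * b 0 + a 1 * b 1 + a 2 * b 2 := by
  simp [PiLp.inner_apply, Fin.sum_univ_three, mul_comm]

lemma inner_E2 (a b : E2) : inner ℝ a b = a 0 * b 0 + a 1 * b 1 := by
  simp [PiLp.inner_apply, mul_comm]

lemma norm_sq_E2 (a : E2) : ‖a‖ ^ 2 = a 0 ^ 2 + a 1 ^ 2 := by
  simp [EuclideanSpace.norm_sq_eq]

lemma E2_eq (p : E2) : p = p 0 • e2 0 + p 1 • e2 1 := by
  ext i; fin_cases i <;> simp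

/-! ### The half space -/

lemma isOpen_B : IsOpen B := isOpen_lt (by fun_prop) continuous_const

lemma isClosed_Bbar : IsClosed Bbar := isClosed_le (by fun_prop) continuous_const

lemma convex_Bbar : Convex ℝ Bbar := by
  intro x hx y hy a b ha hb hab
  simp only [Bbar, mem_ofPred_eq, PiLp.add_apply, PiLp.smul_apply, smul_eq_mul] at *
  nlinarith

lemma B_subset_Bbar : B ⊆ Bbar := fun x (h : x 2 < 0) => (h.le : x 2 ≤ 0)

lemma lift_mem_B {p : E2} {z : ℝ} : lift p z ∈ B ↔ z < 0 := Iff.rfl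
lemma lift_mem_Bbar {p : E2} {z : ℝ} : lift p z ∈ Bbar ↔ z ≤ 0 := Iff.rfl
lemma emb_mem_Bbar (p : E2) : emb p ∈ Bbar := le_refl (0 : ℝ)

lemma B_mem_nhds {x : E3} (h : x ∈ B) : B ∈ 𝓝 x := isOpen_B.mem_nhds h
lemma Bbar_mem_nhds {x : E3} (h : x ∈ B) : Bbar ∈ 𝓝 x :=
  mem_of_superset (B_mem_nhds h) B_subset_Bbar

lemma uniqueDiffOn_Bbar : UniqueDiffOn ℝ Bbar :=
  uniqueDiffOn_convex convex_Bbar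
    ⟨lift 0 (-1), mem_interior_iff_mem_nhds.2 (Bbar_mem_nhds (lift_mem_B.2 (by norm_num)))⟩

lemma B_subset_diff (S : Set E2) : B ⊆ Bbar \ emb '' S := by
  rintro x hx
  refine ⟨B_subset_Bbar hx, ?_⟩
  rintro ⟨p, -, rfl⟩
  exact lt_irrefl (0 : ℝ) hx

/-! ### Integration over the half space -/

/-- The splitting of space into horizontal planes, as an equivalence of measurable spaces. -/
def liftEquiv : E2 × ℝ ≃ᵐ E3 where
  toFun q := lift q.1 q.2
  invFun x := (hor x, x 2)
  left_inv q := by simp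
  right_inv x := lift_hor x
  measurable_toFun := continuous_lift.measurable
  measurable_invFun := (continuous_hor.prodMk (by fun_prop : Continuous fun x : E3 => x 2)).measurable

@[simp] lemma liftEquiv_apply (q : E2 × ℝ) : liftEquiv q = lift q.1 q.2 := rfl

/-- A composite of volume-preserving identifications with coordinate vectors, in which the height is
inserted at the last index. -/
lemma measurePreserving_lift : MeasurePreserving liftEquiv := by
  have h1 := (EuclideanSpace.volume_preserving_symm_measurableEquiv_toLp (Fin 3)).symm
  have h2 := (volume_preserving_piFinSuccAbove (fun _ : Fin 3 => ℝ) (Fin.last 2)).symm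
  have h3 := EuclideanSpace.volume_preserving_symm_measurableEquiv_toLp (Fin 2)
  have h4 := (MeasurePreserving.id (volume : Measure ℝ)).prod h3
  have h5 := Measure.measurePreserving_swap (μ := (volume : Measure E2)) (ν := (volume : Measure ℝ))
  have h : MeasurePreserving liftEquiv (volume.prod volume) volume := by
    refine (h1.comp (h2.comp (h4.comp h5))).congr liftEquiv.measurable (ae_of_all _ fun q => ?_)
    refine PiLp.ext fun i => ?_
    fin_cases i <;> rfl
  exact h

lemma integrableOn_B_iff {F : Type*} [NormedAddCommGroup F] {f : E3 → F} :
    IntegrableOn f B ↔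
      Integrable (fun q : E2 × ℝ => f (lift q.1 q.2)) (volume.prod (volume.restrict (Iio 0))) := by
  have h := measurePreserving_lift.integrableOn_comp_preimage liftEquiv.measurableEmbedding
    (f := f) (s := B)
  rw [← h]
  have : (volume.prod (volume.restrict (Iio 0)) : Measure (E2 × ℝ)) =
      (volume : Measure (E2 × ℝ)).restrict (liftEquiv ⁻¹' B) := by
    have h0 : (liftEquiv ⁻¹' B) = (univ : Set E2) ×ˢ (Iio (0:ℝ)) := by ext q; simp [lift_mem_B]
    rw [h0, Measure.volume_eq_prod, ← Measure.prod_restrict, Measure.restrict_univ]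
  rw [this]; rfl

lemma integral_B_eq {f : E3 → ℝ} (hf : IntegrableOn f B) :
    ∫ x in B, f x = ∫ z in Iio (0:ℝ), ∫ p, f (lift p z) := by
  have h := measurePreserving_lift.setIntegral_preimage_emb liftEquiv.measurableEmbedding f B
  have h0 : (liftEquiv ⁻¹' B) = (univ : Set E2) ×ˢ (Iio (0:ℝ)) := by ext q; simp [lift_mem_B]
  have hi := integrableOn_B_iff.1 hf
  rw [← h, h0, Measure.volume_eq_prod, ← Measure.prod_restrict, Measure.restrict_univ]
  exact integral_prod_symm _ hi

lemma integrable_slices {f : E3 → ℝ} (hf : IntegrableOn f B) :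
    IntegrableOn (fun z => ∫ p, f (lift p z)) (Iio 0) :=
  (integrableOn_B_iff.1 hf).integral_prod_right

end Langmuir
end

/-! ### Partial derivatives, and the decay of regular fields. -/

noncomputable section
namespace Langmuir

/-! ### Partial derivatives -/

variable {F : Type*} [NormedAddCommGroup F] [NormedSpace ℝ F]

lemma two_le_infty : (2 : WithTop ℕ∞) ≤ ∞ := ENat.LEInfty.out

/-- The partial derivative in space. -/
def pd (i : Fin 3) (f : E3 → F) (x : E3) : F := fderiv ℝ f x (e3 i)

lemma contDiffOn_pd {f : E3 → F} {s : Set E3} (hs : IsOpen s) (hf : ContDiffOn ℝ ∞ f s)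
    (i : Fin 3) : ContDiffOn ℝ ∞ (pd i f) s :=
  (hf.fderiv_of_isOpen hs (m := ∞) (by simp)).clm_apply contDiffOn_const

lemma pd_congr {f g : E3 → F} {s : Set E3} (hs : IsOpen s) (h : EqOn f g s) (i : Fin 3) :
    EqOn (pd i f) (pd i g) s := fun x hx => by
  rw [pd, pd, (h.eventuallyEq_of_mem (hs.mem_nhds hx)).fderiv_eq]

lemma norm_pd_le (f : E3 → F) (i : Fin 3) (x : E3) : ‖pd i f x‖ ≤ ‖fderiv ℝ f x‖ := by
  simpa [pd] using (fderiv ℝ f x).le_opNorm (e3 i)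

lemma pd_pd_eq {f : E3 → F} {x : E3} (hf : ContDiffAt ℝ 2 f x) (i j : Fin 3) :
    pd i (pd j f) x = iteratedFDeriv ℝ 2 f x ![e3 i, e3 j] := by
  have h : DifferentiableAt ℝ (fderiv ℝ f) x :=
    (hf.fderiv_right (m := 1) (by norm_num)).differentiableAt (by norm_num)
  rw [iteratedFDeriv_two_apply]
  have := h.hasFDerivAt.clm_apply (hasFDerivAt_const (e3 j) x)
  simp [pd, this.fderiv, show pd j f = fun y => fderiv ℝ f y (e3 j) from rfl]

lemma norm_pd_pd_le {f : E3 → F} {x : E3} (hf : ContDiffAt ℝ 2 f x) (i j : Fin 3) :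
    ‖pd i (pd j f) x‖ ≤ ‖iteratedFDeriv ℝ 2 f x‖ := by
  rw [pd_pd_eq hf]
  simpa [Fin.prod_univ_two] using (iteratedFDeriv ℝ 2 f x).le_opNorm ![e3 i, e3 j]

lemma pd_comm {f : E3 → F} {x : E3} (hf : ContDiffAt ℝ 2 f x) (i j : Fin 3) :
    pd i (pd j f) x = pd j (pd i f) x := by
  rw [pd_pd_eq hf, pd_pd_eq hf, iteratedFDeriv_two_apply, iteratedFDeriv_two_apply]
  exact (hf.isSymmSndFDerivAt (by simp)).eq _ _

lemma laplacian_eq {f : E3 → F} {x : E3} (hf : ContDiffAt ℝ 2 f x) :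
    Laplacian.laplacian f x = ∑ i, pd i (pd i f) x := by
  rw [laplacian_eq_iteratedFDeriv_orthonormalBasis f (EuclideanSpace.basisFun (Fin 3) ℝ)]
  simp [pd_pd_eq hf]

lemma pd_apply {f : E3 → E3} {x : E3} (hf : DifferentiableAt ℝ f x) (i j : Fin 3) :
    pd i f x j = pd i (fun y => f y j) x := by
  have := (EuclideanSpace.proj (𝕜 := ℝ) j).hasFDerivAt.comp x hf.hasFDerivAt
  have h2 := this.fderiv
  simp only [pd]
  change _ = fderiv ℝ ((EuclideanSpace.proj (𝕜 := ℝ) j) ∘ f) x (e3 i)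
  rw [h2]; rfl

/-! ### Fields in the half space -/

section Smooth

variable {f : E3 → F}

lemma contDiffAt_of_mem_B (hf : ContDiffOn ℝ ∞ f B) {x : E3} (hx : x ∈ B) {n : WithTop ℕ∞}
    (hn : n ≤ ∞) : ContDiffAt ℝ n f x := (hf.contDiffAt (B_mem_nhds hx)).of_le hn

lemma differentiableAt_of_mem_B (hf : ContDiffOn ℝ ∞ f B) {x : E3} (hx : x ∈ B) :
    DifferentiableAt ℝ f x :=
  (contDiffAt_of_mem_B hf hx le_rfl).differentiableAt (by simp)

lemma hasDerivAt_vertical (hf : ContDiffOn ℝ ∞ f B) {p : E2} {z : ℝ} (hz : z < 0) :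
    HasDerivAt (fun z => f (lift p z)) (pd 2 f (lift p z)) z :=
  (differentiableAt_of_mem_B hf (lift_mem_B.2 hz)).hasFDerivAt.comp_hasDerivAt z
    (hasDerivAt_lift p z)

lemma hasFDerivAt_slice (hf : ContDiffOn ℝ ∞ f B) (p : E2) {z : ℝ} (hz : z < 0) :
    HasFDerivAt (fun p => f (lift p z)) ((fderiv ℝ f (lift p z)).comp embL) p :=
  (differentiableAt_of_mem_B hf (lift_mem_B.2 hz)).hasFDerivAt.comp p
    (hasFDerivAt_lift p z)

lemma continuous_slice {F : Type*} [NormedAddCommGroup F] {f : E3 → F} (hf : ContinuousOn f B) {z : ℝ} (hz : z < 0) :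
    Continuous fun p => f (lift p z) := by
  refine continuousOn_univ.1 (hf.comp ?_ fun p _ => lift_mem_B.2 hz)
  exact (continuous_lift.comp (continuous_id.prodMk continuous_const)).continuousOn

end Smooth

/-- Quadratic decay at infinity of all derivatives on a set. -/
def DecaysOn (s : Set E3) (f : E3 → F) : Prop :=
  ∀ n : ℕ, ∃ C : ℝ, ∀ x ∈ s, ‖iteratedFDeriv ℝ n f x‖ ≤ C / (1 + ‖x‖) ^ 2

/-- Decay outside a ball becomes a global bound: inside, continuity and compactness bound the
function, and the weight is at most (1 + |R|)². -/
lemma exists_bound_of_decay {X F : Type*} [NormedAddCommGroup X] [ProperSpace X]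
    [NormedAddCommGroup F] {s : Set X}
    (hs : IsClosed s) {f : X → F}
    (hf : ContinuousOn f s) (hd : ∃ C R : ℝ, ∀ x ∈ s, R ≤ ‖x‖ → ‖f x‖ ≤ C / (1 + ‖x‖) ^ 2) :
    ∃ C : ℝ, 0 ≤ C ∧ ∀ x ∈ s, ‖f x‖ ≤ C / (1 + ‖x‖) ^ 2 := by
  obtain ⟨C, R, h⟩ := hd
  obtain ⟨M, hM⟩ := ((isCompact_closedBall (0 : X) R).inter_left hs).exists_bound_of_continuousOn
    (hf.mono inter_subset_left)
  refine ⟨max C (|M| * (1 + |R|) ^ 2), le_max_of_le_right (by positivity), fun x hx => ?_⟩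
  rcases le_or_gt R ‖x‖ with hR | hR
  · exact (h x hx hR).trans (by gcongr; exact le_max_left _ _)
  · have h1 := hM x ⟨hx, by simpa using hR.le⟩
    refine h1.trans ?_
    rw [le_div_iff₀ (by positivity)]
    refine le_trans ?_ (le_max_right _ _)
    have : ‖x‖ ≤ |R| := hR.le.trans (le_abs_self R)
    gcongr
    exact le_abs_self M

namespace IsRegularField

variable {S : Set E2} {u : E3 → E3}

lemma contDiffOn_B (hu : IsRegularField S u) : ContDiffOn ℝ ∞ u B :=
  hu.smooth.mono (B_subset_diff S)

lemma decay_B (hu : IsRegularField S u) (n : ℕ) : ∃ C R : ℝ, ∀ x ∈ B, R ≤ ‖x‖ →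
    ‖iteratedFDeriv ℝ n u x‖ ≤ C / (1 + ‖x‖) ^ 2 := by
  obtain ⟨C, R, h⟩ := hu.decay n
  refine ⟨C, R, fun x hx hR => ?_⟩
  have := h x (B_subset_Bbar hx) hR
  rwa [iteratedFDerivWithin_eq_iteratedFDeriv uniqueDiffOn_Bbar
    (contDiffAt_of_mem_B hu.contDiffOn_B hx (by exact_mod_cast le_top)) (B_subset_Bbar hx)] at this

/-- The closed set z ≤ a does not meet the surface, so the singularities along `S` are out of reach
of the compactness argument. -/
lemma slab_decay (hu : IsRegularField S u) {a : ℝ} (ha : a < 0) :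
    DecaysOn {x | x 2 ≤ a} u := by
  intro n
  have hsub : {x : E3 | x 2 ≤ a} ⊆ B := fun x (hx : x 2 ≤ a) => show x 2 < 0 from hx.trans_lt ha
  obtain ⟨C, R, h⟩ := hu.decay_B n
  have hc : IsClosed {x : E3 | x 2 ≤ a} := isClosed_le (by fun_prop) continuous_const
  obtain ⟨C', -, h'⟩ := exists_bound_of_decay hc (f := iteratedFDeriv ℝ n u) (fun x hx => by
    refine ContinuousAt.continuousWithinAt ?_
    exact (contDiffAt_of_mem_B hu.contDiffOn_B (hsub hx) le_rfl).continuousAt_iteratedFDeriv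
      (by exact_mod_cast le_top))
    ⟨C, R, fun x hx => h x (hsub hx)⟩
  exact ⟨C', h'⟩

/-- Among the first derivatives only the vertical one has a bound up to the singular curves; this
dominates the flux integrals when z tends to 0. -/
lemma z_decay (hu : IsRegularField S u) : ∃ C, 0 ≤ C ∧ ∀ x ∈ B,
    ‖pd 2 u x‖ ≤ C / (1 + ‖x‖) ^ 2 := by
  obtain ⟨C, R, h⟩ := hu.decay_B 1
  obtain ⟨M, hM⟩ := hu.z_bounded
  refine ⟨max C (|M| * (1 + |R|) ^ 2), le_max_of_le_right (by positivity), fun x hx => ?_⟩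
  rcases le_or_gt R ‖x‖ with hR | hR
  · have h2 := h x hx hR
    rw [norm_iteratedFDeriv_one] at h2
    exact (norm_pd_le u 2 x).trans (h2.trans (by gcongr; exact le_max_left _ _))
  · refine (hM x hx).trans ?_
    rw [le_div_iff₀ (by positivity)]
    refine le_trans ?_ (le_max_right _ _)
    have : ‖x‖ ≤ |R| := hR.le.trans (le_abs_self R)
    gcongr
    exact le_abs_self M

lemma contDiffOn_Bbar (hv : IsRegularField ∅ u) : ContDiffOn ℝ ∞ u Bbar := by
  simpa using hv.smooth

lemma closed_decay (hv : IsRegularField ∅ u) (n : ℕ) : ∃ C, 0 ≤ C ∧ ∀ x ∈ Bbar,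
    ‖iteratedFDerivWithin ℝ n u Bbar x‖ ≤ C / (1 + ‖x‖) ^ 2 :=
  exists_bound_of_decay isClosed_Bbar
    (hv.contDiffOn_Bbar.continuousOn_iteratedFDerivWithin (by exact_mod_cast le_top)
      uniqueDiffOn_Bbar) (hv.decay n)

lemma decaysOn_B (hv : IsRegularField ∅ u) : DecaysOn B u := by
  intro n
  obtain ⟨C, -, h⟩ := hv.closed_decay n
  refine ⟨C, fun x hx => ?_⟩
  have := h x (B_subset_Bbar hx)
  rwa [iteratedFDerivWithin_eq_iteratedFDeriv uniqueDiffOn_Bbar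
    (contDiffAt_of_mem_B hv.contDiffOn_B hx (by exact_mod_cast le_top)) (B_subset_Bbar hx)] at this

/-- The trace of a smooth field is smooth. -/
lemma contDiff_surf (hv : IsRegularField ∅ u) : ContDiff ℝ ∞ (surf u) := by
  have h : ContDiffOn ℝ ∞ (u ∘ emb) univ :=
    hv.contDiffOn_Bbar.comp contDiff_emb.contDiffOn (fun p _ => emb_mem_Bbar p)
  exact contDiff_hor.comp (contDiffOn_univ.1 h)

lemma surf_decay (hv : IsRegularField ∅ u) (n : ℕ) : ∃ C, 0 ≤ C ∧ ∀ p,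
    ‖iteratedFDeriv ℝ n (surf u) p‖ ≤ C / (1 + ‖p‖) ^ 2 := by
  obtain ⟨C, hC, h⟩ := hv.closed_decay n
  have hpre : embL ⁻¹' Bbar = univ := eq_univ_of_forall fun p => emb_mem_Bbar p
  have hE : ‖embL‖ ≤ 1 := embL.opNorm_le_bound zero_le_one fun p => by simp [norm_emb]
  have hH : ‖horL‖ ≤ 1 := horL.opNorm_le_bound zero_le_one fun p => by simpa using norm_hor_le p
  have hs : ContDiff ℝ ∞ (u ∘ embL) := contDiffOn_univ.1
    (hv.contDiffOn_Bbar.comp contDiff_emb.contDiffOn (fun p _ => emb_mem_Bbar p))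
  refine ⟨C, hC, fun p => ?_⟩
  have h1 : ‖iteratedFDeriv ℝ n (surf u) p‖ ≤ ‖horL‖ * ‖iteratedFDeriv ℝ n (u ∘ embL) p‖ :=
    ContinuousLinearMap.norm_iteratedFDeriv_comp_left horL (f := u ∘ embL) hs.contDiffAt
      (by exact_mod_cast le_top)
  have h2 := embL.iteratedFDerivWithin_comp_right (f := u) (s := Bbar) (i := n) (x := p)
    hv.contDiffOn_Bbar uniqueDiffOn_Bbar (by rw [hpre]; exact uniqueDiffOn_univ) (emb_mem_Bbar p)
    (by exact_mod_cast le_top)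
  rw [hpre, iteratedFDerivWithin_univ] at h2
  have h3 : ‖iteratedFDeriv ℝ n (u ∘ embL) p‖ ≤ ‖iteratedFDerivWithin ℝ n u Bbar (emb p)‖ := by
    rw [h2]
    refine (ContinuousMultilinearMap.norm_compContinuousLinearMap_le _ _).trans ?_
    refine mul_le_of_le_one_right (norm_nonneg _) (Finset.prod_le_one (fun _ _ => norm_nonneg _)
      fun _ _ => hE)
  have h4 := h (emb p) (emb_mem_Bbar p)
  rw [norm_emb] at h4
  calc _ ≤ 1 * ‖iteratedFDeriv ℝ n (u ∘ embL) p‖ := h1.trans (by gcongr)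
    _ ≤ _ := by rw [one_mul]; exact h3.trans h4

end IsRegularField

end Langmuir
end

/-! ### Green's identity up to a surface with singular curves. -/

noncomputable section
namespace Langmuir

/-! ### Green's identity in the half space -/

lemma integrable_div_one_add_norm_pow (C : ℝ) {n : ℕ} (hn : 2 < n) :
    Integrable fun p : E2 => C / (1 + ‖p‖) ^ n := by
  have h := (integrable_one_add_norm (E := E2) (μ := volume) (r := n) (by
    simp only [finrank_euclideanSpace, Fintype.card_fin]; exact_mod_cast hn)).const_mul C
  refine h.congr (ae_of_all _ fun p => ?_)
  simp [Real.rpow_neg (by positivity : (0:ℝ) ≤ 1 + ‖p‖), div_eq_mul_inv]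

/-- The pointwise inner product of two gradients. -/
def gradInner (u v : E3 → E3) (x : E3) : ℝ := ∑ i, inner ℝ (pd i u x) (pd i v x)

/-- The Dirichlet form of the half space. -/
def dirichlet (u v : E3 → E3) : ℝ := ∫ x in B, gradInner u v x

/-- The one-sided vertical derivative at the surface. -/
def normalDeriv (u : E3 → E3) (p : E2) : E3 := derivWithin (fun z => u (lift p z)) (Iic 0) 0

section
variable {S : Set E2} {u v : E3 → E3}

lemma IsRegularField.continuousOn_pd (hu : IsRegularField S u) (i : Fin 3) :
    ContinuousOn (pd i u) B := (contDiffOn_pd isOpen_B hu.contDiffOn_B i).continuousOn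

lemma integrableOn_gradInner (hu : IsRegularField S u) {S' : Set E2} (hv : IsRegularField S' v) :
    IntegrableOn (gradInner u v) B := by
  -- Each of the three inner products is at most half the sum of the squared gradients.
  have h := (hu.energy.add hv.energy).const_mul (3 / 2)
  refine h.mono ?_ (ae_of_all _ fun x => ?_)
  · refine ContinuousOn.aestronglyMeasurable ?_ isOpen_B.measurableSet
    unfold gradInner
    exact continuousOn_finsetSum _ fun i _ => (hu.continuousOn_pd i).inner (hv.continuousOn_pd i)
  · have h1 : ∀ i, ‖inner ℝ (pd i u x) (pd i v x)‖ ≤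
        (‖fderiv ℝ u x‖ ^ 2 + ‖fderiv ℝ v x‖ ^ 2) / 2 := fun i => by
      have h1 := norm_inner_le_norm (𝕜 := ℝ) (pd i u x) (pd i v x)
      have h2 : ‖pd i u x‖ * ‖pd i v x‖ ≤ ‖fderiv ℝ u x‖ * ‖fderiv ℝ v x‖ :=
        mul_le_mul (norm_pd_le u i x) (norm_pd_le v i x) (norm_nonneg _) (norm_nonneg _)
      nlinarith [sq_nonneg (‖fderiv ℝ u x‖ - ‖fderiv ℝ v x‖)]
    calc ‖gradInner u v x‖ ≤ ∑ i, ‖inner ℝ (pd i u x) (pd i v x)‖ := norm_sum_le _ _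
      _ ≤ ∑ _i : Fin 3, (‖fderiv ℝ u x‖ ^ 2 + ‖fderiv ℝ v x‖ ^ 2) / 2 :=
        Finset.sum_le_sum fun i _ => h1 i
      _ = 3 / 2 * (‖fderiv ℝ u x‖ ^ 2 + ‖fderiv ℝ v x‖ ^ 2) := by simp; ring
      _ ≤ _ := by
        rw [Real.norm_eq_abs]; exact le_abs_self _

lemma contDiffOn_vertical (hu : IsRegularField S u) {p : E2} (hp : p ∉ S) :
    ContDiffOn ℝ ∞ (fun z => u (lift p z)) (Iic 0) := by
  refine hu.smooth.comp (t := Bbar \ emb '' S) (g := u) (f := fun z => lift p z) ?_ ?_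
  · simp only [lift_eq]; fun_prop
  · intro z hz
    refine ⟨lift_mem_Bbar.2 hz, ?_⟩
    rintro ⟨q, hq, h⟩
    have := congrArg hor h
    simp only [hor_emb, hor_lift] at this
    exact hp (this ▸ hq)

/-- The vertical line through a point off `S` avoids the singular set, so the field is smooth along
it up to the surface. -/
lemma tendsto_normalDeriv (hu : IsRegularField S u) {p : E2} (hp : p ∉ S) :
    Tendsto (fun z => pd 2 u (lift p z)) (𝓝[<] 0) (𝓝 (normalDeriv u p)) := by
  have h := (contDiffOn_vertical hu hp).continuousOn_derivWithin (uniqueDiffOn_Iic 0)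
    (by simp) 0 (mem_Iic.2 le_rfl)
  have h2 := h.tendsto.mono_left (nhdsWithin_mono 0 Iio_subset_Iic_self)
  refine h2.congr' ?_
  filter_upwards [self_mem_nhdsWithin] with z hz
  rw [derivWithin_of_mem_nhds (Iic_mem_nhds hz), (hasDerivAt_vertical hu.contDiffOn_B hz).deriv]

lemma norm_div_le_of_lift (C : ℝ) (hC : 0 ≤ C) (p : E2) (z : ℝ) (n : ℕ) :
    C / (1 + ‖lift p z‖) ^ n ≤ C / (1 + ‖p‖) ^ n := by
  have := norm_le_norm_lift p z
  gcongr

lemma norm_normalDeriv_le (hu : IsRegularField S u) :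
    ∃ C, 0 ≤ C ∧ ∀ p ∉ S, ‖normalDeriv u p‖ ≤ C / (1 + ‖p‖) ^ 2 := by
  obtain ⟨C, hC, h⟩ := hu.z_decay
  refine ⟨C, hC, fun p hp => ?_⟩
  refine le_of_tendsto (tendsto_normalDeriv hu hp).norm ?_
  filter_upwards [self_mem_nhdsWithin] with z hz
  exact (h _ (lift_mem_B.2 hz)).trans (norm_div_le_of_lift C hC p z 2)

lemma continuous_slice_pd (hu : IsRegularField S u) (i : Fin 3) {z : ℝ} (hz : z < 0) :
    Continuous fun p => pd i u (lift p z) := continuous_slice (hu.continuousOn_pd i) hz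

/-- Off the null set `S` this is the pointwise limit of the continuous slices of ∂_z u at the
heights -1/(n+1). -/
lemma aestronglyMeasurable_normalDeriv (hu : IsRegularField S u) (hS : volume S = 0) :
    AEStronglyMeasurable (normalDeriv u) volume := by
  have ht : Tendsto (fun n : ℕ => -(1 / ((n : ℝ) + 1))) atTop (𝓝[<] 0) := by
    refine tendsto_nhdsWithin_iff.2 ⟨?_, Eventually.of_forall fun n => ?_⟩
    · simpa using (tendsto_one_div_add_atTop_nhds_zero_nat (𝕜 := ℝ)).neg
    · simp only [mem_Iio, Left.neg_neg_iff]; positivity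
  refine aestronglyMeasurable_of_tendsto_ae atTop
    (f := fun (n : ℕ) p => pd 2 u (lift p (-(1 / ((n : ℝ) + 1)))))
    (fun n => (continuous_slice_pd hu 2 (by
      simp only [Left.neg_neg_iff]; positivity)).aestronglyMeasurable) ?_
  filter_upwards [compl_mem_ae_iff.2 hS] with p hp
  exact (tendsto_normalDeriv hu hp).comp ht

/-- All the products that occur in Green's identity decay like `|x|⁻⁴` away from the surface. -/
lemma exists_slab_bound (hu : IsRegularField S u) (hv : IsRegularField ∅ v) {a : ℝ} (ha : a < 0) :
    ∃ C, 0 ≤ C ∧ ∀ p z, z ≤ a → ∀ i,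
      ‖v (lift p z)‖ * ‖pd i u (lift p z)‖ ≤ C / (1 + ‖lift p z‖) ^ 4 ∧
      ‖v (lift p z)‖ * ‖pd i (pd i u) (lift p z)‖ ≤ C / (1 + ‖lift p z‖) ^ 4 ∧
      ‖pd i v (lift p z)‖ * ‖pd i u (lift p z)‖ ≤ C / (1 + ‖lift p z‖) ^ 4 := by
  obtain ⟨a0, h0⟩ := hv.decaysOn_B 0
  obtain ⟨a1, h1⟩ := hv.decaysOn_B 1
  obtain ⟨b1, k1⟩ := hu.slab_decay ha 1
  obtain ⟨b2, k2⟩ := hu.slab_decay ha 2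
  refine ⟨max |a0| |a1| * max |b1| |b2|, by positivity, fun p z hz i => ?_⟩
  have hx : lift p z ∈ B := lift_mem_B.2 (hz.trans_lt ha)
  set x := lift p z with hxd
  have hxa : x 2 ≤ a := hz
  have key : ∀ {s t α β : ℝ}, 0 ≤ s → 0 ≤ t → s ≤ α / (1 + ‖x‖) ^ 2 → t ≤ β / (1 + ‖x‖) ^ 2 →
      |α| ≤ max |a0| |a1| → |β| ≤ max |b1| |b2| →
      s * t ≤ max |a0| |a1| * max |b1| |b2| / (1 + ‖x‖) ^ 4 := by
    intro s t α β hs ht h h' hα hβ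
    have e : max |a0| |a1| * max |b1| |b2| / (1 + ‖x‖) ^ 4 =
        max |a0| |a1| / (1 + ‖x‖) ^ 2 * (max |b1| |b2| / (1 + ‖x‖) ^ 2) := by
      field_simp
    rw [e]
    refine mul_le_mul (h.trans ?_) (h'.trans ?_) ht (by positivity)
    · gcongr; exact (le_abs_self _).trans hα
    · gcongr; exact (le_abs_self _).trans hβ
  have g0 : ‖v x‖ ≤ a0 / (1 + ‖x‖) ^ 2 := by simpa using h0 x hx
  have g1 : ‖pd i v x‖ ≤ a1 / (1 + ‖x‖) ^ 2 := by
    have := h1 x hx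
    rw [norm_iteratedFDeriv_one] at this
    exact (norm_pd_le v i x).trans this
  have g2 : ‖pd i u x‖ ≤ b1 / (1 + ‖x‖) ^ 2 := by
    have := k1 x hxa
    rw [norm_iteratedFDeriv_one] at this
    exact (norm_pd_le u i x).trans this
  have g3 : ‖pd i (pd i u) x‖ ≤ b2 / (1 + ‖x‖) ^ 2 :=
    (norm_pd_pd_le (contDiffAt_of_mem_B hu.contDiffOn_B hx two_le_infty) i i).trans
      (k2 x hxa)
  exact ⟨key (norm_nonneg _) (norm_nonneg _) g0 g2 (le_max_left _ _) (le_max_left _ _),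
    key (norm_nonneg _) (norm_nonneg _) g0 g3 (le_max_left _ _) (le_max_right _ _),
    key (norm_nonneg _) (norm_nonneg _) g1 g2 (le_max_right _ _) (le_max_left _ _)⟩

lemma integrable_slice_inner {f g : E3 → E3} (hf : ContinuousOn f B) (hg : ContinuousOn g B)
    {z C : ℝ} (hz : z < 0)
    (h : ∀ p, ‖f (lift p z)‖ * ‖g (lift p z)‖ ≤ C / (1 + ‖p‖) ^ 4) :
    Integrable fun p => inner ℝ (f (lift p z)) (g (lift p z)) :=
  (integrable_div_one_add_norm_pow C (by norm_num : 2 < 4)).mono'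
    ((continuous_slice hf hz).inner (continuous_slice hg hz)).aestronglyMeasurable
    (ae_of_all _ fun p => (norm_inner_le_norm _ _).trans (h p))

/-- Integration by parts inside one horizontal plane; the products decay like |p|⁻⁴, so nothing is
left at infinity. -/
lemma slice_integral_by_parts (hu : IsRegularField S u) (hv : IsRegularField ∅ v) {z : ℝ}
    (hz : z < 0) (i : Fin 3) (j : Fin 2) (hij : emb (e2 j) = e3 i) :
    ∫ p, inner ℝ (v (lift p z)) (pd i (pd i u) (lift p z)) =
      -∫ p, inner ℝ (pd i v (lift p z)) (pd i u (lift p z)) := by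
  obtain ⟨C, hC, h⟩ := exists_slab_bound hu hv hz
  have h' := fun p => h p z le_rfl i
  have hb := fun p => norm_div_le_of_lift C hC p z 4
  have hpu := contDiffOn_pd isOpen_B hu.contDiffOn_B i
  have main := integral_bilinear_hasFDerivAt_right_eq_neg_left_of_integrable (μ := volume)
    (f := fun p => v (lift p z)) (g := fun p => pd i u (lift p z)) (v := e2 j) (B := innerSL ℝ)
    (f' := fun p => (fderiv ℝ v (lift p z)).comp embL)
    (g' := fun p => (fderiv ℝ (pd i u) (lift p z)).comp embL) ?_ ?_ ?_ ?_ ?_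
  · simp only [ContinuousLinearMap.comp_apply, embL_apply, hij] at main
    exact main
  · simp only [ContinuousLinearMap.comp_apply, embL_apply, hij]
    exact integrable_slice_inner (f := pd i v) (g := pd i u) (hv.continuousOn_pd i)
      (hu.continuousOn_pd i) hz fun p => (h' p).2.2.trans (hb p)
  · simp only [ContinuousLinearMap.comp_apply, embL_apply, hij]
    exact integrable_slice_inner (f := v) (g := pd i (pd i u)) hv.contDiffOn_B.continuousOn
      (contDiffOn_pd isOpen_B hpu i).continuousOn hz fun p => (h' p).2.1.trans (hb p)
  · exact integrable_slice_inner (f := v) (g := pd i u) hv.contDiffOn_B.continuousOn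
      hpu.continuousOn hz fun p => (h' p).1.trans (hb p)
  · exact fun p _ => hasFDerivAt_slice hv.contDiffOn_B p hz
  · exact fun p _ => hasFDerivAt_slice hpu p hz

/-- Differentiation gives v·u_zz + v_z·u_z. Harmonicity replaces u_zz by -u_xx - u_yy, and
integration by parts in the plane turns these terms into the horizontal part of the gradient
product. -/
lemma hasDerivAt_slice_flux (hu : IsRegularField S u) (hv : IsRegularField ∅ v) {z : ℝ}
    (hz : z < 0) (hΔ : ∀ x ∈ B, ∑ i, pd i (pd i u) x = 0) :
    HasDerivAt (fun z => ∫ p, inner ℝ (v (lift p z)) (pd 2 u (lift p z)))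
      (∫ p, gradInner u v (lift p z)) z := by
  -- The heights below z/2 form a neighbourhood of z on which all bounds are uniform, away from the
  -- surface.
  have hz2 : z / 2 < 0 := by linarith
  obtain ⟨C, hC, h⟩ := exists_slab_bound hu hv hz2
  have hb := fun p z => norm_div_le_of_lift C hC p z 4
  have hpu := contDiffOn_pd isOpen_B hu.contDiffOn_B
  have hppu := fun i => (contDiffOn_pd isOpen_B (hpu i) i).continuousOn
  have hvc := hv.contDiffOn_B.continuousOn
  have hnhd : Iio (z / 2) ∈ 𝓝 z := Iio_mem_nhds (by linarith)
  have I1 : ∀ i, Integrable fun p => inner ℝ (v (lift p z)) (pd i (pd i u) (lift p z)) := fun i =>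
    integrable_slice_inner hvc (hppu i) hz fun p => (h p z (by linarith) i).2.1.trans (hb p z)
  have I2 : ∀ i, Integrable fun p => inner ℝ (pd i v (lift p z)) (pd i u (lift p z)) := fun i =>
    integrable_slice_inner (hv.continuousOn_pd i) (hu.continuousOn_pd i) hz
      fun p => (h p z (by linarith) i).2.2.trans (hb p z)
  have main := (hasDerivAt_integral_of_dominated_loc_of_deriv_le (μ := volume)
    (F := fun z p => inner ℝ (v (lift p z)) (pd 2 u (lift p z)))
    (F' := fun z p => inner ℝ (v (lift p z)) (pd 2 (pd 2 u) (lift p z)) +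
      inner ℝ (pd 2 v (lift p z)) (pd 2 u (lift p z)))
    (bound := fun p => C / (1 + ‖p‖) ^ 4 + C / (1 + ‖p‖) ^ 4) hnhd ?_ ?_ ?_ ?_ ?_ ?_).2
  · refine main.congr_deriv ?_
    rw [integral_add (I1 2) (I2 2)]
    have e : ∀ p, inner ℝ (v (lift p z)) (pd 2 (pd 2 u) (lift p z)) =
        -inner ℝ (v (lift p z)) (pd 0 (pd 0 u) (lift p z)) -
          inner ℝ (v (lift p z)) (pd 1 (pd 1 u) (lift p z)) := fun p => by
      have := hΔ _ (lift_mem_B.2 hz : lift p z ∈ B)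
      rw [Fin.sum_univ_three] at this
      rw [eq_neg_of_add_eq_zero_right this, inner_neg_right, inner_add_right]; ring
    simp_rw [e]
    have s0 := slice_integral_by_parts hu hv hz 0 0 emb_e2_zero
    have s1 := slice_integral_by_parts hu hv hz 1 1 emb_e2_one
    have hg : ∀ p, gradInner u v (lift p z) = inner ℝ (pd 0 v (lift p z)) (pd 0 u (lift p z)) +
        inner ℝ (pd 1 v (lift p z)) (pd 1 u (lift p z)) +
        inner ℝ (pd 2 v (lift p z)) (pd 2 u (lift p z)) := fun p => by
      simp only [gradInner, Fin.sum_univ_three, real_inner_comm]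
    simp_rw [hg]
    rw [integral_sub (I1 0).fun_neg (I1 1), integral_neg, s0, s1,
      integral_add ((I2 0).fun_add (I2 1)) (I2 2), integral_add (I2 0) (I2 1)]
    ring
  · filter_upwards [hnhd] with y hy
    have hy0 : y < 0 := lt_trans hy hz2
    exact ((continuous_slice hvc hy0).inner
      (continuous_slice_pd hu 2 hy0)).aestronglyMeasurable
  · exact integrable_slice_inner hvc (hu.continuousOn_pd 2) hz
      fun p => (h p z (by linarith) 2).1.trans (hb p z)
  · exact ((I1 2).add (I2 2)).aestronglyMeasurable
  · refine ae_of_all _ fun p y hy => ?_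
    obtain ⟨-, h2, h3⟩ := h p y (le_of_lt hy) 2
    exact (norm_add_le _ _).trans (add_le_add
      ((norm_inner_le_norm _ _).trans (h2.trans (hb p y)))
      ((norm_inner_le_norm _ _).trans (h3.trans (hb p y))))
  · exact (integrable_div_one_add_norm_pow C (by norm_num)).add
      (integrable_div_one_add_norm_pow C (by norm_num))
  · refine ae_of_all _ fun p y hy => ?_
    have hy0 : y < 0 := lt_trans hy hz2
    exact (hasDerivAt_vertical hv.contDiffOn_B hy0).inner ℝ (hasDerivAt_vertical (hpu 2) hy0)

/-- **Green's identity** for a harmonic field. -/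
theorem dirichlet_eq_boundary (hu : IsRegularField S u) (hS : volume S = 0)
    (hv : IsRegularField ∅ v) (hΔ : ∀ x ∈ B, ∑ i, pd i (pd i u) x = 0) :
    dirichlet u v = ∫ p, inner ℝ (v (emb p)) (normalDeriv u p) := by
  classical
  set A : ℝ → ℝ := fun z => ∫ p, inner ℝ (v (lift p z)) (pd 2 u (lift p z)) with hA
  set L := ∫ p, inner ℝ (v (emb p)) (normalDeriv u p) with hL
  obtain ⟨Cu, hCu, hub⟩ := hu.z_decay
  obtain ⟨Cv, hCv, hvb⟩ := hv.closed_decay 0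
  have hvb' : ∀ x ∈ Bbar, ‖v x‖ ≤ Cv / (1 + ‖x‖) ^ 2 := fun x hx => by simpa using hvb x hx
  have hprod : ∀ p z, z < 0 → ‖inner ℝ (v (lift p z)) (pd 2 u (lift p z))‖ ≤
      Cv * Cu / (1 + ‖lift p z‖) ^ 4 := fun p z hz => by
    have e : Cv * Cu / (1 + ‖lift p z‖) ^ 4 =
        Cv / (1 + ‖lift p z‖) ^ 2 * (Cu / (1 + ‖lift p z‖) ^ 2) := by field_simp
    rw [e]
    exact (norm_inner_le_norm _ _).trans (mul_le_mul (hvb' _ (lift_mem_Bbar.2 hz.le))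
      (hub _ (lift_mem_B.2 hz)) (norm_nonneg _) (by positivity))
  -- Dominated convergence: the bound (1 + |p|)⁻⁴ is uniform in z, and convergence can fail only on
  -- the null set `S`.
  have hA0 : Tendsto A (𝓝[<] 0) (𝓝 L) := by
    refine tendsto_integral_filter_of_dominated_convergence (fun p => Cv * Cu / (1 + ‖p‖) ^ 4)
      ?_ ?_ (integrable_div_one_add_norm_pow _ (by norm_num)) ?_
    · filter_upwards [self_mem_nhdsWithin] with z hz
      exact ((continuous_slice hv.contDiffOn_B.continuousOn hz).inner
        (continuous_slice_pd hu 2 hz)).aestronglyMeasurable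
    · filter_upwards [self_mem_nhdsWithin] with z hz
      exact ae_of_all _ fun p => (hprod p z hz).trans (norm_div_le_of_lift _ (by positivity) p z 4)
    · filter_upwards [compl_mem_ae_iff.2 hS] with p hp
      refine Tendsto.inner ?_ (tendsto_normalDeriv hu hp)
      have h1 : ContinuousWithinAt (fun z => v (lift p z)) (Iic 0) 0 :=
        (contDiffOn_vertical hv (notMem_empty p)).continuousOn 0 (mem_Iic.2 le_rfl)
      exact h1.tendsto.mono_left (nhdsWithin_mono 0 Iio_subset_Iic_self)
  -- Of the four powers of decay one is spent on |z|; the other three remain integrable over the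
  -- plane.
  have hAbot : Tendsto A atBot (𝓝 0) := by
    set M := ∫ p : E2, Cv * Cu / (1 + ‖p‖) ^ 3 with hM
    have hlim : Tendsto (fun z : ℝ => M / (1 + |z|)) atBot (𝓝 0) :=
      tendsto_const_nhds.div_atTop (tendsto_atTop_add_const_left _ _ tendsto_abs_atBot_atTop)
    refine squeeze_zero_norm' ?_ hlim
    filter_upwards [eventually_lt_atBot (0:ℝ)] with z hz
    have : M / (1 + |z|) = ∫ p : E2, (Cv * Cu / (1 + ‖p‖) ^ 3) / (1 + |z|) := by
      rw [integral_div]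
    rw [this]
    refine norm_integral_le_of_norm_le
      ((integrable_div_one_add_norm_pow _ (by norm_num)).div_const _)
      (ae_of_all _ fun p => (hprod p z hz).trans ?_)
    rw [div_div, pow_succ (1 + ‖lift p z‖)]
    have h1 := norm_le_norm_lift p z
    have h2 := abs_le_norm_lift p z
    gcongr
  have hint := integrable_slices (integrableOn_gradInner hu hv)
  -- At z = 0 the formula for `A` involves two-sided derivatives of u, which need not exist, so the
  -- limit `L` is put there instead.
  have hFTC := integral_Iic_of_hasDerivAt_of_tendsto (a := 0) (f := Function.update A 0 L)
    (f' := fun z => ∫ p, gradInner u v (lift p z)) (m := 0) ?_ ?_ ?_ ?_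
  · rw [dirichlet, integral_B_eq (integrableOn_gradInner hu hv), ← integral_Iic_eq_integral_Iio,
      hFTC]
    simp
  · rw [continuousWithinAt_update_same]
    simpa using hA0
  · intro z hz
    refine (hasDerivAt_slice_flux hu hv hz hΔ).congr_of_eventuallyEq ?_
    filter_upwards [Iio_mem_nhds hz] with y hy
    exact Function.update_of_ne (ne_of_lt hy) _ _
  · exact (integrableOn_Iic_iff_integrableOn_Iio (by simp)).2 hint
  · refine hAbot.congr' ?_
    filter_upwards [eventually_lt_atBot (0:ℝ)] with y hy
    exact (Function.update_of_ne (ne_of_lt hy) _ _).symm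

end
end Langmuir
end

/-! ### Orthogonality to interior test fields forces harmonicity. -/

noncomputable section
namespace Langmuir

/-! ### Compactly supported test fields -/

lemma isRegularField_of_compactSupport {v : E3 → E3} (hv : ContDiff ℝ ∞ v)
    (hc : HasCompactSupport v) : IsRegularField ∅ v where
  continuousOn := hv.continuous.continuousOn
  smooth := hv.contDiffOn
  z_bounded := by
    obtain ⟨C, hC⟩ := (hc.fderiv_apply ℝ (e3 2)).exists_bound_of_continuous
      ((hv.continuous_fderiv (by simp)).clm_apply continuous_const)
    exact ⟨C, fun x _ => hC x⟩
  energy := by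
    have h : Continuous fun x => ‖fderiv ℝ v x‖ ^ 2 := (hv.continuous_fderiv (by simp)).norm.pow 2
    refine (h.integrable_of_hasCompactSupport ?_).integrableOn
    exact (hc.fderiv ℝ).comp_left (g := fun L => ‖L‖ ^ 2) (by simp)
  decay := fun n => by
    obtain ⟨R, hR⟩ := hc.isCompact.isBounded.subset_closedBall 0
    refine ⟨0, R + 1, fun x hx h => ?_⟩
    have h0 : iteratedFDeriv ℝ n v x = 0 := by
      by_contra hne
      have := hR (support_iteratedFDeriv_subset n (Function.mem_support.2 hne))
      rw [mem_closedBall_zero_iff] at this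
      linarith
    rw [iteratedFDerivWithin_eq_iteratedFDeriv uniqueDiffOn_Bbar
      (hv.contDiffAt.of_le (by exact_mod_cast le_top)) hx, h0]
    simp

/-- The rotated horizontal gradient of a function. -/
def rotGrad3 (ψ : E3 → ℝ) (x : E3) : E3 := !₂[pd 1 ψ x, -pd 0 ψ x, 0]

lemma contDiff_pd {F : Type*} [NormedAddCommGroup F] [NormedSpace ℝ F] {f : E3 → F}
    (hf : ContDiff ℝ ∞ f) (i : Fin 3) : ContDiff ℝ ∞ (pd i f) :=
  contDiffOn_univ.1 (contDiffOn_pd isOpen_univ hf.contDiffOn i)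

lemma contDiff_rotGrad3 {ψ : E3 → ℝ} (hψ : ContDiff ℝ ∞ ψ) : ContDiff ℝ ∞ (rotGrad3 ψ) := by
  rw [contDiff_euclidean]
  intro i
  fin_cases i
  · exact contDiff_pd hψ 1
  · exact (contDiff_pd hψ 0).neg
  · exact contDiff_const

lemma tsupport_pd_subset {F : Type*} [NormedAddCommGroup F] [NormedSpace ℝ F] (f : E3 → F)
    (i : Fin 3) : tsupport (pd i f) ⊆ tsupport f := by
  refine (closure_mono ?_).trans (tsupport_fderiv_subset ℝ)
  intro x hx h
  exact hx (by simp [pd, h])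

lemma rotGrad3_eq_zero {ψ : E3 → ℝ} {x : E3} (hx : x ∉ tsupport ψ) : rotGrad3 ψ x = 0 := by
  have h := fun i => image_eq_zero_of_notMem_tsupport (fun h => hx (tsupport_pd_subset ψ i h))
  ext i
  fin_cases i <;> simp [rotGrad3, h]

lemma div3_eq (v : E3 → E3) (x : E3) : div3 v x = pd 0 v x 0 + pd 1 v x 1 + pd 2 v x 2 := by
  simp [div3, Fin.sum_univ_three, pd]

lemma pd_rotGrad3 {ψ : E3 → ℝ} (hψ : ContDiff ℝ ∞ ψ) (i : Fin 3) (x : E3) :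
    pd i (rotGrad3 ψ) x = !₂[pd i (pd 1 ψ) x, -pd i (pd 0 ψ) x, 0] := by
  have h := (contDiff_rotGrad3 hψ).differentiable (by simp) x
  ext j
  rw [pd_apply h]
  fin_cases j
  · rfl
  · exact congrArg (fun L : E3 →L[ℝ] ℝ => L (e3 i)) (fderiv_neg (f := pd 0 ψ))
  · change fderiv ℝ (fun _ => (0 : ℝ)) x (e3 i) = 0
    simp

/-- Mixed partial derivatives cancel in the divergence. These are the interior test fields, which
leave the surface at rest. -/
lemma isTangentField_rotGrad3 {ψ : E3 → ℝ} (hψ : ContDiff ℝ ∞ ψ) (hc : HasCompactSupport ψ)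
    (hB : tsupport ψ ⊆ B) : IsTangentField ∅ (rotGrad3 ψ) ∧ surf (rotGrad3 ψ) = 0 := by
  have hs : surf (rotGrad3 ψ) = 0 := by
    funext p
    have : emb p ∉ tsupport ψ := fun h => lt_irrefl (0:ℝ) (hB h)
    rw [surf, rotGrad3_eq_zero this]
    ext i; fin_cases i <;> rfl
  refine ⟨⟨?_, fun x _ => ?_, fun p _ => ?_, fun x _ => rfl⟩, hs⟩
  · refine isRegularField_of_compactSupport (contDiff_rotGrad3 hψ) ?_
    exact hc.of_isClosed_subset (isClosed_tsupport _)
      (closure_minimal (fun x hx => by_contra fun h => hx (rotGrad3_eq_zero h))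
        (isClosed_tsupport _))
  · rw [div3_eq, pd_rotGrad3 hψ, pd_rotGrad3 hψ, pd_rotGrad3 hψ,
      pd_comm (hψ.contDiffAt.of_le two_le_infty) 0 1]
    simp
  · rw [hs]
    simp [div2]

/-! ### Integration by parts in the interior -/

/-- The support of `g` lies in the open set `B`, so the product is continuous on all of space
although `f` is controlled only on `B`. -/
lemma integrable_mul_test {f g : E3 → ℝ} (hf : ContinuousOn f B) (hg : Continuous g)
    (hc : HasCompactSupport g) (hB : tsupport g ⊆ B) : Integrable fun x => f x * g x := by
  have hsub : tsupport (fun x => f x * g x) ⊆ tsupport g := tsupport_mul_subset_right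
  refine Continuous.integrable_of_hasCompactSupport (continuous_of_tsupport fun x hx => ?_)
    (hc.of_isClosed_subset (isClosed_tsupport _) hsub)
  exact (hf.continuousAt (B_mem_nhds (hB (hsub hx)))).mul hg.continuousAt

lemma setIntegral_mul_test {f g : E3 → ℝ} (hB : tsupport g ⊆ B) :
    ∫ x in B, f x * g x = ∫ x, f x * g x :=
  setIntegral_eq_integral_of_forall_compl_eq_zero fun x hx => by
    rw [image_eq_zero_of_notMem_tsupport fun h => hx (hB h), mul_zero]

lemma integral_pd_mul_test {f g : E3 → ℝ} (hf : ContDiffOn ℝ ∞ f B) (hg : ContDiff ℝ ∞ g)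
    (hc : HasCompactSupport g) (hB : tsupport g ⊆ B) (i : Fin 3) :
    ∫ x, f x * pd i g x = -∫ x, pd i f x * g x := by
  have hsub := tsupport_pd_subset g i
  exact integral_mul_fderiv_eq_neg_fderiv_mul_of_integrable (μ := volume) (f := f) (g := g)
    (v := e3 i)
    (integrable_mul_test (contDiffOn_pd isOpen_B hf i).continuousOn hg.continuous hc hB)
    (integrable_mul_test hf.continuousOn (contDiff_pd hg i).continuous
      (hc.of_isClosed_subset (isClosed_tsupport _) hsub) (hsub.trans hB))
    (integrable_mul_test hf.continuousOn hg.continuous hc hB)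
    (fun x hx => differentiableAt_of_mem_B hf (hB hx))
    (fun x _ => hg.differentiable (by simp) x)

/-- The Laplacian as a sum of partial derivatives. -/
def lap (f : E3 → ℝ) (x : E3) : ℝ := ∑ i, pd i (pd i f) x

lemma contDiffOn_lap {f : E3 → ℝ} (hf : ContDiffOn ℝ ∞ f B) : ContDiffOn ℝ ∞ (lap f) B :=
  ContDiffOn.sum fun i _ => contDiffOn_pd isOpen_B (contDiffOn_pd isOpen_B hf i) i

lemma pd_lap {f : E3 → ℝ} (hf : ContDiffOn ℝ ∞ f B) {x : E3} (hx : x ∈ B) (j : Fin 3) :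
    pd j (lap f) x = ∑ i, pd j (pd i (pd i f)) x := by
  have h : ∀ i ∈ Finset.univ, DifferentiableAt ℝ (fun x => pd i (pd i f) x) x := fun i _ =>
    differentiableAt_of_mem_B (contDiffOn_pd isOpen_B (contDiffOn_pd isOpen_B hf i) i) hx
  unfold lap
  rw [pd, fderiv_fun_sum h, sum_apply]
  rfl

lemma pd_lap_comm {f : E3 → ℝ} (hf : ContDiffOn ℝ ∞ f B) {x : E3} (hx : x ∈ B) (j : Fin 3) :
    pd j (lap f) x = lap (pd j f) x := by
  rw [pd_lap hf hx, lap]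
  refine Finset.sum_congr rfl fun i _ => ?_
  rw [pd_comm (contDiffAt_of_mem_B (contDiffOn_pd isOpen_B hf i) hx two_le_infty)]
  exact pd_congr isOpen_B (fun y hy => pd_comm (contDiffAt_of_mem_B hf hy two_le_infty) j i) i hx

lemma lap_congr {f g : E3 → ℝ} (h : EqOn f g B) : EqOn (lap f) (lap g) B := fun _ hx =>
  Finset.sum_congr rfl fun i _ => pd_congr isOpen_B (pd_congr isOpen_B h i) i hx

/-- Two integrations by parts: the Dirichlet form tested with a partial derivative. -/
lemma sum_integral_pd_pd_test {f ψ : E3 → ℝ} (hf : ContDiffOn ℝ ∞ f B) (hψ : ContDiff ℝ ∞ ψ)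
    (hc : HasCompactSupport ψ) (hB : tsupport ψ ⊆ B) (j : Fin 3) :
    ∑ i, ∫ x, pd i f x * pd i (pd j ψ) x = ∫ x, pd j (lap f) x * ψ x := by
  have hsub := tsupport_pd_subset ψ j
  have hcj : HasCompactSupport (pd j ψ) := hc.of_isClosed_subset (isClosed_tsupport _) hsub
  have h3 := fun i => contDiffOn_pd isOpen_B (contDiffOn_pd isOpen_B hf i) i
  have h1 : ∀ i, ∫ x, pd i f x * pd i (pd j ψ) x = ∫ x, pd j (pd i (pd i f)) x * ψ x := fun i => by
    rw [integral_pd_mul_test (contDiffOn_pd isOpen_B hf i) (contDiff_pd hψ j) hcj (hsub.trans hB),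
      integral_pd_mul_test (h3 i) hψ hc hB, neg_neg]
  simp_rw [h1]
  rw [← integral_finsetSum _ fun i _ => integrable_mul_test
    (contDiffOn_pd isOpen_B (h3 i) j).continuousOn hψ.continuous hc hB,
    ← setIntegral_mul_test hB]
  have h0 : ∀ x, (∑ i, pd j (pd i (pd i f)) x * ψ x) = (∑ i, pd j (pd i (pd i f)) x) * ψ x :=
    fun x => (Finset.sum_mul _ _ _).symm
  simp_rw [h0]
  rw [← setIntegral_mul_test (f := fun x => ∑ i, pd j (pd i (pd i f)) x) hB]
  exact setIntegral_congr_fun isOpen_B.measurableSet fun _ hx => by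
    simp only [pd_lap hf hx]

lemma eqOn_zero_of_integral_test {f : E3 → ℝ} (hf : ContinuousOn f B)
    (h : ∀ ψ : E3 → ℝ, ContDiff ℝ ∞ ψ → HasCompactSupport ψ → tsupport ψ ⊆ B →
      ∫ x, f x * ψ x = 0) : EqOn f 0 B := by
  have h1 := isOpen_B.ae_eq_zero_of_integral_contDiff_smul_eq_zero (μ := volume)
    (hf.locallyIntegrableOn isOpen_B.measurableSet) (fun g h1 h2 h3 => by
      simpa [mul_comm] using h g h1 h2 h3)
  exact Measure.eqOn_open_of_ae_eq ((ae_restrict_iff' isOpen_B.measurableSet).2 h1) isOpen_B hf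
    continuousOn_const

section
variable {S : Set E2} {u : E3 → E3}

/-- The coordinates of a field. -/
abbrev coord (u : E3 → E3) (j : Fin 3) (x : E3) : ℝ := u x j

lemma contDiffOn_coord (hu : ContDiffOn ℝ ∞ u B) (j : Fin 3) : ContDiffOn ℝ ∞ (coord u j) B :=
  (EuclideanSpace.proj (𝕜 := ℝ) j).contDiff.comp_contDiffOn hu

lemma pd_coord (hu : ContDiffOn ℝ ∞ u B) (i j : Fin 3) {x : E3} (hx : x ∈ B) :
    pd i u x j = pd i (coord u j) x := pd_apply (differentiableAt_of_mem_B hu hx) i j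

lemma pd_pd_coord (hu : ContDiffOn ℝ ∞ u B) (i j : Fin 3) {x : E3} (hx : x ∈ B) :
    pd i (pd i u) x j = pd i (pd i (coord u j)) x := by
  rw [pd_coord (contDiffOn_pd isOpen_B hu i) i j hx]
  exact pd_congr isOpen_B (fun y hy => pd_coord hu i j hy) i hx

lemma sum_pd_pd_apply (hu : ContDiffOn ℝ ∞ u B) (j : Fin 3) {x : E3} (hx : x ∈ B) :
    (∑ i, pd i (pd i u) x) j = lap (coord u j) x := by
  simp [lap, Fin.sum_univ_three, pd_pd_coord hu _ _ hx]

/-- The Laplacian of a field orthogonal to the interior test fields is irrotational in horizontal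
planes. -/
lemma curl_lap_eq_zero (hu : IsTangentField S u)
    (h : ∀ v, IsTangentField ∅ v → surf v = 0 → dirichlet u v = 0) {x : E3} (hx : x ∈ B) :
    pd 1 (lap (coord u 0)) x = pd 0 (lap (coord u 1)) x := by
  have hB := hu.regular.contDiffOn_B
  have hc0 := contDiffOn_coord hB 0
  have hc1 := contDiffOn_coord hB 1
  have d1 := contDiffOn_pd isOpen_B (contDiffOn_lap hc0) 1
  have d0 := contDiffOn_pd isOpen_B (contDiffOn_lap hc1) 0
  -- Test with the rotated gradient of ψ and move all derivatives off ψ: what remains is the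
  -- integral of this function times ψ.
  have key : EqOn (fun x => pd 1 (lap (coord u 0)) x - pd 0 (lap (coord u 1)) x) 0 B := by
    refine eqOn_zero_of_integral_test (d1.sub d0).continuousOn fun ψ hψ hc hs => ?_
    obtain ⟨ht, hs0⟩ := isTangentField_rotGrad3 hψ hc hs
    have h0 := h _ ht hs0
    have e : EqOn (gradInner u (rotGrad3 ψ)) (fun x => ∑ i,
        (pd i (coord u 0) x * pd i (pd 1 ψ) x - pd i (coord u 1) x * pd i (pd 0 ψ) x)) B := by
      intro y hy
      refine Finset.sum_congr rfl fun i _ => ?_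
      rw [inner_E3, pd_rotGrad3 hψ, pd_coord hB i 0 hy, pd_coord hB i 1 hy]
      simp
      ring
    have hsub : ∀ i j, tsupport (pd i (pd j ψ)) ⊆ tsupport ψ := fun i j =>
      (tsupport_pd_subset _ i).trans (tsupport_pd_subset _ j)
    have hI : ∀ (i j : Fin 3) {f : E3 → ℝ}, ContDiffOn ℝ ∞ f B →
        Integrable fun x => pd i f x * pd i (pd j ψ) x := fun i j f hf =>
      integrable_mul_test (contDiffOn_pd isOpen_B hf i).continuousOn
        (contDiff_pd (contDiff_pd hψ j) i).continuous
        (hc.of_isClosed_subset (isClosed_tsupport _) (hsub i j)) ((hsub i j).trans hs)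
    have h1 : ∫ x, ∑ i, (pd i (coord u 0) x * pd i (pd 1 ψ) x -
        pd i (coord u 1) x * pd i (pd 0 ψ) x) = 0 := by
      rw [dirichlet, setIntegral_congr_fun isOpen_B.measurableSet e,
        setIntegral_eq_integral_of_forall_compl_eq_zero] at h0
      · exact h0
      · intro y hy
        refine Finset.sum_eq_zero fun i _ => ?_
        rw [image_eq_zero_of_notMem_tsupport fun h => hy (hs (hsub i 1 h)),
          image_eq_zero_of_notMem_tsupport fun h => hy (hs (hsub i 0 h))]
        simp
    have hI' : ∀ i ∈ Finset.univ, Integrable fun x => pd i (coord u 0) x * pd i (pd 1 ψ) x -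
        pd i (coord u 1) x * pd i (pd 0 ψ) x := fun i _ => (hI i 1 hc0).sub (hI i 0 hc1)
    rw [integral_finsetSum _ hI'] at h1
    simp_rw [fun i => integral_sub (hI i 1 hc0) (hI i 0 hc1)] at h1
    rw [Finset.sum_sub_distrib, sum_integral_pd_pd_test hc0 hψ hc hs,
      sum_integral_pd_pd_test hc1 hψ hc hs, ← integral_sub
        (integrable_mul_test d1.continuousOn hψ.continuous hc hs)
        (integrable_mul_test d0.continuousOn hψ.continuous hc hs)] at h1
    simpa [sub_mul] using h1
  exact sub_eq_zero.1 (key hx)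

lemma coord_two_eqOn (hu : IsTangentField S u) : EqOn (coord u 2) (fun _ => 0) B := fun x hx =>
  hu.horizontal x (B_subset_Bbar hx)

lemma pd_zero_fun (i : Fin 3) (x : E3) : pd i (fun _ : E3 => (0 : ℝ)) x = 0 := by simp [pd]

lemma lap_zero_fun (x : E3) : lap (fun _ : E3 => (0 : ℝ)) x = 0 := by
  refine Finset.sum_eq_zero fun i _ => ?_
  rw [show pd i (fun _ : E3 => (0 : ℝ)) = fun _ => 0 from funext (pd_zero_fun i), pd_zero_fun]

/-- The Laplacian of a tangent field is solenoidal in horizontal planes. -/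
lemma div_lap_eq_zero (hu : IsTangentField S u) {x : E3} (hx : x ∈ B) :
    pd 0 (lap (coord u 0)) x + pd 1 (lap (coord u 1)) x = 0 := by
  have hB := hu.regular.contDiffOn_B
  have hc0 := contDiffOn_coord hB 0
  have hc1 := contDiffOn_coord hB 1
  -- Without a vertical component the divergence condition is planar, and it then passes to the
  -- Laplacian by commuting derivatives.
  have hdiv : EqOn (fun y => pd 0 (coord u 0) y) (fun y => -pd 1 (coord u 1) y) B := by
    intro y hy
    have := hu.div_free y hy
    rw [div3_eq, pd_coord hB 0 0 hy, pd_coord hB 1 1 hy, pd_coord hB 2 2 hy,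
      pd_congr isOpen_B (coord_two_eqOn hu) 2 hy, pd_zero_fun] at this
    simp only
    linarith
  have hneg : ∀ {f : E3 → ℝ} (i : Fin 3) (y : E3), pd i (fun y => -f y) y = -pd i f y :=
    fun i y => congrArg (fun L : E3 →L[ℝ] ℝ => L (e3 i)) fderiv_fun_neg
  rw [pd_lap_comm hc0 hx, pd_lap_comm hc1 hx, lap_congr hdiv hx, lap, lap,
    ← Finset.sum_add_distrib]
  refine Finset.sum_eq_zero fun i _ => ?_
  rw [show pd i (fun y => -pd 1 (coord u 1) y) = fun y => -pd i (pd 1 (coord u 1)) y from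
    funext (hneg i), hneg]
  ring

lemma norm_lap_le (hu : IsRegularField S u) {z : ℝ} (hz : z < 0) (j : Fin 3) :
    ∃ C, 0 ≤ C ∧ ∀ x : E3, x 2 ≤ z → ‖lap (coord u j) x‖ ≤ C / (1 + ‖x‖) ^ 2 := by
  obtain ⟨C, h⟩ := hu.slab_decay hz 2
  refine ⟨3 * |C|, by positivity, fun x hx => ?_⟩
  have hxB : x ∈ B := lt_of_le_of_lt hx hz
  rw [← sum_pd_pd_apply hu.contDiffOn_B j hxB]
  refine (PiLp.norm_apply_le _ j).trans ((norm_sum_le _ _).trans ?_)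
  have : ∀ i, ‖pd i (pd i u) x‖ ≤ |C| / (1 + ‖x‖) ^ 2 := fun i =>
    ((norm_pd_pd_le (contDiffAt_of_mem_B hu.contDiffOn_B hxB two_le_infty) i i).trans
      (h x hx)).trans (by gcongr; exact le_abs_self C)
  calc ∑ i, ‖pd i (pd i u) x‖ ≤ ∑ _i : Fin 3, |C| / (1 + ‖x‖) ^ 2 :=
        Finset.sum_le_sum fun i _ => this i
    _ = _ := by simp; ring

/-- A plane field which is smooth, solenoidal, irrotational and vanishes at infinity is zero. -/
lemma eq_zero_of_div_curl {a b : ℂ → ℝ} (ha : Differentiable ℝ a) (hb : Differentiable ℝ b)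
    (hdiv : ∀ ζ, fderiv ℝ a ζ 1 + fderiv ℝ b ζ Complex.I = 0)
    (hcurl : ∀ ζ, fderiv ℝ a ζ Complex.I = fderiv ℝ b ζ 1)
    (ha0 : Tendsto a (cocompact ℂ) (𝓝 0)) (hb0 : Tendsto b (cocompact ℂ) (𝓝 0)) (ζ : ℂ) :
    a ζ = 0 ∧ b ζ = 0 := by
  -- The two hypotheses are the Cauchy–Riemann equations of a - ib, and Liouville's theorem does the
  -- rest.
  set f : ℂ → ℂ := fun ζ => (a ζ : ℂ) - b ζ * Complex.I with hf
  have hfd : ∀ ζ, HasFDerivAt f ((Complex.ofRealCLM.comp (fderiv ℝ a ζ)) -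
      (Complex.I • Complex.ofRealCLM.comp (fderiv ℝ b ζ))) ζ := fun ζ => by
    have h1 := Complex.ofRealCLM.hasFDerivAt.comp ζ (ha ζ).hasFDerivAt
    have h2 := (Complex.ofRealCLM.hasFDerivAt.comp ζ (hb ζ).hasFDerivAt).const_smul Complex.I
    refine (h1.sub h2).congr_of_eventuallyEq (Eventually.of_forall fun w => ?_)
    simp [hf, mul_comm]
  have hdf : Differentiable ℂ f := fun ζ => by
    rw [differentiableAt_complex_iff_differentiableAt_real]
    refine ⟨(hfd ζ).differentiableAt, ?_⟩
    rw [(hfd ζ).fderiv]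
    have h1 := hdiv ζ
    have h2 := hcurl ζ
    apply Complex.ext
    · simp; linarith
    · simp; linarith
  have hlim : Tendsto f (cocompact ℂ) (𝓝 0) := by
    have h1 := (Complex.continuous_ofReal.tendsto 0).comp ha0
    have h2 := ((Complex.continuous_ofReal.tendsto 0).comp hb0).mul_const Complex.I
    simpa [hf, Function.comp_def] using h1.sub h2
  have h0 := hdf.apply_eq_of_tendsto_cocompact ζ hlim
  constructor
  · simpa [hf] using congrArg Complex.re h0
  · simpa [hf] using congrArg Complex.im h0

/-- The horizontal part of Δu is solenoidal, irrotational and decaying on the plane through `x`,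
which `ι` identifies with ℂ. -/
lemma lap_eq_zero_of_orthogonal (hu : IsTangentField S u)
    (h : ∀ v, IsTangentField ∅ v → surf v = 0 → dirichlet u v = 0) {x : E3} (hx : x ∈ B) :
    lap (coord u 0) x = 0 ∧ lap (coord u 1) x = 0 := by
  have hB := hu.regular.contDiffOn_B
  have hx2 : x 2 < 0 := hx
  let ι : ℂ →L[ℝ] E2 := LinearMap.toContinuousLinearMap
    { toFun := fun ζ => !₂[ζ.re, ζ.im]
      map_add' := fun p q => by ext i; fin_cases i <;> simp
      map_smul' := fun a p => by ext i; fin_cases i <;> simp }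
  have hι : ∀ ζ, ‖ι ζ‖ = ‖ζ‖ := fun ζ => by
    refine (sq_eq_sq₀ (norm_nonneg _) (norm_nonneg _)).1 ?_
    rw [norm_sq_E2, ← Complex.normSq_eq_norm_sq, Complex.normSq_apply]
    simp [ι]; ring
  have hι1 : emb (ι 1) = e3 0 := by ext i; fin_cases i <;> simp [ι]
  have hιI : emb (ι Complex.I) = e3 1 := by ext i; fin_cases i <;> simp [ι]
  have hd : ∀ j ζ, HasFDerivAt (fun ζ => lap (coord u j) (lift (ι ζ) (x 2)))
      (((fderiv ℝ (lap (coord u j)) (lift (ι ζ) (x 2))).comp embL).comp ι) ζ := fun j ζ =>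
    (hasFDerivAt_slice (contDiffOn_lap (contDiffOn_coord hB j)) (ι ζ) hx2).comp ζ ι.hasFDerivAt
  have hlim : ∀ j, Tendsto (fun ζ => lap (coord u j) (lift (ι ζ) (x 2))) (cocompact ℂ) (𝓝 0) := by
    intro j
    obtain ⟨C, hC, hb⟩ := norm_lap_le hu.regular hx2 j
    have h1 : Tendsto (fun ζ : ℂ => C / (1 + ‖ζ‖)) (cocompact ℂ) (𝓝 0) :=
      tendsto_const_nhds.div_atTop
        (tendsto_atTop_add_const_left _ _ (tendsto_norm_cocompact_atTop))
    refine squeeze_zero_norm (fun ζ => (hb (lift (ι ζ) (x 2)) le_rfl).trans ?_) h1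
    have h2 := norm_le_norm_lift (ι ζ) (x 2)
    rw [hι] at h2
    have h3 : 1 + ‖ζ‖ ≤ (1 + ‖lift (ι ζ) (x 2)‖) ^ 2 := by nlinarith [norm_nonneg ζ]
    gcongr
  have key := eq_zero_of_div_curl (a := fun ζ => lap (coord u 0) (lift (ι ζ) (x 2)))
    (b := fun ζ => lap (coord u 1) (lift (ι ζ) (x 2)))
    (fun ζ => (hd 0 ζ).differentiableAt) (fun ζ => (hd 1 ζ).differentiableAt)
    (fun ζ => by
      rw [(hd 0 ζ).fderiv, (hd 1 ζ).fderiv]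
      simp only [ContinuousLinearMap.comp_apply, embL_apply, hι1, hιI]
      exact div_lap_eq_zero hu (lift_mem_B.2 hx2))
    (fun ζ => by
      rw [(hd 0 ζ).fderiv, (hd 1 ζ).fderiv]
      simp only [ContinuousLinearMap.comp_apply, embL_apply, hι1, hιI]
      exact curl_lap_eq_zero hu h (lift_mem_B.2 hx2))
    (hlim 0) (hlim 1) ⟨x 0, x 1⟩
  have hxe : lift (ι ⟨x 0, x 1⟩) (x 2) = x := by
    ext i; fin_cases i <;> simp [ι]
  simpa only [hxe] using key

/-- A tangent field that is orthogonal to the interior test fields is harmonic. -/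
theorem sum_pd_pd_eq_zero_of_orthogonal (hu : IsTangentField S u)
    (h : ∀ v, IsTangentField ∅ v → surf v = 0 → dirichlet u v = 0) {x : E3} (hx : x ∈ B) :
    ∑ i, pd i (pd i u) x = 0 := by
  have hB := hu.regular.contDiffOn_B
  obtain ⟨h0, h1⟩ := lap_eq_zero_of_orthogonal hu h hx
  ext j
  rw [sum_pd_pd_apply hB j hx]
  fin_cases j
  · exact h0
  · exact h1
  · exact (lap_congr (coord_two_eqOn hu) hx).trans (lap_zero_fun x)

end
end Langmuir
end

/-! ### The Newtonian kernel of the plane and potentials of vector measures. -/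

noncomputable section
namespace Langmuir
open scoped Convolution
open Metric

/-! ### The gradient of the Newtonian potential of the plane -/

/-- The gradient of the fundamental solution `(2π)⁻¹ log |y|` of the planar Laplacian. -/
def newtonKernel (y : E2) : E2 := (2 * Real.pi)⁻¹ • ((1 / ‖y‖) ^ 2 • y)

lemma norm_newtonKernel (y : E2) : ‖newtonKernel y‖ = (2 * Real.pi)⁻¹ * ‖y‖⁻¹ := by
  rcases eq_or_ne y 0 with rfl | hy
  · simp [newtonKernel]
  · have := norm_pos_iff.2 hy
    have hpi := Real.pi_pos
    rw [newtonKernel, norm_smul, norm_smul, Real.norm_of_nonneg (by positivity),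
      Real.norm_of_nonneg (by positivity)]
    field_simp

/-- Up to a constant the kernel is inversion in the unit circle, which divides distances by |x||y|.
-/
lemma norm_newtonKernel_sub {x y : E2} (hx : x ≠ 0) (hy : y ≠ 0) :
    ‖newtonKernel x - newtonKernel y‖ = (2 * Real.pi)⁻¹ * (‖x - y‖ / (‖x‖ * ‖y‖)) := by
  have h := dist_div_norm_sq_smul hx hy 1
  have hpi := Real.pi_pos
  rw [newtonKernel, newtonKernel, ← smul_sub, norm_smul, Real.norm_of_nonneg (by positivity),
    ← dist_eq_norm, h, dist_eq_norm]
  ring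

lemma measurable_newtonKernel : Measurable newtonKernel := by
  unfold newtonKernel; fun_prop

/-- The Jacobian r of polar coordinates cancels the singularity 1/r. -/
lemma integrableOn_ball_newtonKernel (R : ℝ) : IntegrableOn newtonKernel (ball 0 R) := by
  have h : IntegrableOn (fun y : E2 => (2 * Real.pi)⁻¹ * ‖y‖⁻¹) (ball 0 R) := by
    rw [integrableOn_fun_norm_addHaar (volume : Measure E2)
      (f := fun t => (2 * Real.pi)⁻¹ * t⁻¹)]
    have h1 : IntegrableOn (fun _ : ℝ => (2 * Real.pi)⁻¹) (Ioo 0 R) := by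
      exact integrableOn_const (by simp)
    refine h1.congr_fun (fun t ht => ?_) measurableSet_Ioo
    have := ht.1.ne'
    simp
    field_simp
  refine Integrable.mono' h measurable_newtonKernel.aestronglyMeasurable (ae_of_all _ fun y => ?_)
  rw [norm_newtonKernel]

lemma locallyIntegrable_newtonKernel : LocallyIntegrable newtonKernel := fun x =>
  ⟨ball 0 (‖x‖ + 1), isOpen_ball.mem_nhds (by simp), integrableOn_ball_newtonKernel _⟩

lemma integrableOn_ball_newtonKernel_sub (p : E2) (R : ℝ) :
    IntegrableOn (fun x => newtonKernel (p - x)) (ball 0 R) := by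
  have h : IntegrableOn newtonKernel (ball p R) :=
    (integrableOn_ball_newtonKernel (‖p‖ + R)).mono_set (fun x hx => by
      rw [mem_ball_zero_iff]
      rw [mem_ball, dist_eq_norm] at hx
      linarith [norm_le_norm_add_norm_sub' x p])
  have := (Measure.measurePreserving_sub_left (volume : Measure E2) p).integrableOn_comp_preimage
    (MeasurableEquiv.subLeft p).measurableEmbedding (f := newtonKernel) (s := ball p R)
  have h2 := this.2 h
  have e : (fun x => p - x) ⁻¹' ball p R = ball 0 R := by
    ext x; simp [dist_eq_norm]
  rw [e] at h2
  exact h2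

/-- Two regimes. For |p| ≤ 2R the translated ball lies in the ball of radius 3R, where the kernel is
integrable. For |p| > 2R every point of the ball is at distance at least |p|/2 from `p`. -/
lemma exists_integral_newtonKernel_le (R : ℝ) (hR : 0 < R) : ∃ C, 0 ≤ C ∧ ∀ p : E2,
    ∫ x in ball (0 : E2) R, ‖newtonKernel (p - x)‖ ≤ C / (1 + ‖p‖) := by
  set M := ∫ y in ball (0 : E2) (3 * R), ‖newtonKernel y‖ with hM
  set W := (volume : Measure E2).real (ball 0 R) with hW
  have hM0 : 0 ≤ M := integral_nonneg fun _ => norm_nonneg _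
  have hW0 : 0 ≤ W := measureReal_nonneg
  have hpi := Real.pi_pos
  have key : ∀ p : E2, (‖p‖ ≤ 2 * R → ∫ x in ball (0 : E2) R, ‖newtonKernel (p - x)‖ ≤ M) ∧
      (2 * R < ‖p‖ → ∫ x in ball (0 : E2) R, ‖newtonKernel (p - x)‖ ≤
        (2 * Real.pi)⁻¹ * (2 / ‖p‖) * W) := by
    intro p
    constructor
    · intro hp
      have e : (fun x => p - x) ⁻¹' ball p R = ball 0 R := by
        ext x; simp [dist_eq_norm]
      have h1 := (Measure.measurePreserving_sub_left (volume : Measure E2) p).setIntegral_preimage_emb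
        (MeasurableEquiv.subLeft p).measurableEmbedding (fun y => ‖newtonKernel y‖) (ball p R)
      rw [e] at h1
      rw [h1]
      refine setIntegral_mono_set (integrableOn_ball_newtonKernel _).norm
        (ae_of_all _ fun _ => norm_nonneg _) (LE.le.eventuallyLE fun x hx => ?_)
      rw [mem_ball_zero_iff]
      rw [mem_ball, dist_eq_norm] at hx
      linarith [norm_le_norm_add_norm_sub' x p]
    · intro hp
      have h2 : ∀ x ∈ ball (0 : E2) R, ‖‖newtonKernel (p - x)‖‖ ≤ (2 * Real.pi)⁻¹ * (2 / ‖p‖) := by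
        intro x hx
        rw [mem_ball_zero_iff] at hx
        have h3 : ‖p‖ / 2 ≤ ‖p - x‖ := by linarith [norm_sub_norm_le p x]
        have hp0 : 0 < ‖p‖ := by linarith
        rw [norm_norm, norm_newtonKernel]
        gcongr
        rw [inv_le_comm₀ (by linarith) (by positivity), inv_div]
        exact h3
      refine (le_abs_self _).trans ((norm_setIntegral_le_of_norm_le_const measure_ball_lt_top
        h2).trans (le_of_eq rfl))
  clear_value M W
  refine ⟨M * (1 + 2 * R) + (2 * Real.pi)⁻¹ * 2 * W * (1 / (2 * R) + 1), by positivity,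
    fun p => ?_⟩
  rw [le_div_iff₀ (by positivity)]
  rcases le_or_gt ‖p‖ (2 * R) with hp | hp
  · have h1 := (key p).1 hp
    calc _ ≤ M * (1 + 2 * R) := by gcongr
      _ ≤ _ := le_add_of_nonneg_right (by positivity)
  · have h1 := (key p).2 hp
    have hp0 : 0 < ‖p‖ := by linarith
    generalize ∫ x in ball (0 : E2) R, ‖newtonKernel (p - x)‖ = I at h1 ⊢
    have hc : 0 ≤ (2 * Real.pi)⁻¹ := by positivity
    generalize (2 * Real.pi)⁻¹ = c at h1 hc ⊢
    calc I * (1 + ‖p‖) ≤ (c * (2 / ‖p‖) * W) * (1 + ‖p‖) := by gcongr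
      _ = c * 2 * W * (1 / ‖p‖ + 1) := by field_simp
      _ ≤ c * 2 * W * (1 / (2 * R) + 1) := by
        have := one_div_le_one_div_of_le (by positivity) hp.le
        exact mul_le_mul_of_nonneg_left (by linarith) (by positivity)
      _ ≤ _ := by
        have : 0 ≤ M * (1 + 2 * R) := mul_nonneg hM0 (by linarith)
        linarith

/-! ### Potentials of vector measures -/

section Potential

variable {A : Type*} [MeasurableSpace A] {ν : Measure A} {pos G : A → E2}

/-- The potential of the vector measure with density `G` and positions `pos`. -/
def potential (ν : Measure A) (pos G : A → E2) (x : E2) : ℝ :=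
  -∫ a, inner ℝ (newtonKernel (pos a - x)) (G a) ∂ν

/-- The weight 1/(1 + |pos a|) is exactly what integrating the kernel over a ball yields, so `G`
itself need not be integrable. -/
lemma integrable_potential_prod (hpos : Measurable pos) (hG : AEStronglyMeasurable G ν)
    (hi : Integrable (fun a => ‖G a‖ / (1 + ‖pos a‖)) ν) {R : ℝ} (hR : 0 < R) :
    Integrable (fun q : A × E2 => inner ℝ (newtonKernel (pos q.1 - q.2)) (G q.1))
      (ν.prod (volume.restrict (ball 0 R))) := by
  have hm : AEStronglyMeasurable
      (fun q : A × E2 => inner ℝ (newtonKernel (pos q.1 - q.2)) (G q.1))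
      (ν.prod (volume.restrict (ball (0 : E2) R))) := by
    refine AEStronglyMeasurable.inner ?_ hG.comp_fst
    exact (measurable_newtonKernel.comp
      ((hpos.comp measurable_fst).sub measurable_snd)).aestronglyMeasurable
  obtain ⟨C, hC, hb⟩ := exists_integral_newtonKernel_le R hR
  have hs : ∀ a, Integrable (fun x => ‖newtonKernel (pos a - x)‖ * ‖G a‖)
      (volume.restrict (ball 0 R)) := fun a =>
    (integrableOn_ball_newtonKernel_sub (pos a) R).norm.mul_const _
  rw [integrable_prod_iff hm]
  refine ⟨ae_of_all _ fun a => ?_, ?_⟩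
  · exact (integrableOn_ball_newtonKernel_sub (pos a) R).inner_const (G a)
  · refine (hi.const_mul C).mono' hm.norm.integral_prod_right' (ae_of_all _ fun a => ?_)
    rw [Real.norm_of_nonneg (integral_nonneg fun _ => norm_nonneg _)]
    calc ∫ x in ball (0 : E2) R, ‖inner ℝ (newtonKernel (pos a - x)) (G a)‖
        ≤ ∫ x in ball (0 : E2) R, ‖newtonKernel (pos a - x)‖ * ‖G a‖ :=
          integral_mono_of_nonneg (ae_of_all _ fun _ => norm_nonneg _) (hs a)
            (ae_of_all _ fun x => norm_inner_le_norm _ _)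
      _ = (∫ x in ball (0 : E2) R, ‖newtonKernel (pos a - x)‖) * ‖G a‖ := integral_mul_const _ _
      _ ≤ C / (1 + ‖pos a‖) * ‖G a‖ := by gcongr; exact hb _
      _ = _ := by ring

lemma locallyIntegrable_potential [SFinite ν] (hpos : Measurable pos) (hG : AEStronglyMeasurable G ν)
    (hi : Integrable (fun a => ‖G a‖ / (1 + ‖pos a‖)) ν) :
    LocallyIntegrable (potential ν pos G) := fun x =>
  ⟨ball 0 (‖x‖ + 1), isOpen_ball.mem_nhds (by simp),
    (integrable_potential_prod hpos hG hi (by positivity)).integral_prod_right.neg⟩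

/-- The convolution of the Newtonian kernel with a function. -/
def newtonConv (g : E2 → ℝ) : E2 → E2 :=
  newtonKernel ⋆[(ContinuousLinearMap.lsmul ℝ ℝ : ℝ →L[ℝ] E2 →L[ℝ] E2).flip, volume] g

lemma newtonConv_apply (g : E2 → ℝ) (z : E2) :
    newtonConv g z = ∫ x, g x • newtonKernel (z - x) := by
  rw [newtonConv, convolution_eq_swap]; rfl

/-- Fubini. With `ν` and `pos` left general, the same identity serves the surface stress (Lebesgue
measure on the plane) and the line tension (a parameter interval carried to a curve). -/
lemma integral_potential_mul [SFinite ν] (hpos : Measurable pos) (hG : AEStronglyMeasurable G ν)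
    (hi : Integrable (fun a => ‖G a‖ / (1 + ‖pos a‖)) ν) {g : E2 → ℝ} (hg : Continuous g)
    (hc : HasCompactSupport g) :
    Integrable (fun a => inner ℝ (G a) (newtonConv g (pos a))) ν ∧
    -∫ x, potential ν pos G x * g x = ∫ a, inner ℝ (G a) (newtonConv g (pos a)) ∂ν := by
  obtain ⟨R0, hR0⟩ := hc.isCompact.isBounded.subset_closedBall (0 : E2)
  set R := |R0| + 1
  have hR : 0 < R := by positivity
  have hsupp : ∀ x ∉ ball (0 : E2) R, g x = 0 := fun x hx => by
    refine image_eq_zero_of_notMem_tsupport fun h => hx ?_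
    have := hR0 h
    rw [mem_closedBall_zero_iff] at this
    rw [mem_ball_zero_iff]
    exact (this.trans (le_abs_self _)).trans_lt (lt_add_one _)
  obtain ⟨M, hM⟩ := hc.exists_bound_of_continuous hg
  have hint := integrable_potential_prod hpos hG hi hR
  have hint2 : Integrable (fun q : A × E2 =>
      g q.2 * inner ℝ (newtonKernel (pos q.1 - q.2)) (G q.1))
      (ν.prod (volume.restrict (ball 0 R))) :=
    hint.bdd_mul (c := M) (hg.measurable.comp measurable_snd).aestronglyMeasurable
      (ae_of_all _ fun q => hM q.2)
  have e1 : ∀ a, inner ℝ (G a) (newtonConv g (pos a)) =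
      ∫ x in ball (0 : E2) R, g x * inner ℝ (newtonKernel (pos a - x)) (G a) := by
    intro a
    have h0 : ∀ x ∉ ball (0 : E2) R, g x • newtonKernel (pos a - x) = 0 := fun x hx => by
      rw [hsupp x hx, zero_smul]
    have hI : Integrable (fun x => g x • newtonKernel (pos a - x))
        (volume.restrict (ball 0 R)) :=
      (integrableOn_ball_newtonKernel_sub (pos a) R).bdd_smul M hg.aestronglyMeasurable
        (ae_of_all _ hM)
    rw [newtonConv_apply, ← setIntegral_eq_integral_of_forall_compl_eq_zero h0,
      ← integral_inner hI]
    refine integral_congr_ae (ae_of_all _ fun x => ?_)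
    simp only [inner_smul_right, real_inner_comm]
  constructor
  · simp_rw [e1]
    exact hint2.integral_prod_left
  · simp_rw [e1]
    rw [integral_integral_swap hint2,
      ← setIntegral_eq_integral_of_forall_compl_eq_zero (s := ball (0 : E2) R)
        (fun x hx => by rw [hsupp x hx, mul_zero]), ← integral_neg]
    refine integral_congr_ae (ae_of_all _ fun x => ?_)
    simp only [potential]
    rw [integral_const_mul]
    ring

end Potential

end Langmuir
end

/-! ### Solving div W = g in the plane with quadratic decay. -/

noncomputable section
namespace Langmuir
open scoped Convolution
open Metric

/-! ### Decay of convolutions with the Newtonian kernel -/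

lemma integral_fderiv_of_compactSupport {F : Type*} [NormedAddCommGroup F] [NormedSpace ℝ F]
    [CompleteSpace F] {g : E2 → F} (hg : ContDiff ℝ ∞ g) (hc : HasCompactSupport g) :
    ∫ x, fderiv ℝ g x = 0 := by
  have hcont := hg.continuous_fderiv (by simp)
  ext v
  rw [ContinuousLinearMap.integral_apply
    (hcont.integrable_of_hasCompactSupport (hc.fderiv ℝ))]
  have hI : Integrable fun x => fderiv ℝ g x v :=
    (hcont.clm_apply continuous_const).integrable_of_hasCompactSupport (hc.fderiv_apply ℝ v)
  have := integral_smul_fderiv_eq_neg_fderiv_smul_of_integrable (μ := volume)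
    (f := fun _ : E2 => (1 : ℝ)) (g := g) (v := v) (by simp) (by simpa using hI)
    (by simpa using hg.continuous.integrable_of_hasCompactSupport hc) (by simp)
    (fun x _ => hg.differentiable (by simp) x)
  simpa using this

/-- As `g` has mean zero, K(x) may be subtracted from K(x - y) under the integral; the difference is
O(|x|⁻²) for y in the support, one power better than the kernel K itself. -/
lemma newtonKernel_conv_decay_zero {F' F : Type} [NormedAddCommGroup F'] [NormedSpace ℝ F']
    [CompleteSpace F'] [NormedAddCommGroup F] [NormedSpace ℝ F] [CompleteSpace F]
    (L : E2 →L[ℝ] F' →L[ℝ] F) {g : E2 → F'} (hg : ContDiff ℝ ∞ g) (hc : HasCompactSupport g)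
    (h0 : ∫ x, g x = 0) :
    ∃ C, 0 ≤ C ∧ ∀ x, ‖(newtonKernel ⋆[L, volume] g) x‖ ≤ C / (1 + ‖x‖) ^ 2 := by
  have hcont : Continuous (newtonKernel ⋆[L, volume] g) :=
    (hc.contDiff_convolution_right L locallyIntegrable_newtonKernel hg).continuous
  obtain ⟨R0, hR0⟩ := hc.isCompact.isBounded.subset_closedBall (0 : E2)
  set R := |R0| + 1 with hR
  have hR1 : 1 ≤ R := by rw [hR]; linarith [abs_nonneg R0]
  have hsupp : ∀ x, R < ‖x‖ → g x = 0 := fun x hx => by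
    refine image_eq_zero_of_notMem_tsupport fun h => ?_
    have := hR0 h
    rw [mem_closedBall_zero_iff] at this
    linarith [le_abs_self R0]
  have hgi := hg.continuous.integrable_of_hasCompactSupport (μ := volume) hc
  have hpi := Real.pi_pos
  set I := ∫ x, ‖g x‖ with hI
  have hI0 : 0 ≤ I := integral_nonneg fun _ => norm_nonneg _
  suffices hfar : ∀ x, 2 * R ≤ ‖x‖ → ‖(newtonKernel ⋆[L, volume] g) x‖ ≤
      ‖L‖ * (2 * Real.pi)⁻¹ * (2 * R) * I * 4 / (1 + ‖x‖) ^ 2 by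
    obtain ⟨C, hC, hb⟩ := exists_bound_of_decay (s := (univ : Set E2)) isClosed_univ
      hcont.continuousOn ⟨_, 2 * R, fun x _ hx => hfar x hx⟩
    exact ⟨C, hC, fun x => hb x (mem_univ x)⟩
  intro x hx
  have hx0 : 0 < ‖x‖ := by linarith
  have hi1 := (hc.convolutionExists_right L locallyIntegrable_newtonKernel hg.continuous
    x).integrable_swap
  have hi2 : Integrable fun y => L (newtonKernel x) (g y) := (L (newtonKernel x)).integrable_comp hgi
  have e : (newtonKernel ⋆[L, volume] g) x =
      ∫ y, (L (newtonKernel (x - y)) (g y) - L (newtonKernel x) (g y)) := by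
    rw [integral_sub hi1 hi2, ContinuousLinearMap.integral_comp_comm _ hgi, h0, map_zero, sub_zero,
      convolution_eq_swap]
  have hpt : ∀ y, ‖L (newtonKernel (x - y)) (g y) - L (newtonKernel x) (g y)‖ ≤
      ‖L‖ * ((2 * Real.pi)⁻¹ * (2 * R / ‖x‖ ^ 2)) * ‖g y‖ := by
    intro y
    rcases le_or_gt ‖y‖ R with hy | hy
    · have hxy : ‖x‖ / 2 ≤ ‖x - y‖ := by linarith [norm_sub_norm_le x y]
      have hxy0 : x - y ≠ 0 := norm_pos_iff.1 (by linarith)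
      rw [← sub_apply, ← map_sub]
      refine (L.le_opNorm₂ _ _).trans ?_
      rw [norm_newtonKernel_sub hxy0 (norm_pos_iff.1 hx0)]
      have h1 : ‖x - y - x‖ / (‖x - y‖ * ‖x‖) ≤ R / (‖x‖ / 2 * ‖x‖) := by
        rw [sub_sub_cancel_left, norm_neg]
        gcongr
      have h2 : R / (‖x‖ / 2 * ‖x‖) = 2 * R / ‖x‖ ^ 2 := by field_simp
      rw [← h2]
      gcongr
    · simp [hsupp y hy]
  rw [e]
  have h1 := norm_integral_le_of_norm_le (hgi.norm.const_mul _) (ae_of_all _ hpt)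
  rw [integral_const_mul] at h1
  refine h1.trans ?_
  have h2 : 2 * R / ‖x‖ ^ 2 ≤ 2 * R * 4 / (1 + ‖x‖) ^ 2 := by
    rw [div_le_div_iff₀ (by positivity) (by positivity), mul_assoc (2 * R)]
    have h3 : (1 + ‖x‖) ^ 2 ≤ 4 * ‖x‖ ^ 2 := by nlinarith
    exact mul_le_mul_of_nonneg_left h3 (by linarith)
  calc ‖L‖ * ((2 * Real.pi)⁻¹ * (2 * R / ‖x‖ ^ 2)) * I
      ≤ ‖L‖ * ((2 * Real.pi)⁻¹ * (2 * R * 4 / (1 + ‖x‖) ^ 2)) * I := by gcongr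
    _ = _ := by ring

/-- Induction on the order: the derivative of the convolution is the convolution with the derivative
of `g`, which again has mean zero. Since `g` then takes values in a space of linear maps, the target
spaces and `L` are universally quantified. -/
lemma newtonKernel_conv_decay (n : ℕ) : ∀ {F' F : Type} [NormedAddCommGroup F'] [NormedSpace ℝ F']
    [CompleteSpace F'] [NormedAddCommGroup F] [NormedSpace ℝ F] [CompleteSpace F]
    (L : E2 →L[ℝ] F' →L[ℝ] F) {g : E2 → F'}, ContDiff ℝ ∞ g → HasCompactSupport g →
    ∫ x, g x = 0 →
    ∃ C, 0 ≤ C ∧ ∀ x, ‖iteratedFDeriv ℝ n (newtonKernel ⋆[L, volume] g) x‖ ≤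
      C / (1 + ‖x‖) ^ 2 := by
  induction n with
  | zero =>
    intro F' F _ _ _ _ _ _ L g hg hc h0
    simpa using newtonKernel_conv_decay_zero L hg hc h0
  | succ n ih =>
    intro F' F _ _ _ _ _ _ L g hg hc h0
    obtain ⟨C, hC, h⟩ := ih (L.precompR E2) (hg.fderiv_right (m := ∞) (by simp)) (hc.fderiv ℝ)
      (integral_fderiv_of_compactSupport hg hc)
    refine ⟨C, hC, fun x => ?_⟩
    have e : fderiv ℝ (newtonKernel ⋆[L, volume] g) =
        newtonKernel ⋆[L.precompR E2, volume] fderiv ℝ g := funext fun y =>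
      (hc.hasFDerivAt_convolution_right L locallyIntegrable_newtonKernel
        (hg.of_le (by simp)) y).fderiv
    rw [← norm_iteratedFDeriv_fderiv, e]
    exact h x

/-! ### The divergence of the convolution with the Newtonian kernel -/

/-- Polar coordinates of the plane. -/
def polarPoint (q : ℝ × ℝ) : E2 := !₂[q.1 * Real.cos q.2, q.1 * Real.sin q.2]

lemma integral_polarPoint (f : E2 → ℝ) :
    ∫ q in Ioi (0:ℝ) ×ˢ Ioo (-Real.pi) Real.pi, q.1 * f (polarPoint q) = ∫ p, f p := by
  have h1 := (EuclideanSpace.volume_preserving_symm_measurableEquiv_toLp (Fin 2)).symm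
  have h2 := (volume_preserving_finTwoArrow ℝ).symm
  rw [← h1.integral_comp (MeasurableEquiv.measurableEmbedding _),
    ← h2.integral_comp (MeasurableEquiv.measurableEmbedding _),
    ← integral_comp_polarCoord_symm]
  refine integral_congr_ae (ae_of_all _ fun q => ?_)
  simp only [smul_eq_mul]
  congr 2

lemma polarPoint_eq (r θ : ℝ) : polarPoint (r, θ) = r • polarPoint (1, θ) := by
  ext i; fin_cases i <;> simp [polarPoint]

lemma norm_polarPoint_one (θ : ℝ) : ‖polarPoint (1, θ)‖ = 1 := by
  refine (sq_eq_sq₀ (norm_nonneg _) zero_le_one).1 ?_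
  rw [norm_sq_E2]; simp [polarPoint]

/-- The distributional divergence of the Newtonian kernel is the Dirac mass. -/
lemma integral_fderiv_newtonKernel {φ : E2 → ℝ} (hφ : ContDiff ℝ ∞ φ)
    (hc : HasCompactSupport φ) : ∫ y, fderiv ℝ φ y (newtonKernel y) = -φ 0 := by
  have hpi := Real.pi_pos
  have hpp : Continuous polarPoint := by
    unfold polarPoint
    refine (PiLp.continuous_toLp 2 _).comp (continuous_pi fun i => ?_)
    fin_cases i <;> simp <;> fun_prop
  -- Once the Jacobian r has cancelled the 1/r of the kernel, the integrand is the radial derivative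
  -- of φ over 2π, continuous up to r = 0.
  set D : ℝ × ℝ → ℝ := fun q => (2 * Real.pi)⁻¹ * fderiv ℝ φ (polarPoint q) (polarPoint (1, q.2))
    with hD
  have hDc : Continuous D := by
    refine continuous_const.mul (((hφ.continuous_fderiv (by simp)).comp hpp).clm_apply ?_)
    exact hpp.comp (continuous_const.prodMk continuous_snd)
  rw [← integral_polarPoint]
  have e : EqOn (fun q : ℝ × ℝ => q.1 * fderiv ℝ φ (polarPoint q) (newtonKernel (polarPoint q))) D
      (Ioi (0:ℝ) ×ˢ Ioo (-Real.pi) Real.pi) := by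
    rintro ⟨r, θ⟩ ⟨hr, -⟩
    have hr0 : (0:ℝ) < r := hr
    simp only [hD]
    have : newtonKernel (polarPoint (r, θ)) = ((2 * Real.pi)⁻¹ * r⁻¹) • polarPoint (1, θ) := by
      rw [polarPoint_eq r, newtonKernel, norm_smul, norm_polarPoint_one, smul_smul, smul_smul,
        Real.norm_of_nonneg hr0.le]
      congr 1
      field_simp
    rw [this, map_smul, smul_eq_mul]
    field_simp
  rw [setIntegral_congr_fun (measurableSet_Ioi.prod measurableSet_Ioo) e]
  obtain ⟨R, hR⟩ := hc.isCompact.isBounded.subset_closedBall (0 : E2)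
  have hφR : ∀ y, R < ‖y‖ → y ∉ tsupport φ := fun y hy h => by
    have := hR h
    rw [mem_closedBall_zero_iff] at this
    linarith
  have hDR : ∀ r θ, 0 < r → R < r → D (r, θ) = 0 := fun r θ h0 h => by
    have h1 : polarPoint (r, θ) ∉ tsupport (fderiv ℝ φ) := fun hh => by
      refine hφR _ ?_ (tsupport_fderiv_subset ℝ hh)
      rw [polarPoint_eq, norm_smul, norm_polarPoint_one, mul_one]
      exact h.trans_le (le_abs_self r)
    simp [hD, image_eq_zero_of_notMem_tsupport h1]
  have hint : Integrable D ((volume.restrict (Ioi 0)).prod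
      (volume.restrict (Ioo (-Real.pi) Real.pi))) := by
    rw [Measure.prod_restrict]
    have h1 : IntegrableOn D (Icc 0 R ×ˢ Icc (-Real.pi) Real.pi) :=
      hDc.continuousOn.integrableOn_compact (isCompact_Icc.prod isCompact_Icc)
    refine (h1.of_forall_sdiff_eq_zero (measurableSet_Ioi.prod measurableSet_Ioo) ?_ : IntegrableOn D
      (Ioi 0 ×ˢ Ioo (-Real.pi) Real.pi))
    rintro ⟨r, θ⟩ ⟨⟨hr, hθ⟩, hn⟩
    refine hDR r θ hr (not_le.1 fun hle => hn ⟨⟨le_of_lt hr, hle⟩, Ioo_subset_Icc_self hθ⟩)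
  -- The fundamental theorem of calculus along each ray; integration over the angle then supplies
  -- the factor 2π.
  have hinner : ∀ θ, ∫ r in Ioi (0:ℝ), D (r, θ) = -((2 * Real.pi)⁻¹ * φ 0) := by
    intro θ
    set f : ℝ → ℝ := fun r => (2 * Real.pi)⁻¹ * φ (r • polarPoint (1, θ)) with hf
    have hline : ContDiff ℝ 1 fun r : ℝ => r • polarPoint (1, θ) := contDiff_id.smul contDiff_const
    have hfd : ContDiff ℝ 1 f := contDiff_const.mul ((hφ.of_le (by simp)).comp hline)
    have hfc : HasCompactSupport f := by
      refine HasCompactSupport.of_support_subset_isCompact (isCompact_Icc (a := -R) (b := R))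
        fun r hr => ?_
      by_contra hn
      refine hr ?_
      have : r • polarPoint (1, θ) ∉ tsupport φ := hφR _ (by
        rw [norm_smul, norm_polarPoint_one, mul_one]
        exact not_le.1 fun h => hn (abs_le.1 h))
      simp [hf, image_eq_zero_of_notMem_tsupport this]
    have hderiv : ∀ r, deriv f r = D (r, θ) := fun r => by
      have h1 : HasDerivAt (fun r : ℝ => r • polarPoint (1, θ)) (polarPoint (1, θ)) r := by
        simpa using (hasDerivAt_id r).smul_const (polarPoint (1, θ))
      have h2 := ((hφ.differentiable (by simp) (r • polarPoint (1, θ))).hasFDerivAt.comp_hasDerivAt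
        r h1).const_mul (2 * Real.pi)⁻¹
      rw [hD]
      simp only
      rw [polarPoint_eq r]
      exact h2.deriv
    have := hfc.integral_Ioi_deriv_eq hfd 0
    simp_rw [hderiv] at this
    rw [this]
    simp [hf]
  rw [Measure.volume_eq_prod, ← Measure.prod_restrict, integral_prod_symm _ hint]
  simp_rw [hinner]
  rw [integral_neg, setIntegral_const, measureReal_def, Real.volume_Ioo,
    ENNReal.toReal_ofReal (by linarith), smul_eq_mul]
  field_simp
  ring

section NewtonConv

variable {g : E2 → ℝ}

lemma contDiff_newtonConv (hg : ContDiff ℝ ∞ g) (hc : HasCompactSupport g) :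
    ContDiff ℝ ∞ (newtonConv g) :=
  hc.contDiff_convolution_right _ locallyIntegrable_newtonKernel hg

lemma newtonConv_decay (hg : ContDiff ℝ ∞ g) (hc : HasCompactSupport g) (h0 : ∫ x, g x = 0)
    (n : ℕ) : ∃ C, 0 ≤ C ∧ ∀ p, ‖iteratedFDeriv ℝ n (newtonConv g) p‖ ≤ C / (1 + ‖p‖) ^ 2 :=
  newtonKernel_conv_decay n _ hg hc h0

/-- All derivatives fall on `g`; their sum is minus the derivative of t ↦ g(p - t) in the direction
of the kernel, to which `integral_fderiv_newtonKernel` applies. -/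
lemma div2_newtonConv (hg : ContDiff ℝ ∞ g) (hc : HasCompactSupport g) (p : E2) :
    div2 (newtonConv g) p = g p := by
  set L : E2 →L[ℝ] ℝ →L[ℝ] E2 := (ContinuousLinearMap.lsmul ℝ ℝ : ℝ →L[ℝ] E2 →L[ℝ] E2).flip
    with hL
  have hg1 : ContDiff ℝ 1 g := hg.of_le (by simp)
  have hd := hc.hasFDerivAt_convolution_right L locallyIntegrable_newtonKernel hg1 p
  have hcf := hc.fderiv ℝ
  have hgf := hg1.continuous_fderiv one_ne_zero
  have hi : ∀ i, Integrable fun t => fderiv ℝ g (p - t) (e2 i) • newtonKernel t := fun i =>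
    ((hc.fderiv_apply ℝ (e2 i)).convolutionExists_right L locallyIntegrable_newtonKernel
      (hgf.clm_apply continuous_const) p)
  have h1 : ∀ i, (fderiv ℝ (newtonConv g) p (e2 i)) i =
      ∫ t, fderiv ℝ g (p - t) (e2 i) * newtonKernel t i := fun i => by
    have e1 : fderiv ℝ (newtonConv g) p (e2 i) =
        ∫ t, fderiv ℝ g (p - t) (e2 i) • newtonKernel t := by
      rw [show fderiv ℝ (newtonConv g) p = _ from hd.fderiv,
        convolution_precompR_apply L locallyIntegrable_newtonKernel hcf hgf]
      rfl
    rw [e1]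
    exact ((EuclideanSpace.proj (𝕜 := ℝ) i).integral_comp_comm (hi i)).symm
  have hi' : ∀ i, Integrable fun t => fderiv ℝ g (p - t) (e2 i) * newtonKernel t i := fun i =>
    (EuclideanSpace.proj (𝕜 := ℝ) i).integrable_comp (hi i)
  rw [div2, Fin.sum_univ_two, h1, h1, ← integral_add (hi' 0) (hi' 1)]
  have h2 := integral_fderiv_newtonKernel (φ := fun t => g (p - t))
    (hg.comp (contDiff_const.sub contDiff_id))
    (hc.comp_homeomorph (Homeomorph.subLeft p))
  simp only [sub_zero] at h2
  rw [← neg_inj, ← h2, ← integral_neg]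
  refine integral_congr_ae (ae_of_all _ fun t => ?_)
  have h3 : fderiv ℝ (fun t => g (p - t)) t = -(fderiv ℝ g (p - t)) := by
    have h4 := (hg.differentiable (by simp) (p - t)).hasFDerivAt.comp t
      ((hasFDerivAt_id t).const_sub p)
    rw [show fderiv ℝ (fun t => g (p - t)) t = _ from h4.fderiv]
    ext v
    simp
  simp only [h3]
  conv_rhs => rw [E2_eq (newtonKernel t)]
  simp
  ring

end NewtonConv
end Langmuir
end

/-! ### The surface forces, and planar fields as traces of tangent fields. -/

noncomputable section
namespace Langmuir

/-! ### The line tension in terms of the tangent -/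

namespace IsClosedCurve

variable {c : ℝ → E2}

lemma contDiff_deriv (hc : IsClosedCurve c) : ContDiff ℝ 1 (deriv c) :=
  (contDiff_succ_iff_deriv.1 (show ContDiff ℝ (1 + 1) c by
    rw [one_add_one_eq_two]; exact hc.contDiff)).2.2

lemma contDiff_unitTangent (hc : IsClosedCurve c) : ContDiff ℝ 1 (unitTangent c) :=
  ((hc.contDiff_deriv.norm ℝ hc.regular).inv fun s => norm_ne_zero_iff.2 (hc.regular s)).smul
    hc.contDiff_deriv

lemma norm_unitTangent (hc : IsClosedCurve c) (s : ℝ) : ‖unitTangent c s‖ = 1 := by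
  rw [unitTangent, norm_smul, norm_inv, norm_norm, inv_mul_cancel₀ (norm_ne_zero_iff.2 (hc.regular s))]

lemma continuous_deriv_unitTangent (hc : IsClosedCurve c) :
    Continuous (deriv (unitTangent c)) := hc.contDiff_unitTangent.continuous_deriv le_rfl

lemma inner_unitTangent_deriv (hc : IsClosedCurve c) (s : ℝ) :
    inner ℝ (unitTangent c s) (deriv (unitTangent c) s) = 0 := by
  have hd := (hc.contDiff_unitTangent.differentiable one_ne_zero s).hasDerivAt
  have h := hd.inner ℝ hd
  have h1 : (fun t => inner ℝ (unitTangent c t) (unitTangent c t)) = fun _ => (1:ℝ) :=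
    funext fun t => by rw [real_inner_self_eq_norm_sq, hc.norm_unitTangent]; norm_num
  rw [h1] at h
  have := h.unique (hasDerivAt_const s (1:ℝ))
  rw [real_inner_comm] at this
  rw [real_inner_comm]
  linarith

/-- The derivative of the unit tangent T is normal to the curve. The normal enters twice, so its
sign cancels and κ n ds = dT for either choice of side. -/
lemma curvature_mul (hc : IsClosedCurve c) (D : Set E2) (s : ℝ) (w : E2) :
    curvature D c s * inner ℝ (outwardNormal D c s) w * ‖deriv c s‖ =
      inner ℝ (deriv (unitTangent c) s) w := by
  have hn : ‖deriv c s‖ ≠ 0 := norm_ne_zero_iff.2 (hc.regular s)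
  have h1 := hc.norm_unitTangent s
  have h2 := hc.inner_unitTangent_deriv s
  have h3 : unitTangent c s 0 ^ 2 + unitTangent c s 1 ^ 2 = 1 := by
    rw [← norm_sq_E2, h1]; norm_num
  rw [inner_E2] at h2
  have key : inner ℝ (deriv (unitTangent c) s) (outwardNormal D c s) *
      inner ℝ (outwardNormal D c s) w = inner ℝ (deriv (unitTangent c) s) w := by
    have h4 : inner ℝ (deriv (unitTangent c) s) (sideNormal c s) *
        inner ℝ (sideNormal c s) w = inner ℝ (deriv (unitTangent c) s) w := by
      simp only [inner_E2, sideNormal, Matrix.cons_val_zero, Matrix.cons_val_one]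
      generalize unitTangent c s 0 = a at *
      generalize unitTangent c s 1 = b at *
      generalize deriv (unitTangent c) s 0 = a' at *
      generalize deriv (unitTangent c) s 1 = b' at *
      linear_combination (a' * w.ofLp 0 + b' * w.ofLp 1) * h3 -
        (a * w.ofLp 0 + b * w.ofLp 1) * h2
    unfold outwardNormal
    split_ifs
    · exact h4
    · simpa using h4
  rw [← key, curvature]
  field_simp

end IsClosedCurve

section Tension

variable {m : ℕ} {D : Set E2} {c : Fin m → ℝ → E2}

lemma lineTension_eq (hc : ∀ i, IsClosedCurve (c i)) (V : E2 → E2) :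
    lineTension D c V =
      ∑ i, ∫ s in (0 : ℝ)..1, inner ℝ (deriv (unitTangent (c i)) s) (V (c i s)) := by
  unfold lineTension
  refine Finset.sum_congr rfl fun i _ => ?_
  simp_rw [(hc i).curvature_mul D]

lemma intervalIntegrable_tension (hc : ∀ i, IsClosedCurve (c i)) {V : E2 → E2}
    (hV : Continuous V) (i : Fin m) : IntervalIntegrable
      (fun s => inner ℝ (deriv (unitTangent (c i)) s) (V (c i s))) volume 0 1 :=
  ((hc i).continuous_deriv_unitTangent.inner
    (hV.comp (hc i).contDiff.continuous)).intervalIntegrable _ _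

lemma lineTension_sub (hc : ∀ i, IsClosedCurve (c i)) {V W : E2 → E2} (hV : Continuous V)
    (hW : Continuous W) :
    lineTension D c (fun p => V p - W p) = lineTension D c V - lineTension D c W := by
  rw [lineTension_eq hc, lineTension_eq hc, lineTension_eq hc, ← Finset.sum_sub_distrib]
  refine Finset.sum_congr rfl fun i _ => ?_
  rw [← intervalIntegral.integral_sub (intervalIntegrable_tension hc hV i)
    (intervalIntegrable_tension hc hW i)]
  simp_rw [inner_sub_right]

lemma lineTension_congr {V W : E2 → E2} (h : EqOn V W (interface c)) :
    lineTension D c V = lineTension D c W := by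
  unfold lineTension
  refine Finset.sum_congr rfl fun i _ => ?_
  have : ∀ s, V (c i s) = W (c i s) := fun s => h (mem_iUnion.2 ⟨i, mem_range_self s⟩)
  simp_rw [this]

/-- The curve is the image of the plane under p ↦ c(p₀), whose differential is nowhere invertible.
-/
lemma volume_range_curve {c : ℝ → E2} (hc : ContDiff ℝ 1 c) : volume (range c) = 0 := by
  have hfst : ContDiff ℝ 1 fun p : E2 => c (p 0) :=
    hc.comp (EuclideanSpace.proj (𝕜 := ℝ) (0 : Fin 2)).contDiff
  have hr : range c = (fun p : E2 => c (p 0)) '' univ := by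
    ext x
    simp only [mem_range, image_univ]
    exact ⟨fun ⟨s, hs⟩ => ⟨!₂[s, 0], hs⟩, fun ⟨p, hp⟩ => ⟨p 0, hp⟩⟩
  rw [hr]
  refine addHaar_image_eq_zero_of_det_fderivWithin_eq_zero volume (s := univ)
    (f' := fun p => fderiv ℝ (fun p : E2 => c (p 0)) p)
    (fun p _ => (hfst.differentiable one_ne_zero p).hasFDerivAt.hasFDerivWithinAt) fun p _ => ?_
  by_contra hdet
  have hinj : Function.Injective (fderiv ℝ (fun p : E2 => c (p 0)) p) :=
    (LinearMap.equivOfDetNeZero _ hdet).injective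
  have h0 : fderiv ℝ (fun p : E2 => c (p 0)) p (e2 1) = 0 := by
    have h1 := ((hc.differentiable one_ne_zero (p 0)).hasFDerivAt.comp p
      (EuclideanSpace.proj (𝕜 := ℝ) (0 : Fin 2)).hasFDerivAt)
    rw [show fderiv ℝ (fun p : E2 => c (p 0)) p = _ from h1.fderiv]
    simp
  have := hinj (h0.trans (map_zero _).symm)
  simpa using congrArg (fun q : E2 => q 1) this

lemma volume_interface (hc : ∀ i, IsClosedCurve (c i)) : volume (interface c) = 0 :=
  measure_iUnion_null fun i => volume_range_curve ((hc i).contDiff.of_le (by norm_num))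

lemma range_curve_eq {c : ℝ → E2} (hc : IsClosedCurve c) : range c = c '' Icc 0 1 := by
  refine Subset.antisymm ?_ (image_subset_range _ _)
  rintro _ ⟨s, rfl⟩
  obtain ⟨t, ht, h⟩ := hc.periodic.exists_mem_Ico₀ one_pos s
  exact ⟨t, Ico_subset_Icc_self ht, h.symm⟩

lemma isCompact_interface (hc : ∀ i, IsClosedCurve (c i)) : IsCompact (interface c) :=
  isCompact_iUnion fun i => by
    rw [range_curve_eq (hc i)]
    exact isCompact_Icc.image (hc i).contDiff.continuous

end Tension

/-! ### The surface stress -/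

section Stress

variable {S : Set E2} {u v : E3 → E3}

lemma surfaceStress_eq (u : E3 → E3) (p : E2) : surfaceStress u p = -hor (normalDeriv u p) := rfl

lemma norm_surfaceStress_le (hu : IsRegularField S u) :
    ∃ C, 0 ≤ C ∧ ∀ p ∉ S, ‖surfaceStress u p‖ ≤ C / (1 + ‖p‖) ^ 2 := by
  obtain ⟨C, hC, h⟩ := norm_normalDeriv_le hu
  refine ⟨C, hC, fun p hp => ?_⟩
  rw [surfaceStress_eq, norm_neg]
  exact (norm_hor_le _).trans (h p hp)

lemma aestronglyMeasurable_surfaceStress (hu : IsRegularField S u) (hS : volume S = 0) :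
    AEStronglyMeasurable (surfaceStress u) volume :=
  (continuous_hor.comp_aestronglyMeasurable (aestronglyMeasurable_normalDeriv hu hS)).neg

/-- The test field is horizontal, so only the horizontal part of ∂_z u contributes; the sign is that
in the definition of the stress. -/
lemma dirichlet_eq_stress (hu : IsRegularField S u) (hS : volume S = 0)
    (hv : IsTangentField ∅ v) (hΔ : ∀ x ∈ B, ∑ i, pd i (pd i u) x = 0) :
    dirichlet u v = -∫ p, inner ℝ (surfaceStress u p) (surf v p) := by
  rw [dirichlet_eq_boundary hu hS hv.regular hΔ, ← integral_neg]
  refine integral_congr_ae (ae_of_all _ fun p => ?_)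
  simp only [surfaceStress_eq, inner_E3, inner_E2, hv.horizontal _ (emb_mem_Bbar p), surf,
    PiLp.neg_apply, hor_zero', hor_one']
  ring

end Stress

/-! ### Vertical extension of planar fields -/

section Extension

lemma norm_iteratedFDeriv_comp_clm_le {X Y F : Type*} [NormedAddCommGroup X] [NormedSpace ℝ X]
    [NormedAddCommGroup Y] [NormedSpace ℝ Y] [NormedAddCommGroup F] [NormedSpace ℝ F]
    {f : Y → F} (hf : ContDiff ℝ ∞ f) (L : X →L[ℝ] Y) (hL : ‖L‖ ≤ 1) (n : ℕ) (x : X) :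
    ‖iteratedFDeriv ℝ n (fun x => f (L x)) x‖ ≤ ‖iteratedFDeriv ℝ n f (L x)‖ := by
  have h := L.iteratedFDeriv_comp_right hf x (i := n) (by exact_mod_cast le_top)
  rw [show (fun x => f (L x)) = f ∘ L from rfl, h]
  refine (ContinuousMultilinearMap.norm_compContinuousLinearMap_le _ _).trans ?_
  exact mul_le_of_le_one_right (norm_nonneg _) (Finset.prod_le_one (fun _ _ => norm_nonneg _)
    fun _ _ => hL)

lemma norm_embL_le : ‖embL‖ ≤ 1 := embL.opNorm_le_bound zero_le_one fun p => by simp [norm_emb]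

lemma norm_horL_le : ‖horL‖ ≤ 1 :=
  horL.opNorm_le_bound zero_le_one fun p => by simpa using norm_hor_le p

lemma isRegularField_of_decay {v : E3 → E3} (hv : ContDiff ℝ ∞ v)
    (hd : ∀ n : ℕ, ∃ C, 0 ≤ C ∧ ∀ x, ‖iteratedFDeriv ℝ n v x‖ ≤ C / (1 + ‖x‖) ^ 2) :
    IsRegularField ∅ v := by
  obtain ⟨C, hC, h⟩ := hd 1
  simp_rw [norm_iteratedFDeriv_one] at h
  refine ⟨hv.continuous.continuousOn, hv.contDiffOn, ⟨C, fun x _ => ?_⟩, ?_, fun n => ?_⟩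
  · refine (norm_pd_le v 2 x).trans ((h x).trans (div_le_self hC ?_))
    exact one_le_pow₀ (by linarith [norm_nonneg x])
  · have hI : Integrable fun x : E3 => C ^ 2 * (1 + ‖x‖) ^ (-4 : ℝ) :=
      (integrable_one_add_norm (by
        simp only [finrank_euclideanSpace, Fintype.card_fin]; norm_num)).const_mul _
    refine (hI.mono' ((hv.continuous_fderiv (by simp)).norm.pow 2).aestronglyMeasurable
      (ae_of_all _ fun x => ?_)).integrableOn
    rw [Pi.pow_apply, Real.norm_of_nonneg (sq_nonneg _), Real.rpow_neg (by positivity),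
      show (4 : ℝ) = (4 : ℕ) by norm_num, Real.rpow_natCast]
    calc ‖fderiv ℝ v x‖ ^ 2 ≤ (C / (1 + ‖x‖) ^ 2) ^ 2 := by gcongr; exact h x
      _ = _ := by field_simp
  · obtain ⟨C, -, h⟩ := hd n
    refine ⟨C, 0, fun x hx _ => ?_⟩
    rw [iteratedFDerivWithin_eq_iteratedFDeriv uniqueDiffOn_Bbar
      (hv.contDiffAt.of_le (by exact_mod_cast le_top)) hx]
    exact h x

/-- The horizontal field with horizontal profile `U` and vertical profile `χ`. -/
def vertExt (χ : ℝ → ℝ) (U : E2 → E2) (x : E3) : E3 := χ (x 2) • emb (U (hor x))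

variable {χ : ℝ → ℝ} {U : E2 → E2}

lemma contDiff_vertExt (hχ : ContDiff ℝ ∞ χ) (hU : ContDiff ℝ ∞ U) :
    ContDiff ℝ ∞ (vertExt χ U) :=
  (hχ.comp (EuclideanSpace.proj (𝕜 := ℝ) (2 : Fin 3)).contDiff).smul
    (contDiff_emb.comp (hU.comp contDiff_hor))

lemma fderiv_vertExt (hχ : ContDiff ℝ ∞ χ) (hU : ContDiff ℝ ∞ U) (x w : E3) :
    fderiv ℝ (vertExt χ U) x w = χ (x 2) • emb (fderiv ℝ U (hor x) (hor w)) +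
      (w 2 * deriv χ (x 2)) • emb (U (hor x)) := by
  have h1 := (hχ.differentiable (by simp) (x 2)).hasDerivAt.comp_hasFDerivAt x
    (EuclideanSpace.proj (𝕜 := ℝ) (2 : Fin 3)).hasFDerivAt
  have h2 := (hasFDerivAt_emb (U (hor x))).comp x
    ((hU.differentiable (by simp) (hor x)).hasFDerivAt.comp x (hasFDerivAt_hor x))
  rw [show fderiv ℝ (vertExt χ U) x = _ from (h1.smul h2).fderiv]
  simp [mul_comm]

/-- On the support of χ the height is bounded by some R, so 1 + |x| ≤ (1 + R)(1 + |hor x|) and the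
planar decay becomes spatial decay; the Leibniz rule covers the derivatives. -/
lemma vertExt_decay (hχ : ContDiff ℝ ∞ χ) (hc : HasCompactSupport χ) (hU : ContDiff ℝ ∞ U)
    (hd : ∀ n : ℕ, ∃ C, 0 ≤ C ∧ ∀ p, ‖iteratedFDeriv ℝ n U p‖ ≤ C / (1 + ‖p‖) ^ 2) (n : ℕ) :
    ∃ C, 0 ≤ C ∧ ∀ x, ‖iteratedFDeriv ℝ n (vertExt χ U) x‖ ≤ C / (1 + ‖x‖) ^ 2 := by
  choose C hC hCb using hd
  obtain ⟨R0, hR0⟩ := hc.isCompact.isBounded.subset_closedBall (0 : ℝ)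
  set R := |R0|
  have hM : ∀ i : ℕ, ∃ M, 0 ≤ M ∧ ∀ t, ‖iteratedFDeriv ℝ i χ t‖ ≤ M := fun i => by
    obtain ⟨M, hM⟩ := (hc.iteratedFDeriv i).exists_bound_of_continuous
      (hχ.continuous_iteratedFDeriv (m := i) (by exact_mod_cast le_top))
    exact ⟨M, (norm_nonneg _).trans (hM 0), hM⟩
  choose M hM0 hMb using hM
  have hχR : ∀ i t, R < |t| → iteratedFDeriv ℝ i χ t = 0 := fun i t ht => by
    by_contra hne
    have := hR0 (support_iteratedFDeriv_subset i (Function.mem_support.2 hne))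
    rw [mem_closedBall_zero_iff, Real.norm_eq_abs] at this
    linarith [le_abs_self R0]
  refine ⟨∑ i ∈ Finset.range (n + 1), (n.choose i : ℝ) * (M i * (C (n - i) * (1 + R) ^ 2)),
    Finset.sum_nonneg fun i _ => mul_nonneg (by positivity)
      (mul_nonneg (hM0 i) (mul_nonneg (hC _) (by positivity))), fun x => ?_⟩
  have hproj : ‖(EuclideanSpace.proj (𝕜 := ℝ) (2 : Fin 3) : E3 →L[ℝ] ℝ)‖ ≤ 1 :=
    ContinuousLinearMap.opNorm_le_bound _ zero_le_one fun x => by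
      simpa using PiLp.norm_apply_le x 2
  have hp : ContDiff ℝ ∞ fun x : E3 => χ (x 2) :=
    hχ.comp (EuclideanSpace.proj (𝕜 := ℝ) (2 : Fin 3)).contDiff
  have hq : ContDiff ℝ ∞ fun x : E3 => emb (U (hor x)) :=
    contDiff_emb.comp (hU.comp contDiff_hor)
  have h0 := norm_iteratedFDeriv_smul_le hp hq x (n := n) (by exact_mod_cast le_top)
  refine h0.trans ?_
  rw [Finset.sum_div]
  refine Finset.sum_le_sum fun i _ => ?_
  rw [mul_assoc, mul_div_assoc]
  refine mul_le_mul_of_nonneg_left ?_ (by positivity)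
  have h1 : ‖iteratedFDeriv ℝ i (fun x : E3 => χ (x 2)) x‖ ≤ ‖iteratedFDeriv ℝ i χ (x 2)‖ :=
    norm_iteratedFDeriv_comp_clm_le hχ _ hproj i x
  have h2 : ‖iteratedFDeriv ℝ (n - i) (fun x : E3 => emb (U (hor x))) x‖ ≤
      C (n - i) / (1 + ‖hor x‖) ^ 2 := by
    have h3 := ContinuousLinearMap.norm_iteratedFDeriv_comp_left embL (f := fun x => U (horL x))
      (x := x) (n := n - i) (N := ∞) (hU.comp contDiff_hor).contDiffAt ENat.LEInfty.out
    have h4 := norm_iteratedFDeriv_comp_clm_le hU horL norm_horL_le (n - i) x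
    refine h3.trans ?_
    calc _ ≤ 1 * ‖iteratedFDeriv ℝ (n - i) (fun x => U (horL x)) x‖ := by
          gcongr; exact norm_embL_le
      _ ≤ _ := by rw [one_mul]; exact h4.trans (hCb _ _)
  rcases le_or_gt |x 2| R with hR | hR
  · have h5 : 1 + ‖x‖ ≤ (1 + R) * (1 + ‖hor x‖) := by
      have := norm_lift_le (hor x) (x 2)
      rw [lift_hor] at this
      have : 0 ≤ R := abs_nonneg _
      nlinarith [norm_nonneg (hor x)]
    have h6 : C (n - i) / (1 + ‖hor x‖) ^ 2 ≤ C (n - i) * (1 + R) ^ 2 / (1 + ‖x‖) ^ 2 := by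
      rw [div_le_div_iff₀ (by positivity) (by positivity), mul_assoc, ← mul_pow]
      have := hC (n - i)
      gcongr
    rw [mul_div_assoc]
    exact mul_le_mul (h1.trans (hMb i _)) (h2.trans h6) (norm_nonneg _) (hM0 i)
  · rw [hχR i _ hR, norm_zero] at h1
    rw [le_antisymm h1 (norm_nonneg _), zero_mul]
    have := hC (n - i)
    have := hM0 i
    positivity

/-- A factor that depends on z alone creates no divergence in a horizontal field. This makes all
decaying solenoidal planar fields available as traces. -/
lemma isTangentField_vertExt (hχ : ContDiff ℝ ∞ χ) (hc : HasCompactSupport χ) (h1 : χ 0 = 1)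
    (hU : ContDiff ℝ ∞ U)
    (hd : ∀ n : ℕ, ∃ C, 0 ≤ C ∧ ∀ p, ‖iteratedFDeriv ℝ n U p‖ ≤ C / (1 + ‖p‖) ^ 2)
    (hdiv : ∀ p, div2 U p = 0) :
    IsTangentField ∅ (vertExt χ U) ∧ surf (vertExt χ U) = U := by
  have hs : surf (vertExt χ U) = U := by
    funext p
    simp [surf, vertExt, h1]
  refine ⟨⟨isRegularField_of_decay (contDiff_vertExt hχ hU) (vertExt_decay hχ hc hU hd),
    fun x _ => ?_, fun p _ => by rw [hs, hdiv], fun x _ => by simp [vertExt]⟩, hs⟩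
  have h := hdiv (hor x)
  rw [div2, Fin.sum_univ_two] at h
  have e0 : hor (e3 0) = e2 0 := by rw [← emb_e2_zero, hor_emb]
  have e1 : hor (e3 1) = e2 1 := by rw [← emb_e2_one, hor_emb]
  rw [div3_eq, pd, pd, pd, fderiv_vertExt hχ hU, fderiv_vertExt hχ hU, fderiv_vertExt hχ hU, e0, e1]
  simp only [PiLp.add_apply, PiLp.smul_apply, smul_eq_mul, emb_zero', emb_one', emb_two']
  simp
  rw [← mul_add, h, mul_zero]

end Extension
end Langmuir
end

/-! ### Force balance and the weak identity imply each other for harmonic fields. -/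

noncomputable section
namespace Langmuir
open Metric

section
variable {m : ℕ} {D : Set E2} {c : Fin m → ℝ → E2} {u v : E3 → E3} {q : E2 → ℝ}

/-! ### Existence of the surface pressure -/

lemma contDiff_div2 {V : E2 → E2} (hV : ContDiff ℝ ∞ V) : ContDiff ℝ ∞ (div2 V) := by
  unfold div2
  refine ContDiff.sum fun i _ => ?_
  exact (EuclideanSpace.proj (𝕜 := ℝ) i).contDiff.comp
    ((hV.fderiv_right (m := ∞) (by simp)).clm_apply contDiff_const)

lemma hasCompactSupport_div2 {V : E2 → E2} (hc : HasCompactSupport V) :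
    HasCompactSupport (div2 V) :=
  (hc.fderiv ℝ).comp_left (g := fun L : E2 →L[ℝ] E2 => ∑ i, (L (e2 i)) i) (by simp)

lemma integral_div2_eq_zero {V : E2 → E2} (hV : ContDiff ℝ ∞ V) (hc : HasCompactSupport V) :
    ∫ p, div2 V p = 0 := by
  set tr : (E2 →L[ℝ] E2) →L[ℝ] ℝ := ∑ i, (EuclideanSpace.proj (𝕜 := ℝ) i).comp
    (ContinuousLinearMap.apply ℝ E2 (e2 i)) with htr
  have h : ∀ p, div2 V p = tr (fderiv ℝ V p) := fun p => by
    simp [div2, htr]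
  simp_rw [h]
  rw [tr.integral_comp_comm ((hV.continuous_fderiv (by simp)).integrable_of_hasCompactSupport
    (hc.fderiv ℝ)), integral_fderiv_of_compactSupport hV hc, map_zero]

lemma decay_of_compactSupport {V : E2 → E2} (hV : ContDiff ℝ ∞ V) (hc : HasCompactSupport V)
    (n : ℕ) : ∃ C, 0 ≤ C ∧ ∀ p, ‖iteratedFDeriv ℝ n V p‖ ≤ C / (1 + ‖p‖) ^ 2 := by
  obtain ⟨R, hR⟩ := hc.isCompact.isBounded.subset_closedBall 0
  obtain ⟨C, hC, h⟩ := exists_bound_of_decay (s := (univ : Set E2)) isClosed_univ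
    (f := iteratedFDeriv ℝ n V) (hV.continuous_iteratedFDeriv (m := n)
      (by exact_mod_cast le_top)).continuousOn ⟨0, R + 1, fun x _ hx => by
        have h0 : iteratedFDeriv ℝ n V x = 0 := by
          by_contra hne
          have := hR (support_iteratedFDeriv_subset n (Function.mem_support.2 hne))
          rw [mem_closedBall_zero_iff] at this
          linarith
        simp [h0]⟩
  exact ⟨C, hC, fun p => h p (mem_univ p)⟩

/-- The available decay |p|⁻² is borderline in the plane; the weight supplies the missing power. -/
lemma integrable_stress_weight (hu : IsRegularField (interface c) u)
    (hc : ∀ i, IsClosedCurve (c i)) :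
    Integrable fun p => ‖surfaceStress u p‖ / (1 + ‖p‖) := by
  have hS := volume_interface hc
  obtain ⟨C, hC, h⟩ := norm_surfaceStress_le hu
  refine (integrable_div_one_add_norm_pow C (by norm_num : 2 < 3)).mono' ?_ ?_
  · have hw : Continuous fun p : E2 => (1 + ‖p‖)⁻¹ :=
      (continuous_const.add continuous_norm).inv₀ fun p =>
        (by positivity : (0:ℝ) < 1 + ‖p‖).ne'
    simp only [div_eq_mul_inv]
    exact (aestronglyMeasurable_surfaceStress hu hS).norm.mul hw.aestronglyMeasurable
  · filter_upwards [compl_mem_ae_iff.2 hS] with p hp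
    rw [Real.norm_of_nonneg (by positivity), pow_succ, ← div_div]
    gcongr
    exact h p hp

lemma integrable_inner_of_compactSupport {F V : E2 → E2} (hF : AEStronglyMeasurable F)
    (hFi : Integrable fun p => ‖F p‖ / (1 + ‖p‖)) (hV : Continuous V) (hVc : HasCompactSupport V) :
    Integrable fun p => inner ℝ (F p) (V p) := by
  have hVb : ∃ M, ∀ p, ‖(1 + ‖p‖) • V p‖ ≤ M := by
    have hcont : Continuous fun p : E2 => (1 + ‖p‖) • V p :=
      (continuous_const.add continuous_norm).smul hV
    have hs : HasCompactSupport ((fun p : E2 => 1 + ‖p‖) • V) := hVc.smul_left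
    exact hs.exists_bound_of_continuous hcont
  obtain ⟨M, hM⟩ := hVb
  have hm : AEStronglyMeasurable (fun p => inner ℝ (F p) (V p)) := hF.inner hV.aestronglyMeasurable
  have hg : Integrable fun p => ‖F p‖ / (1 + ‖p‖) * M := hFi.mul_const M
  refine Integrable.mono' hg hm (ae_of_all _ fun p => (norm_inner_le_norm _ _).trans ?_)
  have h1 := hM p
  rw [norm_smul, Real.norm_of_nonneg (by positivity)] at h1
  calc ‖F p‖ * ‖V p‖ = ‖F p‖ / (1 + ‖p‖) * ((1 + ‖p‖) * ‖V p‖) := by field_simp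
    _ ≤ _ := by gcongr

lemma planar_potential {F : E2 → E2} (hF : AEStronglyMeasurable F)
    (hFi : Integrable fun p => ‖F p‖ / (1 + ‖p‖)) :
    ∃ q0 : E2 → ℝ, LocallyIntegrable q0 ∧ ∀ g : E2 → ℝ, Continuous g → HasCompactSupport g →
      Integrable (fun p => inner ℝ (F p) (newtonConv g p)) ∧
      -∫ p, q0 p * g p = ∫ p, inner ℝ (F p) (newtonConv g p) := by
  have hm : Measurable fun p : E2 => p := measurable_id
  exact ⟨potential volume (fun p => p) F, locallyIntegrable_potential hm hF hFi,
    fun g hg hgc => integral_potential_mul hm hF hFi hg hgc⟩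

lemma curve_potential {c : ℝ → E2} (hc : IsClosedCurve c) :
    ∃ q1 : E2 → ℝ, LocallyIntegrable q1 ∧ ∀ g : E2 → ℝ, Continuous g → HasCompactSupport g →
      -∫ p, q1 p * g p =
        ∫ s in (0:ℝ)..1, inner ℝ (deriv (unitTangent c) s) (newtonConv g (c s)) := by
  have hcm : Measurable c := hc.contDiff.continuous.measurable
  have hT : AEStronglyMeasurable (deriv (unitTangent c)) (volume.restrict (Ioc (0:ℝ) 1)) :=
    hc.continuous_deriv_unitTangent.aestronglyMeasurable
  have hTi : Integrable (fun s => ‖deriv (unitTangent c) s‖ / (1 + ‖c s‖))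
      (volume.restrict (Ioc (0:ℝ) 1)) := by
    have hcont : Continuous fun s => ‖deriv (unitTangent c) s‖ / (1 + ‖c s‖) :=
      hc.continuous_deriv_unitTangent.norm.div
        (continuous_const.add hc.contDiff.continuous.norm) fun s =>
          (by positivity : (0:ℝ) < 1 + ‖c s‖).ne'
    exact (hcont.integrableOn_Icc (a := 0) (b := 1)).mono_set Ioc_subset_Icc_self
  refine ⟨potential (volume.restrict (Ioc (0:ℝ) 1)) c (deriv (unitTangent c)),
    locallyIntegrable_potential hcm hT hTi, fun g hg hgc => ?_⟩
  rw [intervalIntegral.integral_of_le zero_le_one]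
  exact (integral_potential_mul hcm hT hTi hg hgc).2

/-- Helmholtz decomposition of the test field: V = U + W, where W is the Newtonian gradient field
with div W = div V. The total force vanishes on the decaying solenoidal field U, and on W it is the
pairing of a potential with div V. -/
theorem exists_forceBalance (hc : ∀ i, IsClosedCurve (c i))
    (hu : IsRegularField (interface c) u) (hΔ : ∀ x ∈ B, ∑ i, pd i (pd i u) x = 0)
    (h : ∀ v, IsTangentField ∅ v → dirichlet u v = lineTension D c (surf v)) :
    ∃ q, ForceBalance D c u q := by
  have hS := volume_interface hc
  have hF := aestronglyMeasurable_surfaceStress hu hS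
  have hFi := integrable_stress_weight hu hc
  obtain ⟨q0, hq0l, hq0⟩ := planar_potential hF hFi
  choose q1 hq1l hq1 using fun i => curve_potential (hc i)
  refine ⟨fun p => q0 p + ∑ i, q1 i p, hq0l.add (locallyIntegrable_finsetSum _ fun i _ => hq1l i),
    fun V hV hVc => ?_⟩
  set g := div2 V with hg
  have hgs : ContDiff ℝ ∞ g := contDiff_div2 hV
  have hgc : HasCompactSupport g := hasCompactSupport_div2 hVc
  -- This mean value is what gives W the decay required of a trace.
  have hg0 : ∫ p, g p = 0 := integral_div2_eq_zero hV hVc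
  set W := newtonConv g with hW
  have hWs : ContDiff ℝ ∞ W := contDiff_newtonConv hgs hgc
  set U : E2 → E2 := fun p => V p - W p with hU
  have hUs : ContDiff ℝ ∞ U := hV.sub hWs
  have hUd : ∀ n : ℕ, ∃ C, 0 ≤ C ∧ ∀ p, ‖iteratedFDeriv ℝ n U p‖ ≤ C / (1 + ‖p‖) ^ 2 := by
    intro n
    obtain ⟨C1, h1, h1'⟩ := decay_of_compactSupport hV hVc n
    obtain ⟨C2, h2, h2'⟩ := newtonConv_decay hgs hgc hg0 n
    refine ⟨C1 + C2, by positivity, fun p => ?_⟩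
    have e : iteratedFDeriv ℝ n U p = iteratedFDeriv ℝ n V p - iteratedFDeriv ℝ n W p :=
      iteratedFDeriv_sub_apply (hV.contDiffAt.of_le (by exact_mod_cast le_top))
        (hWs.contDiffAt.of_le (by exact_mod_cast le_top))
    rw [e, add_div]
    exact (norm_sub_le _ _).trans (add_le_add (h1' p) (h2' p))
  have hUdiv : ∀ p, div2 U p = 0 := fun p => by
    have e : fderiv ℝ U p = fderiv ℝ V p - fderiv ℝ W p :=
      fderiv_fun_sub (hV.differentiable (by simp) p) (hWs.differentiable (by simp) p)
    have h1 : div2 U p = div2 V p - div2 W p := by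
      simp only [div2, e, sub_apply, PiLp.sub_apply, Finset.sum_sub_distrib]
    rw [h1, hW, div2_newtonConv hgs hgc, sub_self]
  obtain ⟨χ, hχ0, hχs, hχc⟩ : ∃ χ : ℝ → ℝ, χ 0 = 1 ∧ ContDiff ℝ ∞ χ ∧ HasCompactSupport χ := by
    let b : ContDiffBump (0 : ℝ) := ⟨1, 2, one_pos, one_lt_two⟩
    exact ⟨b, b.one_of_mem_closedBall (mem_closedBall_self b.rIn_pos.le), b.contDiff, b.hasCompactSupport⟩
  obtain ⟨ht, hts⟩ := isTangentField_vertExt hχs hχc hχ0 hUs hUd hUdiv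
  have key := h _ ht
  rw [dirichlet_eq_stress hu hS ht hΔ, hts, lineTension_sub hc hV.continuous hWs.continuous] at key
  obtain ⟨hi0, he0⟩ := hq0 g hgs.continuous hgc
  have hVi := integrable_inner_of_compactSupport hF hFi hV.continuous hVc
  have hUi : ∫ p, inner ℝ (surfaceStress u p) (U p) =
      (∫ p, inner ℝ (surfaceStress u p) (V p)) - ∫ p, inner ℝ (surfaceStress u p) (W p) := by
    rw [← integral_sub hVi hi0]
    simp_rw [hU, inner_sub_right]
    rfl
  have hq0i : Integrable fun p => q0 p * g p := by
    simpa [mul_comm] using hq0l.integrable_smul_left_of_hasCompactSupport hgs.continuous hgc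
  have hq1i : ∀ i ∈ Finset.univ, Integrable fun p => q1 i p * g p := fun i _ => by
    simpa [mul_comm] using (hq1l i).integrable_smul_left_of_hasCompactSupport hgs.continuous hgc
  have hline : lineTension D c W = ∑ i, -∫ p, q1 i p * g p := by
    rw [lineTension_eq hc]
    refine Finset.sum_congr rfl fun i _ => ?_
    exact (hq1 i g hgs.continuous hgc).symm
  have hsum : -∫ p, (q0 p + ∑ i, q1 i p) * g p =
      -(∫ p, q0 p * g p) + ∑ i, -∫ p, q1 i p * g p := by
    simp_rw [add_mul, Finset.sum_mul]
    rw [integral_add hq0i (integrable_finsetSum _ hq1i), integral_finsetSum _ hq1i, neg_add,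
      Finset.sum_neg_distrib]
  rw [hsum, ← hline]
  rw [he0]
  linarith

/-! ### Planar solenoidal fields and their stream functions -/

/-- The rotated gradient in the plane. -/
def rotGrad2 (f : E2 → ℝ) (p : E2) : E2 := !₂[fderiv ℝ f p (e2 1), -fderiv ℝ f p (e2 0)]

lemma norm_rotGrad2_le (f : E2 → ℝ) (p : E2) : ‖rotGrad2 f p‖ ≤ 2 * ‖fderiv ℝ f p‖ := by
  have h0 : |fderiv ℝ f p (e2 0)| ≤ ‖fderiv ℝ f p‖ := by
    simpa using (fderiv ℝ f p).le_opNorm (e2 0)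
  have h1 : |fderiv ℝ f p (e2 1)| ≤ ‖fderiv ℝ f p‖ := by
    simpa using (fderiv ℝ f p).le_opNorm (e2 1)
  refine (sq_le_sq₀ (norm_nonneg _) (by positivity)).1 ?_
  rw [norm_sq_E2]
  simp only [rotGrad2, Matrix.cons_val_zero, Matrix.cons_val_one]
  nlinarith [sq_abs (fderiv ℝ f p (e2 0)), sq_abs (fderiv ℝ f p (e2 1)),
    abs_nonneg (fderiv ℝ f p (e2 0)), abs_nonneg (fderiv ℝ f p (e2 1))]

lemma contDiff_rotGrad2 {f : E2 → ℝ} (hf : ContDiff ℝ ∞ f) : ContDiff ℝ ∞ (rotGrad2 f) := by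
  have h : ∀ i, ContDiff ℝ ∞ fun p => fderiv ℝ f p (e2 i) := fun i =>
    (hf.fderiv_right (m := ∞) (by simp)).clm_apply contDiff_const
  rw [contDiff_euclidean]
  intro i
  fin_cases i
  · exact h 1
  · exact (h 0).neg

lemma div2_rotGrad2 {f : E2 → ℝ} (hf : ContDiff ℝ ∞ f) (p : E2) : div2 (rotGrad2 f) p = 0 := by
  have hd : DifferentiableAt ℝ (fderiv ℝ f) p :=
    (hf.fderiv_right (m := ∞) (by simp)).differentiable (by simp) p
  have hr := (contDiff_rotGrad2 hf).differentiable (by simp) p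
  have h : ∀ i, HasFDerivAt (fun p => fderiv ℝ f p (e2 i)) ((fderiv ℝ (fderiv ℝ f) p).flip (e2 i))
      p := fun i => by
    simpa using hd.hasFDerivAt.clm_apply (hasFDerivAt_const (e2 i) p)
  have hc : ∀ (i : Fin 2) (w : E2), (fderiv ℝ (rotGrad2 f) p w) i =
      fderiv ℝ (fun p => rotGrad2 f p i) p w := fun i w => by
    rw [show fderiv ℝ (fun p => rotGrad2 f p i) p = _ from
      ((EuclideanSpace.proj (𝕜 := ℝ) i).hasFDerivAt.comp p hr.hasFDerivAt).fderiv]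
    rfl
  rw [div2, Fin.sum_univ_two, hc, hc,
    show fderiv ℝ (fun p => rotGrad2 f p 0) p = _ from (h 1).fderiv,
    show fderiv ℝ (fun p => rotGrad2 f p 1) p = _ from (h 0).neg.fderiv]
  have hs := (hf.contDiffAt (x := p)).isSymmSndFDerivAt (by
    simp only [minSmoothness_of_isRCLikeNormedField]; exact two_le_infty)
  have := hs.eq (e2 0) (e2 1)
  simp [this]

lemma rotGrad2_mul {f g : E2 → ℝ} (hf : ContDiff ℝ ∞ f) (hg : ContDiff ℝ ∞ g) (p : E2) :
    rotGrad2 (fun p => f p * g p) p = f p • rotGrad2 g p + g p • rotGrad2 f p := by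
  have h := ((hf.differentiable (by simp) p).hasFDerivAt.mul
    (hg.differentiable (by simp) p).hasFDerivAt).fderiv
  unfold rotGrad2
  rw [show fderiv ℝ (fun p => f p * g p) p = _ from h]
  ext i
  fin_cases i <;> simp
  ring

/-- Poincaré lemma: the one-form V₀ dy - V₁ dx is closed because V is solenoidal. -/
lemma exists_stream {V : E2 → E2} (hV : ContDiff ℝ ∞ V) (hdiv : ∀ p, div2 V p = 0) :
    ∃ ψ : E2 → ℝ, ContDiff ℝ ∞ ψ ∧ ∀ p, rotGrad2 ψ p = V p := by
  let J : E2 →L[ℝ] (E2 →L[ℝ] ℝ) :=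
    (EuclideanSpace.proj (𝕜 := ℝ) (0 : Fin 2)).smulRight (EuclideanSpace.proj (𝕜 := ℝ) (1 : Fin 2)) -
    (EuclideanSpace.proj (𝕜 := ℝ) (1 : Fin 2)).smulRight (EuclideanSpace.proj (𝕜 := ℝ) (0 : Fin 2))
  have hJ : ∀ w y : E2, J w y = w 0 * y 1 - w 1 * y 0 := fun w y => by
    simp [J]
  have hω : ContDiff ℝ ∞ fun p => J (V p) := J.contDiff.comp hV
  obtain ⟨ψ, hψ⟩ := convex_univ.exists_forall_hasFDerivAt_of_fderiv_symmetric
    isOpen_univ (hω.differentiable (by simp)).differentiableOn (fun a _ x y => by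
      have h := (J.hasFDerivAt.comp a (hV.differentiable (by simp) a).hasFDerivAt).fderiv
      rw [show fderiv ℝ (fun p => J (V p)) a = _ from h]
      simp only [ContinuousLinearMap.comp_apply, hJ]
      have hd := hdiv a
      rw [div2, Fin.sum_univ_two] at hd
      rw [E2_eq x, E2_eq y]
      simp
      linear_combination (x 0 * y 1 - x 1 * y 0) * hd)
  have hψ' : ∀ p, HasFDerivAt ψ (J (V p)) p := fun p => hψ p (mem_univ p)
  refine ⟨ψ, ?_, fun p => ?_⟩
  · rw [contDiff_infty_iff_fderiv]
    refine ⟨fun p => (hψ' p).differentiableAt, ?_⟩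
    rw [show fderiv ℝ ψ = fun p => J (V p) from funext fun p => (hψ' p).fderiv]
    exact hω
  · unfold rotGrad2
    rw [(hψ' p).fderiv]
    ext i
    fin_cases i <;> simp [hJ]

/-- Along the ray through `p` the gradient bound integrates to K(1 - 1/(1 + |p|)), which stays below
K. -/
lemma stream_bounded {ψ : E2 → ℝ} (hψ : ContDiff ℝ ∞ ψ) {K : ℝ} (hK : 0 ≤ K)
    (h : ∀ p, ‖fderiv ℝ ψ p‖ ≤ K / (1 + ‖p‖) ^ 2) (p : E2) : ‖ψ p‖ ≤ ‖ψ 0‖ + K := by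
  have hline : ∀ t : ℝ, HasDerivAt (fun t : ℝ => ψ (t • p)) (fderiv ℝ ψ (t • p) p) t := fun t => by
    have h1 : HasDerivAt (fun t : ℝ => t • p) p t := by
      simpa using (hasDerivAt_id t).smul_const p
    exact (hψ.differentiable (by simp) (t • p)).hasFDerivAt.comp_hasDerivAt t h1
  have hpos : ∀ t ∈ Icc (0:ℝ) 1, 0 < 1 + t * ‖p‖ := fun t ht => by
    have := mul_nonneg ht.1 (norm_nonneg p); linarith
  have hB : ∀ t ∈ Icc (0:ℝ) 1, HasDerivAt (fun t : ℝ => ‖ψ 0‖ + K * (1 - (1 + t * ‖p‖)⁻¹))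
      (K * (‖p‖ / (1 + t * ‖p‖) ^ 2)) t := fun t ht => by
    have h1 : HasDerivAt (fun t : ℝ => 1 + t * ‖p‖) ‖p‖ t := by
      simpa using ((hasDerivAt_id t).mul_const ‖p‖).const_add 1
    have h2 := (((h1.inv (hpos t ht).ne').const_sub 1).const_mul K).const_add ‖ψ 0‖
    rw [show K * (‖p‖ / (1 + t * ‖p‖) ^ 2) = K * -(-‖p‖ / (1 + t * ‖p‖) ^ 2) by ring]
    exact h2
  have key := image_norm_le_of_norm_deriv_right_le_deriv_boundary' (a := 0) (b := 1)
    (f := fun t : ℝ => ψ (t • p)) (f' := fun t => fderiv ℝ ψ (t • p) p)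
    (B := fun t : ℝ => ‖ψ 0‖ + K * (1 - (1 + t * ‖p‖)⁻¹))
    (B' := fun t => K * (‖p‖ / (1 + t * ‖p‖) ^ 2))
    (fun t _ => (hline t).continuousAt.continuousWithinAt) (fun t _ => (hline t).hasDerivWithinAt)
    (by simp) (fun t ht => (hB t ht).continuousAt.continuousWithinAt)
    (fun t ht => (hB t (Ico_subset_Icc_self ht)).hasDerivWithinAt) (fun t ht => by
      refine ((fderiv ℝ ψ (t • p)).le_opNorm p).trans ?_
      have h1 := h (t • p)
      rw [norm_smul, Real.norm_of_nonneg ht.1] at h1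
      calc _ ≤ K / (1 + t * ‖p‖) ^ 2 * ‖p‖ := by gcongr
        _ = _ := by ring) (right_mem_Icc.2 zero_le_one)
  simp only [one_smul, one_mul] at key
  refine key.trans ?_
  have h1 : 0 ≤ (1 + ‖p‖)⁻¹ := by positivity
  nlinarith

/-! ### Approximation of decaying solenoidal fields by compactly supported ones -/

/-- The force balance tests only compactly supported fields. Cutting off the stream function, not
the field, keeps the approximations solenoidal, so the pressure term drops out for each of them. -/
theorem dirichlet_eq_lineTension (hc : ∀ i, IsClosedCurve (c i))
    (hu : IsRegularField (interface c) u) (hΔ : ∀ x ∈ B, ∑ i, pd i (pd i u) x = 0)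
    (hF : ForceBalance D c u q) (hv : IsTangentField ∅ v) :
    dirichlet u v = lineTension D c (surf v) := by
  have hS := volume_interface hc
  rw [dirichlet_eq_stress hu hS hv hΔ]
  set V := surf v with hVdef
  have hV : ContDiff ℝ ∞ V := hv.regular.contDiff_surf
  have hdiv : ∀ p, div2 V p = 0 := fun p => hv.surface_div_free p (notMem_empty p)
  obtain ⟨CV, hCV, hVb⟩ := hv.regular.surf_decay 0
  have hVb' : ∀ p, ‖V p‖ ≤ CV / (1 + ‖p‖) ^ 2 := fun p => by simpa using hVb p
  obtain ⟨ψ, hψ, hψV⟩ := exists_stream hV hdiv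
  have hψd : ∀ p, ‖fderiv ℝ ψ p‖ ≤ (2 * CV) / (1 + ‖p‖) ^ 2 := by
    intro p
    have h0 : fderiv ℝ ψ p (e2 1) = V p 0 := by rw [← hψV p]; rfl
    have h1 : -fderiv ℝ ψ p (e2 0) = V p 1 := by rw [← hψV p]; rfl
    have hle : ‖fderiv ℝ ψ p‖ ≤ 2 * ‖V p‖ := by
      refine ContinuousLinearMap.opNorm_le_bound _ (by positivity) fun w => ?_
      have e : fderiv ℝ ψ p w = w 0 * fderiv ℝ ψ p (e2 0) + w 1 * fderiv ℝ ψ p (e2 1) := by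
        conv_lhs => rw [E2_eq w]
        simp
      rw [e, h0, show fderiv ℝ ψ p (e2 0) = -V p 1 by linarith]
      have a0 := PiLp.norm_apply_le w 0
      have a1 := PiLp.norm_apply_le w 1
      have b0 := PiLp.norm_apply_le (V p) 0
      have b1 := PiLp.norm_apply_le (V p) 1
      calc ‖w 0 * -V p 1 + w 1 * V p 0‖ ≤ ‖w 0‖ * ‖V p 1‖ + ‖w 1‖ * ‖V p 0‖ := by
            refine (norm_add_le _ _).trans ?_
            rw [norm_mul, norm_mul, norm_neg]
        _ ≤ ‖w‖ * ‖V p‖ + ‖w‖ * ‖V p‖ := by gcongr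
        _ = _ := by ring
    refine hle.trans ?_
    rw [mul_div_assoc]
    gcongr
    exact hVb' p
  set Cψ := ‖ψ 0‖ + 2 * CV with hCψ
  have hCψ0 : 0 ≤ Cψ := by positivity
  have hψb : ∀ p, ‖ψ p‖ ≤ Cψ := stream_bounded hψ (by positivity) hψd
  let b : ContDiffBump (0 : E2) := ⟨1, 2, one_pos, one_lt_two⟩
  have hbs : ContDiff ℝ ∞ (b : E2 → ℝ) := b.contDiff
  obtain ⟨M, hM⟩ := (b.hasCompactSupport.fderiv ℝ).exists_bound_of_continuous
    (hbs.continuous_fderiv (by simp))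
  have hM0 : 0 ≤ M := (norm_nonneg _).trans (hM 0)
  set η : ℕ → E2 → ℝ := fun n p => b (((n : ℝ) + 1)⁻¹ • p) with hη
  have hsm : ∀ n, ContDiff ℝ ∞ (η n) := fun n => hbs.comp (contDiff_id.const_smul _)
  have hηc : ∀ n, HasCompactSupport (η n) := fun n =>
    b.hasCompactSupport.comp_smul (by positivity)
  have hηd : ∀ n p, fderiv ℝ (η n) p = ((n : ℝ) + 1)⁻¹ • fderiv ℝ b (((n : ℝ) + 1)⁻¹ • p) :=
    fun n p => by
      have h1 : HasFDerivAt (fun p : E2 => ((n : ℝ) + 1)⁻¹ • p)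
        (((n : ℝ) + 1)⁻¹ • ContinuousLinearMap.id ℝ E2) p :=
        (((n : ℝ) + 1)⁻¹ • ContinuousLinearMap.id ℝ E2).hasFDerivAt
      have h2 := ((hbs.differentiable (by simp) (((n : ℝ) + 1)⁻¹ • p)).hasFDerivAt.comp p h1).fderiv
      rw [show fderiv ℝ (η n) p = _ from h2]
      ext w; simp
  have hη1 : ∀ (n : ℕ) (p : E2), ‖p‖ < (n : ℝ) + 1 → η n p = 1 ∧ fderiv ℝ (η n) p = 0 := by
    intro n
    have h1 : ∀ p : E2, ‖p‖ < (n : ℝ) + 1 → η n p = 1 := fun p hp => by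
      refine b.one_of_mem_closedBall ?_
      rw [mem_closedBall_zero_iff, norm_smul, norm_inv, Real.norm_of_nonneg (by positivity)]
      change _ ≤ (1:ℝ)
      rw [inv_mul_le_iff₀ (by positivity), mul_one]
      exact hp.le
    intro p hp
    refine ⟨h1 p hp, ?_⟩
    have : η n =ᶠ[𝓝 p] fun _ => 1 := by
      filter_upwards [(isOpen_lt continuous_norm continuous_const).mem_nhds hp] with y hy
      exact h1 y hy
    rw [this.fderiv_eq]; simp
  -- The derivative of η_n is at most M/(n+1) and vanishes for |p| > 2(n+1), while 1 + |p| ≤ 3(n+1)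
  -- on the remaining set.
  have hηle : ∀ n p, ‖fderiv ℝ (η n) p‖ ≤ 3 * M / (1 + ‖p‖) := by
    intro n p
    rw [hηd, norm_smul, norm_inv, Real.norm_of_nonneg (by positivity)]
    have hn : (0:ℝ) < (n : ℝ) + 1 := by positivity
    rcases le_or_gt ‖p‖ (2 * ((n : ℝ) + 1)) with hp | hp
    · rw [le_div_iff₀ (by positivity)]
      have h2 := hM (((n : ℝ) + 1)⁻¹ • p)
      calc _ ≤ ((n : ℝ) + 1)⁻¹ * M * (3 * ((n : ℝ) + 1)) := by
            gcongr
            have : (0:ℝ) ≤ n := n.cast_nonneg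
            linarith
        _ = _ := by field_simp
    · have h2 : ((n : ℝ) + 1)⁻¹ • p ∉ tsupport (fderiv ℝ b) := fun hh => by
        have h3 := tsupport_fderiv_subset ℝ hh
        rw [b.tsupport_eq, mem_closedBall_zero_iff, norm_smul, norm_inv,
          Real.norm_of_nonneg hn.le] at h3
        change _ ≤ (2:ℝ) at h3
        rw [inv_mul_le_iff₀ hn] at h3
        linarith
      rw [image_eq_zero_of_notMem_tsupport h2, norm_zero, mul_zero]
      positivity
  set Vn : ℕ → E2 → E2 := fun n => rotGrad2 fun p => η n p * ψ p with hVn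
  have hVne : ∀ n p, Vn n p = η n p • V p + ψ p • rotGrad2 (η n) p := fun n p => by
    rw [← hψV p]; exact rotGrad2_mul (hsm n) hψ p
  have hVnV : ∀ (n : ℕ) (p : E2), ‖p‖ < (n : ℝ) + 1 → Vn n p = V p := fun n p hp => by
    obtain ⟨h1, h2⟩ := hη1 n p hp
    have h3 : rotGrad2 (η n) p = 0 := by
      ext i; fin_cases i <;> simp [rotGrad2, h2]
    rw [hVne, h1, h3, one_smul, smul_zero, add_zero]
  have hVns : ∀ n, ContDiff ℝ ∞ (Vn n) := fun n => contDiff_rotGrad2 ((hsm n).mul hψ)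
  have hVnc : ∀ n, HasCompactSupport (Vn n) := fun n => by
    have h1 : HasCompactSupport fun p => η n p * ψ p := (hηc n).mul_right
    exact (h1.fderiv ℝ).comp_left (g := fun L : E2 →L[ℝ] ℝ => (!₂[L (e2 1), -L (e2 0)] : E2))
      (by ext i; fin_cases i <;> simp)
  have hbal : ∀ n, (∫ p, inner ℝ (surfaceStress u p) (Vn n p)) = -lineTension D c (Vn n) :=
    fun n => by
    have h1 := hF.2 (Vn n) (hVns n) (hVnc n)
    have h2 : ∀ p, div2 (Vn n) p = 0 := div2_rotGrad2 ((hsm n).mul hψ)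
    simp only [h2, mul_zero, integral_zero, neg_zero] at h1
    linarith
  obtain ⟨R, hR⟩ := (isCompact_interface hc).isBounded.subset_closedBall 0
  -- The curves are compact, so for large n they lie where the cutoff is 1.
  have hline : ∀ᶠ n : ℕ in atTop, lineTension D c (Vn n) = lineTension D c V := by
    filter_upwards [eventually_ge_atTop ⌈R⌉₊] with n hn
    refine lineTension_congr fun p hp => hVnV n p ?_
    have h1 := hR hp
    rw [mem_closedBall_zero_iff] at h1
    have h2 : R ≤ n := (Nat.le_ceil R).trans (by exact_mod_cast hn)
    linarith
  obtain ⟨CF, hCF, hFb⟩ := norm_surfaceStress_le hu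
  have hlim : Tendsto (fun n => ∫ p, inner ℝ (surfaceStress u p) (Vn n p)) atTop
      (𝓝 (∫ p, inner ℝ (surfaceStress u p) (V p))) := by
    -- The stress is O(|p|⁻²), and the cut-off fields are O(|p|⁻¹) uniformly in n because ψ is
    -- bounded; |p|⁻³ is integrable at infinity.
    refine tendsto_integral_of_dominated_convergence
      (fun p => CF * (CV + Cψ * (2 * (3 * M))) / (1 + ‖p‖) ^ 3) (fun n => ?_)
      (integrable_div_one_add_norm_pow _ (by norm_num)) (fun n => ?_) ?_
    · exact (aestronglyMeasurable_surfaceStress hu hS).inner (hVns n).continuous.aestronglyMeasurable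
    · filter_upwards [compl_mem_ae_iff.2 hS] with p hp
      have h1 : ‖Vn n p‖ ≤ (CV + Cψ * (2 * (3 * M))) / (1 + ‖p‖) := by
        have hη01 : ‖η n p‖ ≤ 1 := by
          rw [Real.norm_of_nonneg b.nonneg]; exact b.le_one
        have h2 : ‖V p‖ ≤ CV / (1 + ‖p‖) := by
          refine (hVb' p).trans ?_
          have : 1 + ‖p‖ ≤ (1 + ‖p‖) ^ 2 := by nlinarith [norm_nonneg p]
          gcongr
        have h3 : ‖rotGrad2 (η n) p‖ ≤ 2 * (3 * M) / (1 + ‖p‖) := by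
          rw [mul_div_assoc]
          exact (norm_rotGrad2_le _ _).trans (by gcongr; exact hηle n p)
        rw [hVne]
        calc _ ≤ ‖η n p‖ * ‖V p‖ + ‖ψ p‖ * ‖rotGrad2 (η n) p‖ := by
              rw [← norm_smul, ← norm_smul]; exact norm_add_le _ _
          _ ≤ 1 * (CV / (1 + ‖p‖)) + Cψ * (2 * (3 * M) / (1 + ‖p‖)) := by
              gcongr
              exact hψb p
          _ = _ := by ring
      have e : CF * (CV + Cψ * (2 * (3 * M))) / (1 + ‖p‖) ^ 3 =
          CF / (1 + ‖p‖) ^ 2 * ((CV + Cψ * (2 * (3 * M))) / (1 + ‖p‖)) := by field_simp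
      rw [e]
      exact (norm_inner_le_norm _ _).trans
        (mul_le_mul (hFb p hp) h1 (norm_nonneg _) (by positivity))
    · refine ae_of_all _ fun p => tendsto_const_nhds.congr' ?_
      filter_upwards [eventually_ge_atTop ⌈‖p‖⌉₊] with n hn
      have h2 : ‖p‖ ≤ n := (Nat.le_ceil _).trans (by exact_mod_cast hn)
      rw [hVnV n p (by linarith)]
  have hlim2 : Tendsto (fun n => ∫ p, inner ℝ (surfaceStress u p) (Vn n p)) atTop
      (𝓝 (-lineTension D c V)) := by
    refine tendsto_const_nhds.congr' ?_
    filter_upwards [hline] with n hn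
    rw [hbal n, hn]
  rw [tendsto_nhds_unique hlim hlim2, neg_neg]

end
end Langmuir
end

/-! ### The first variation of length along a flow. -/

noncomputable section
namespace Langmuir

section
open scoped NNReal

/-! ### Dependence of trajectories on the initial point -/

/-- The acceleration along a trajectory is DV·V, which is Lipschitz in position, and Grönwall
controls the distance of two trajectories. Integrating the difference of accelerations twice gives
τ². This replaces differentiability of the flow in its initial point. -/
lemma trajectory_remainder_le {V : E2 → E2} {K K₂ : ℝ≥0} (hV : Differentiable ℝ V)
    (hK : LipschitzWith K V) (hA : LipschitzWith K₂ fun p => fderiv ℝ V p (V p)) {x y : ℝ → E2}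
    (hx : ∀ t, HasDerivAt x (V (x t)) t) (hy : ∀ t, HasDerivAt y (V (y t)) t) {τ : ℝ}
    (h0 : 0 ≤ τ) (h1 : τ ≤ 1) :
    ‖(x τ - x 0 - τ • V (x 0)) - (y τ - y 0 - τ • V (y 0))‖ ≤
      K₂ * Real.exp K * τ ^ 2 * ‖x 0 - y 0‖ := by
  set C := K₂ * Real.exp K * ‖x 0 - y 0‖ with hC
  have hC0 : 0 ≤ C := by positivity
  have hD : ∀ σ ∈ Icc (0:ℝ) τ, ‖x σ - y σ‖ ≤ ‖x 0 - y 0‖ * Real.exp K := fun σ hσ => by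
    have h := dist_le_of_trajectories_ODE (v := fun _ => V) (a := 0) (b := τ) (fun _ => hK)
      (fun t _ => (hx t).continuousAt.continuousWithinAt) (fun t _ => (hx t).hasDerivWithinAt)
      (fun t _ => (hy t).continuousAt.continuousWithinAt) (fun t _ => (hy t).hasDerivWithinAt)
      le_rfl σ hσ
    rw [dist_eq_norm, dist_eq_norm, sub_zero] at h
    refine h.trans ?_
    gcongr
    exact mul_le_of_le_one_right K.coe_nonneg (hσ.2.trans h1)
  have hVx : ∀ {z : ℝ → E2}, (∀ t, HasDerivAt z (V (z t)) t) →
      ∀ t, HasDerivAt (fun t => V (z t)) (fderiv ℝ V (z t) (V (z t))) t := fun hz t =>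
    (hV _).hasFDerivAt.comp_hasDerivAt t (hz t)
  have hG : ∀ σ ∈ Icc (0:ℝ) τ, ‖(V (x σ) - V (y σ)) - (V (x 0) - V (y 0))‖ ≤ C * τ := by
    intro σ hσ
    refine (norm_image_sub_le_of_norm_deriv_le_segment' (C := C)
      (f := fun t => V (x t) - V (y t))
      (fun t _ => ((hVx hx t).sub (hVx hy t)).hasDerivWithinAt) (fun t ht => ?_) σ hσ).trans ?_
    · refine (hA.norm_sub_le _ _).trans ?_
      rw [hC, mul_assoc, mul_comm (Real.exp _)]
      gcongr
      exact hD t (Ico_subset_Icc_self ht)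
    · rw [sub_zero]
      gcongr
      exact hσ.2
  have hF := norm_image_sub_le_of_norm_deriv_le_segment' (C := C * τ) (a := 0) (b := τ)
    (f := fun t => x t - y t - t • (V (x 0) - V (y 0)))
    (fun t _ => (((hx t).sub (hy t)).sub
      ((hasDerivAt_id t).smul_const (V (x 0) - V (y 0)))).hasDerivWithinAt) (fun t ht => by
        simpa using hG t (Ico_subset_Icc_self ht)) τ (right_mem_Icc.2 h0)
  calc _ = ‖(x τ - y τ - τ • (V (x 0) - V (y 0))) - (x 0 - y 0 - (0:ℝ) • (V (x 0) - V (y 0)))‖ := by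
        congr 1; module
    _ ≤ _ := hF
    _ = _ := by rw [hC]; ring

lemma trajectory_remainder_le_abs {V : E2 → E2} {K K₂ : ℝ≥0} (hV : Differentiable ℝ V)
    (hK : LipschitzWith K V) (hA : LipschitzWith K₂ fun p => fderiv ℝ V p (V p)) {x y : ℝ → E2}
    (hx : ∀ t, HasDerivAt x (V (x t)) t) (hy : ∀ t, HasDerivAt y (V (y t)) t) {τ : ℝ}
    (h1 : |τ| ≤ 1) :
    ‖(x τ - x 0 - τ • V (x 0)) - (y τ - y 0 - τ • V (y 0))‖ ≤
      K₂ * Real.exp K * τ ^ 2 * ‖x 0 - y 0‖ := by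
  rcases le_total 0 τ with h0 | h0
  · exact trajectory_remainder_le hV hK hA hx hy h0 ((le_abs_self _).trans h1)
  · have hrev : ∀ {z : ℝ → E2}, (∀ t, HasDerivAt z (V (z t)) t) →
        ∀ t, HasDerivAt (fun t => z (-t)) (-V (z (-t))) t := fun {z} hz t => by
      have h2 : HasDerivAt (fun t : ℝ => -t) (-1) t := hasDerivAt_neg t
      have h3 := (hz (-t)).scomp t h2
      rwa [neg_one_smul] at h3
    -- Time reversal changes the sign of the velocity but not of the acceleration, so the same
    -- constants serve negative times.
    have hd : ∀ p, fderiv ℝ (fun p => -V p) p (-V p) = fderiv ℝ V p (V p) := fun p => by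
      rw [fderiv_fun_neg]; simp
    have h := trajectory_remainder_le (V := fun p => -V p) (K := K) (K₂ := K₂) hV.neg hK.neg
      (by simpa only [hd] using hA) (hrev hx) (hrev hy) (τ := -τ) (by linarith)
      (by rw [abs_of_nonpos h0] at h1; exact h1)
    simpa using h

/-! ### First variation of the length -/

/-- Multiplied by |a|, the lower bound is Cauchy–Schwarz for a and a + h, and the upper one is
2|a||a + h| ≤ |a|² + |a + h|². -/
lemma abs_norm_add_sub_le {a h : E2} (ha : a ≠ 0) :
    |‖a + h‖ - ‖a‖ - inner ℝ (‖a‖⁻¹ • a) h| ≤ ‖h‖ ^ 2 / ‖a‖ := by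
  have hn := norm_pos_iff.2 ha
  have h1 : inner ℝ (‖a‖⁻¹ • a) h = inner ℝ a h / ‖a‖ := by
    rw [real_inner_smul_left]; field_simp
  have h2 := norm_add_sq_real a h
  have h3 : ‖a‖ ^ 2 + inner ℝ a h ≤ ‖a‖ * ‖a + h‖ := by
    have := real_inner_le_norm a (a + h)
    rwa [inner_add_right, real_inner_self_eq_norm_sq] at this
  rw [h1, abs_le]
  have e : ‖a + h‖ - ‖a‖ - inner ℝ a h / ‖a‖ =
      (‖a‖ * ‖a + h‖ - ‖a‖ ^ 2 - inner ℝ a h) / ‖a‖ := by field_simp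
  rw [e, ← neg_div]
  constructor
  · gcongr; nlinarith [sq_nonneg ‖h‖]
  · gcongr; nlinarith [sq_nonneg (‖a + h‖ - ‖a‖), sq_nonneg ‖h‖]

lemma hasDerivAt_zero_of_quadratic {f : ℝ → ℝ} {d C : ℝ}
    (h : ∀ τ, |τ| ≤ 1 → |f τ - f 0 - τ * d| ≤ C * τ ^ 2) : HasDerivAt f d 0 := by
  rw [hasDerivAt_iff_isLittleO_nhds_zero]
  refine Asymptotics.IsBigO.trans_isLittleO ?_ (Asymptotics.isLittleO_pow_id one_lt_two)
  refine Asymptotics.IsBigO.of_bound C ?_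
  filter_upwards [Metric.closedBall_mem_nhds (0:ℝ) one_pos] with τ hτ
  rw [mem_closedBall_zero_iff] at hτ
  simpa using h τ hτ

lemma IsClosedCurve.exists_lipschitzWith {c : ℝ → E2} (hc : IsClosedCurve c) :
    ∃ L : ℝ≥0, LipschitzWith L c := by
  have hp : Function.Periodic (deriv c) 1 := fun s => by
    rw [← deriv_comp_add_const]
    exact congrArg (fun f => deriv f s) (funext hc.periodic)
  obtain ⟨M, hM⟩ := isCompact_Icc.exists_bound_of_continuousOn (s := Icc (0:ℝ) 1)
    hc.contDiff_deriv.continuous.continuousOn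
  have hb : ∀ s, ‖deriv c s‖ ≤ M := fun s => by
    obtain ⟨t, ht, h⟩ := hp.exists_mem_Ico₀ one_pos s
    rw [h]
    exact hM t (Ico_subset_Icc_self ht)
  refine ⟨M.toNNReal, lipschitzWith_of_nnnorm_deriv_le (hc.contDiff.differentiable two_ne_zero)
    fun s => ?_⟩
  rw [← NNReal.coe_le_coe, coe_nnnorm]
  exact (hb s).trans (Real.le_coe_toNNReal M)

/-- The moved curve is c + τ V∘c + R, with R Lipschitz of constant O(τ²). Hence it is differentiable
almost everywhere with derivative c' + τ(V∘c)' up to O(τ²), which suffices under the length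
integral. -/
theorem hasDerivAt_length {c : ℝ → E2} (hc : IsClosedCurve c) {V : E2 → E2} {K K₂ : ℝ≥0}
    (hV : ContDiff ℝ ∞ V) (hK : LipschitzWith K V)
    (hA : LipschitzWith K₂ fun p => fderiv ℝ V p (V p)) {X : ℝ → E2 → E2}
    (hX0 : ∀ p, X 0 p = p) (hX : ∀ p t, HasDerivAt (fun t => X t p) (V (X t p)) t) :
    HasDerivAt (fun τ => ∫ s in (0:ℝ)..1, ‖deriv (fun s => X τ (c s)) s‖)
      (∫ s in (0:ℝ)..1, inner ℝ (unitTangent c s) (deriv (fun s => V (c s)) s)) 0 := by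
  obtain ⟨L, hL⟩ := hc.exists_lipschitzWith
  have hcd : Differentiable ℝ c := hc.contDiff.differentiable two_ne_zero
  have hW1 : ContDiff ℝ 1 fun s => V (c s) :=
    (hV.of_le (by exact_mod_cast le_top)).comp (hc.contDiff.of_le one_le_two)
  have hVd : Differentiable ℝ fun s => V (c s) := hW1.differentiable one_ne_zero
  set W := deriv fun s => V (c s) with hW
  have hWc : Continuous W := hW1.continuous_deriv le_rfl
  have hcc : Continuous (deriv c) := hc.contDiff_deriv.continuous
  have hTc : Continuous (unitTangent c) := hc.contDiff_unitTangent.continuous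
  obtain ⟨M, hM⟩ := isCompact_Icc.exists_bound_of_continuousOn (s := Icc (0:ℝ) 1)
    (f := fun s => ‖W s‖ ^ 2 / ‖deriv c s‖)
    ((hWc.norm.pow 2).div hcc.norm fun s => norm_ne_zero_iff.2 (hc.regular s)).continuousOn
  set C' := K₂ * Real.exp K * L with hC'
  refine hasDerivAt_zero_of_quadratic (C := C' + M) fun τ hτ => ?_
  have hC0 : 0 ≤ C' * τ ^ 2 := by positivity
  set R : ℝ → E2 := fun s => X τ (c s) - c s - τ • V (c s) with hR
  have hRl : LipschitzWith (C' * τ ^ 2).toNNReal R := by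
    refine LipschitzWith.of_dist_le_mul fun s t => ?_
    rw [Real.coe_toNNReal _ hC0, dist_eq_norm]
    have h := trajectory_remainder_le_abs (hV.differentiable (by simp)) hK hA (hX (c s)) (hX (c t)) hτ
    simp only [hX0] at h
    refine h.trans ?_
    have h2 := hL.norm_sub_le s t
    calc _ ≤ K₂ * Real.exp K * τ ^ 2 * (L * ‖s - t‖) := by gcongr
      _ = _ := by rw [hC', dist_eq_norm]; ring
  have hYd : ∀ᵐ s, ‖deriv (fun s => X τ (c s)) s - (deriv c s + τ • W s)‖ ≤ C' * τ ^ 2 := by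
    filter_upwards [hRl.ae_differentiableAt_real] with s hs
    have h1 : HasDerivAt (fun s => R s + (c s + τ • V (c s))) (deriv R s + (deriv c s + τ • W s)) s :=
      hs.hasDerivAt.add ((hcd s).hasDerivAt.add ((hVd s).hasDerivAt.const_smul τ))
    have h2 : (fun s => R s + (c s + τ • V (c s))) = fun s => X τ (c s) := by
      funext s; simp only [hR]; module
    rw [h2] at h1
    rw [h1.deriv, add_sub_cancel_right]
    refine (norm_deriv_le_of_lipschitz hRl).trans ?_
    rw [Real.coe_toNNReal _ hC0]
  have hYi : IntervalIntegrable (fun s => ‖deriv (fun s => X τ (c s)) s‖) volume 0 1 := by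
    have hg : Continuous fun s => ‖deriv c s + τ • W s‖ + C' * τ ^ 2 :=
      (hcc.add (hWc.const_smul τ)).norm.add continuous_const
    refine (hg.intervalIntegrable 0 1).mono_fun' (aestronglyMeasurable_deriv _ _).norm ?_
    filter_upwards [ae_restrict_of_ae hYd] with s hs
    rw [norm_norm]
    have := norm_sub_norm_le (deriv (fun s => X τ (c s)) s) (deriv c s + τ • W s)
    linarith
  have hci : IntervalIntegrable (fun s => ‖deriv c s‖) volume 0 1 := hcc.norm.intervalIntegrable _ _
  have hTi : IntervalIntegrable (fun s => τ * inner ℝ (unitTangent c s) (W s)) volume 0 1 :=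
    (continuous_const.mul (hTc.inner hWc)).intervalIntegrable _ _
  have h0 : (∫ s in (0:ℝ)..1, ‖deriv (fun s => X 0 (c s)) s‖) = ∫ s in (0:ℝ)..1, ‖deriv c s‖ := by
    simp only [hX0]
  rw [h0, ← intervalIntegral.integral_const_mul, ← intervalIntegral.integral_sub hYi hci,
    ← intervalIntegral.integral_sub (hYi.sub hci) hTi, ← Real.norm_eq_abs]
  refine (intervalIntegral.norm_integral_le_of_norm_le_const_ae (C := (C' + M) * τ ^ 2) ?_).trans
    (by simp)
  filter_upwards [hYd] with s hs hs01
  rw [uIoc_of_le zero_le_one] at hs01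
  have h1 := abs_norm_add_sub_le (h := τ • W s) (hc.regular s)
  have h2 := hM s (Ioc_subset_Icc_self hs01)
  rw [Real.norm_of_nonneg (by positivity)] at h2
  have h3 := abs_norm_sub_norm_le (deriv (fun s => X τ (c s)) s) (deriv c s + τ • W s)
  have h4 : ‖τ • W s‖ ^ 2 / ‖deriv c s‖ ≤ M * τ ^ 2 := by
    rw [norm_smul, mul_pow, Real.norm_eq_abs, sq_abs, mul_div_assoc, mul_comm]
    gcongr
  have h5 : inner ℝ (‖deriv c s‖⁻¹ • deriv c s) (τ • W s) = τ * inner ℝ (unitTangent c s) (W s) := by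
    rw [real_inner_smul_right]; rfl
  rw [h5] at h1
  rw [Real.norm_eq_abs]
  calc _ = |(‖deriv (fun s => X τ (c s)) s‖ - ‖deriv c s + τ • W s‖) +
        (‖deriv c s + τ • W s‖ - ‖deriv c s‖ - τ * inner ℝ (unitTangent c s) (W s))| := by
        congr 1; ring
    _ ≤ C' * τ ^ 2 + M * τ ^ 2 := (abs_add_le _ _).trans (add_le_add (h3.trans hs) (h1.trans h4))
    _ = _ := by ring

/-- Integration by parts over one period; the boundary terms agree because the curve closes
smoothly. -/
lemma integral_unitTangent_inner {c : ℝ → E2} (hc : IsClosedCurve c) {V : E2 → E2}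
    (hV : ContDiff ℝ ∞ V) :
    ∫ s in (0:ℝ)..1, inner ℝ (unitTangent c s) (deriv (fun s => V (c s)) s) =
      -∫ s in (0:ℝ)..1, inner ℝ (deriv (unitTangent c) s) (V (c s)) := by
  have hW1 : ContDiff ℝ 1 fun s => V (c s) :=
    (hV.of_le (by exact_mod_cast le_top)).comp (hc.contDiff.of_le one_le_two)
  have hT1 := hc.contDiff_unitTangent
  have hi1 : IntervalIntegrable (fun s => inner ℝ (unitTangent c s) (deriv (fun s => V (c s)) s))
      volume 0 1 := (hT1.continuous.inner (hW1.continuous_deriv le_rfl)).intervalIntegrable _ _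
  have hi2 : IntervalIntegrable (fun s => inner ℝ (deriv (unitTangent c) s) (V (c s)))
      volume 0 1 := ((hT1.continuous_deriv le_rfl).inner hW1.continuous).intervalIntegrable _ _
  have h := intervalIntegral.integral_eq_sub_of_hasDerivAt (a := 0) (b := 1)
    (fun s _ => ((hT1.differentiable one_ne_zero s).hasDerivAt.inner ℝ
      (hW1.differentiable one_ne_zero s).hasDerivAt)) (hi1.add hi2)
  have hp : deriv c 1 = deriv c 0 := by
    have h1 : deriv (fun s => c (s + 1)) 0 = deriv c (0 + 1) := deriv_comp_add_const c 1 0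
    rw [zero_add] at h1
    rw [← h1]
    exact congrArg (fun f => deriv f 0) (funext hc.periodic)
  have hp0 : c 1 = c 0 := by simpa using hc.periodic 0
  have hpT : unitTangent c 1 = unitTangent c 0 := by rw [unitTangent, hp]; rfl
  rw [intervalIntegral.integral_add hi1 hi2, hpT, hp0, sub_self] at h
  linarith

end
end Langmuir
end

/-! ### Existence of flows, and the derivative of the energy. -/

noncomputable section
namespace Langmuir

section
open scoped NNReal
variable {m : ℕ} {γ : Fin m → ℝ → E2} {φ v : E3 → E3}

/-! ### Global flows -/

/-- A field bounded by L moves a point at most L(n+1) in time n+1, so Picard–Lindelöf applies on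
every window [-(n+1), n+1]; uniqueness glues the solutions. -/
lemma exists_global_trajectory {E : Type*} [NormedAddCommGroup E] [NormedSpace ℝ E]
    [CompleteSpace E] {V : E → E} {K L : ℝ≥0} (hK : LipschitzWith K V) (hL : ∀ x, ‖V x‖ ≤ L)
    (x : E) : ∃ α : ℝ → E, α 0 = x ∧ ∀ t, HasDerivAt α (V (α t)) t := by
  have hloc : ∀ n : ℕ, ∃ α : ℝ → E, α 0 = x ∧ ∀ t ∈ Ioo (-(n + 1 : ℝ)) (n + 1),
      HasDerivAt α (V (α t)) t := fun n => by
    have hn : (0:ℝ) < n + 1 := by positivity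
    have hP : IsPicardLindelof (fun _ => V) (tmin := -(n + 1 : ℝ)) (tmax := n + 1)
        ⟨0, by constructor <;> linarith⟩ x (L * (n + 1)) 0 L K :=
      IsPicardLindelof.of_time_independent (fun y _ => hL y) hK.lipschitzOnWith (by simp)
    obtain ⟨α, h0, h⟩ := hP.exists_eq_forall_mem_Icc_hasDerivWithinAt₀
    exact ⟨α, h0, fun t ht => (h t (Ioo_subset_Icc_self ht)).hasDerivAt (Icc_mem_nhds ht.1 ht.2)⟩
  choose α hα0 hα using hloc
  have hagree : ∀ {n k : ℕ}, n ≤ k → EqOn (α n) (α k) (Ioo (-(n + 1 : ℝ)) (n + 1)) := by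
    intro n k hnk
    have hnk' : (n : ℝ) ≤ k := by exact_mod_cast hnk
    exact ODE_solution_unique_of_mem_Ioo (v := fun _ => V) (s := fun _ => univ) (K := K)
      (t₀ := 0) (fun t _ => hK.lipschitzOnWith) (by constructor <;> linarith [n.cast_nonneg (α := ℝ)])
      (fun t ht => ⟨hα n t ht, mem_univ _⟩)
      (fun t ht => ⟨hα k t ⟨by linarith [ht.1], by linarith [ht.2]⟩, mem_univ _⟩)
      (by rw [hα0, hα0])
  have hmem : ∀ t : ℝ, t ∈ Ioo (-((⌈|t|⌉₊ : ℕ) + 1 : ℝ)) ((⌈|t|⌉₊ : ℕ) + 1) := fun t => by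
    have h := Nat.le_ceil |t|
    have h2 := abs_le.1 h
    constructor <;> linarith [h2.1, h2.2]
  refine ⟨fun t => α ⌈|t|⌉₊ t, by simp [hα0], fun t => ?_⟩
  set n := ⌈|t|⌉₊ + 1 with hn
  have hev : (fun t => α ⌈|t|⌉₊ t) =ᶠ[𝓝 t] α n := by
    filter_upwards [isOpen_Ioo.mem_nhds (hmem t)] with r hr
    have h1 : ⌈|r|⌉₊ ≤ n := by
      refine Nat.ceil_le.2 ?_
      rw [hn, abs_le]; push_cast
      exact ⟨by linarith [hr.1], by linarith [hr.2]⟩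
    exact hagree h1 (hmem r)
  have ht : t ∈ Ioo (-(n + 1 : ℝ)) (n + 1) := by
    have := hmem t
    rw [hn]; push_cast
    constructor <;> linarith [this.1, this.2]
  have e : α ⌈|t|⌉₊ t = α n t := hev.eq_of_nhds
  rw [hev.hasDerivAt_iff]
  change HasDerivAt (α n) (V (α ⌈|t|⌉₊ t)) t
  rw [e]
  exact hα n t ht

/-- The nearest point of the closed half space. -/
def clampBbar (x : E3) : E3 := lift (hor x) (min (x 2) 0)

lemma clampBbar_mem (x : E3) : clampBbar x ∈ Bbar := by
  simp [clampBbar, Bbar]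

lemma clampBbar_of_mem {x : E3} (hx : x ∈ Bbar) : clampBbar x = x := by
  have : x 2 ≤ 0 := hx
  rw [clampBbar, min_eq_left this, lift_hor]

lemma lipschitzWith_clampBbar : LipschitzWith 1 clampBbar := by
  refine LipschitzWith.of_dist_le_mul fun x y => ?_
  rw [NNReal.coe_one, one_mul, EuclideanSpace.dist_eq, EuclideanSpace.dist_eq]
  refine Real.sqrt_le_sqrt (Finset.sum_le_sum fun i _ => ?_)
  fin_cases i
  · simp [clampBbar]
  · simp [clampBbar]
  · simp only [clampBbar, Real.dist_eq]
    have h := abs_min_sub_min_le_max (x 2) 0 (y 2) 0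
    simp only [sub_self, abs_zero] at h
    rw [max_eq_left (abs_nonneg _)] at h
    exact pow_le_pow_left₀ (abs_nonneg _) h 2

lemma IsRegularField.exists_lipschitzOnWith (hv : IsRegularField ∅ v) :
    ∃ K : ℝ≥0, LipschitzOnWith K v Bbar := by
  obtain ⟨C, hC, h⟩ := hv.closed_decay 1
  refine ⟨C.toNNReal, convex_Bbar.lipschitzOnWith_of_nnnorm_fderivWithin_le (𝕜 := ℝ)
    (hv.contDiffOn_Bbar.differentiableOn (by simp)) fun x hx => ?_⟩
  rw [← NNReal.coe_le_coe, coe_nnnorm, Real.coe_toNNReal _ hC]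
  have h1 := h x hx
  rw [norm_iteratedFDerivWithin_one _ (uniqueDiffOn_Bbar x hx)] at h1
  exact h1.trans (div_le_self hC (one_le_pow₀ (by linarith [norm_nonneg x])))

/-- Composing with the projection onto the closed half space extends the field to a bounded
Lipschitz one. Its values are horizontal, so heights are preserved and trajectories never leave the
region where the extension agrees with the field. -/
lemma IsTangentField.exists_isFlow (hv : IsTangentField ∅ v) : ∃ ψ, IsFlow v ψ := by
  obtain ⟨K, hK⟩ := hv.regular.exists_lipschitzOnWith
  obtain ⟨L, hL0, hL⟩ := hv.regular.closed_decay 0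
  have hKc : LipschitzWith K fun x => v (clampBbar x) := by
    have h := hK.comp (lipschitzWith_clampBbar.lipschitzOnWith (s := univ))
      (fun x _ => clampBbar_mem x)
    rw [mul_one] at h
    exact lipschitzOnWith_univ.1 h
  have hLc : ∀ x, ‖v (clampBbar x)‖ ≤ L.toNNReal := fun x => by
    have h := hL _ (clampBbar_mem x)
    rw [norm_iteratedFDerivWithin_zero] at h
    rw [Real.coe_toNNReal _ hL0]
    exact h.trans (div_le_self hL0 (one_le_pow₀ (by linarith [norm_nonneg (clampBbar x)])))
  choose α hα0 hα using exists_global_trajectory hKc hLc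
  refine ⟨fun t x => α x t, fun x hx => ⟨hα0 x, fun τ => ?_⟩⟩
  have h2 : ∀ t, α x t 2 = x 2 := fun t => by
    have hd : ∀ t, HasDerivAt (fun t => α x t 2) 0 t := fun t => by
      have h := (EuclideanSpace.proj (𝕜 := ℝ) (2 : Fin 3)).hasFDerivAt.comp_hasDerivAt t (hα x t)
      have e : (EuclideanSpace.proj (𝕜 := ℝ) (2 : Fin 3)) (v (clampBbar (α x t))) = 0 :=
        hv.horizontal _ (clampBbar_mem _)
      rw [e] at h
      exact h
    have h := is_const_of_deriv_eq_zero (fun t => (hd t).differentiableAt) (fun t => (hd t).deriv) t 0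
    rw [h, hα0]
  have hm : α x τ ∈ Bbar := by
    change α x τ 2 ≤ 0
    rw [h2]; exact hx
  refine ⟨hm, ?_⟩
  have := hα x τ
  rwa [clampBbar_of_mem hm] at this

/-! ### First variation of the energy -/

lemma IsFlow.emb_surf {ψ : ℝ → E3 → E3} (hψ : IsFlow v ψ) (hv : IsTangentField ∅ v) (τ : ℝ)
    (p : E2) : emb (surf (ψ τ) p) = ψ τ (emb p) := by
  have hp := emb_mem_Bbar p
  have hd : ∀ t, HasDerivAt (fun t => ψ t (emb p) 2) 0 t := fun t => by
    obtain ⟨hm, h⟩ := (hψ _ hp).2 t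
    have h := (EuclideanSpace.proj (𝕜 := ℝ) (2 : Fin 3)).hasFDerivAt.comp_hasDerivAt t h
    have e : (EuclideanSpace.proj (𝕜 := ℝ) (2 : Fin 3)) (v (ψ t (emb p))) = 0 :=
      hv.horizontal _ hm
    rw [e] at h
    exact h
  refine emb_hor ?_
  have h := is_const_of_deriv_eq_zero (fun t => (hd t).differentiableAt) (fun t => (hd t).deriv) τ 0
  rw [h, (hψ _ hp).1]
  simp

lemma IsFlow.hasDerivAt_surf {ψ : ℝ → E3 → E3} (hψ : IsFlow v ψ) (hv : IsTangentField ∅ v)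
    (p : E2) (t : ℝ) : HasDerivAt (fun t => surf (ψ t) p) (surf v (surf (ψ t) p)) t := by
  have h := horL.hasFDerivAt.comp_hasDerivAt t ((hψ _ (emb_mem_Bbar p)).2 t).2
  have e : surf v (surf (ψ t) p) = horL (v (ψ t (emb p))) := by
    rw [surf, hψ.emb_surf hv]; rfl
  rw [e]
  exact h

lemma IsTangentField.exists_lipschitzWith_surf (hv : IsTangentField ∅ v) :
    ∃ K K₂ : ℝ≥0, LipschitzWith K (surf v) ∧
      LipschitzWith K₂ fun p => fderiv ℝ (surf v) p (surf v p) := by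
  have hV := hv.regular.contDiff_surf
  have hb : ∀ n : ℕ, ∃ C : ℝ≥0, ∀ p, ‖iteratedFDeriv ℝ n (surf v) p‖ ≤ C := fun n => by
    obtain ⟨C, hC, h⟩ := hv.regular.surf_decay n
    exact ⟨C.toNNReal, fun p => by
      rw [Real.coe_toNNReal _ hC]
      exact (h p).trans (div_le_self hC (one_le_pow₀ (by linarith [norm_nonneg p])))⟩
  obtain ⟨C0, h0⟩ := hb 0
  obtain ⟨C1, h1⟩ := hb 1
  obtain ⟨C2, h2⟩ := hb 2
  simp only [norm_iteratedFDeriv_zero] at h0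
  simp only [norm_iteratedFDeriv_one] at h1
  have hV' : ContDiff ℝ ∞ (fderiv ℝ (surf v)) := hV.fderiv_right (by simp)
  have hl1 : LipschitzWith C1 (surf v) :=
    lipschitzWith_of_nnnorm_fderiv_le (hV.differentiable (by simp)) h1
  have hl2 : LipschitzWith C2 (fderiv ℝ (surf v)) :=
    lipschitzWith_of_nnnorm_fderiv_le (hV'.differentiable (by simp)) fun p => by
      have h := h2 p
      rw [← norm_iteratedFDeriv_fderiv, norm_iteratedFDeriv_one] at h
      exact h
  refine ⟨C1, C2 * C0 + C1 * C1, hl1, LipschitzWith.of_dist_le_mul fun p q => ?_⟩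
  rw [dist_eq_norm, dist_eq_norm]
  have e : fderiv ℝ (surf v) p (surf v p) - fderiv ℝ (surf v) q (surf v q) =
      (fderiv ℝ (surf v) p - fderiv ℝ (surf v) q) (surf v p) +
        fderiv ℝ (surf v) q (surf v p - surf v q) := by simp
  rw [e]
  have a1 := hl1.norm_sub_le p q
  have a2 := hl2.norm_sub_le p q
  have a0 := h0 p
  have a3 := h1 q
  calc _ ≤ ‖fderiv ℝ (surf v) p - fderiv ℝ (surf v) q‖ * ‖surf v p‖ +
        ‖fderiv ℝ (surf v) q‖ * ‖surf v p - surf v q‖ :=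
        (norm_add_le _ _).trans (add_le_add (ContinuousLinearMap.le_opNorm _ _)
          (ContinuousLinearMap.le_opNorm _ _))
    _ ≤ (C2 * ‖p - q‖) * C0 + C1 * (C1 * ‖p - q‖) := by gcongr
    _ = _ := by push_cast; ring

lemma IsConstrainedDiffeo.emb_surf (hφ : IsConstrainedDiffeo γ φ) (p : E2) :
    emb (surf φ p) = φ (emb p) :=
  emb_hor (by rw [hφ.planes _ (emb_mem_Bbar p)]; simp)

lemma hasDerivAt_energy (D : Set E2) (hφ : IsConstrainedDiffeo γ φ) (hv : IsTangentField ∅ v)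
    {ψ : ℝ → E3 → E3} (hψ : IsFlow v ψ) :
    HasDerivAt (fun τ => energy γ (ψ τ ∘ φ))
      (-lineTension D (fun i s => surf φ (γ i s)) (surf v)) 0 := by
  obtain ⟨K, K₂, hK, hK₂⟩ := hv.exists_lipschitzWith_surf
  have hV := hv.regular.contDiff_surf
  have h0 : ∀ p, surf (ψ 0) p = p := fun p => by
    rw [surf, (hψ _ (emb_mem_Bbar p)).1, hor_emb]
  have hs : ∀ τ p, surf (ψ τ ∘ φ) p = surf (ψ τ) (surf φ p) := fun τ p => by
    rw [surf, surf, hφ.emb_surf]; rfl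
  rw [lineTension_eq hφ.curve, ← Finset.sum_neg_distrib]
  simp only [energy, hs]
  refine HasDerivAt.fun_sum fun i _ => ?_
  rw [← integral_unitTangent_inner (hφ.curve i) hV]
  exact hasDerivAt_length (hφ.curve i) hV hK hK₂ h0 fun p t => hψ.hasDerivAt_surf hv p t

/-- A flow exists, and every flow gives the same derivative. The set `D` is arbitrary because the
line tension does not see the side of the normal. -/
theorem hasEnergyVariation_iff (D : Set E2) (hφ : IsConstrainedDiffeo γ φ)
    (hv : IsTangentField ∅ v) {d : ℝ} :
    HasEnergyVariation γ φ v d ↔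
      d = -lineTension D (fun i s => surf φ (γ i s)) (surf v) := by
  constructor
  · rintro ⟨ψ, hψ, h⟩
    exact h.unique (hasDerivAt_energy D hφ hv hψ)
  · rintro rfl
    obtain ⟨ψ, hψ⟩ := hv.exists_isFlow
    exact ⟨ψ, hψ, hasDerivAt_energy D hφ hv hψ⟩

end
end Langmuir
end

/-! ### Elimination of the bulk pressure, transport of the domain, and the equivalence. -/

noncomputable section
namespace Langmuir

section
variable {m : ℕ} {γ : Fin m → ℝ → E2} {φ u v w ξ η : E3 → E3} {S D Ω₀ : Set E2}

/-! ### Elimination of the pressure -/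

/-- The vertical component of Δu vanishes with that of u, so P does not depend on z and neither does
Δu = ∇P. The second derivatives of u tend to zero far below the surface, which leaves only zero. -/
lemma sum_pd_pd_eq_zero_of_stokes (hu : IsRegularField S u) (h2 : ∀ x ∈ Bbar, u x 2 = 0)
    {P : E3 → ℝ} (hP : DifferentiableOn ℝ P B)
    (h : ∀ x ∈ B, Laplacian.laplacian u x = gradient P x) {x : E3} (hx : x ∈ B) :
    ∑ i, pd i (pd i u) x = 0 := by
  have hB := hu.contDiffOn_B
  have hlap : ∀ y ∈ B, ∑ i, pd i (pd i u) y = gradient P y := fun y hy => by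
    rw [← h y hy, laplacian_eq (contDiffAt_of_mem_B hB hy two_le_infty)]
  have hPd : ∀ y ∈ B, DifferentiableAt ℝ P y := fun y hy => hP.differentiableAt (B_mem_nhds hy)
  have hP2 : ∀ y ∈ B, fderiv ℝ P y (e3 2) = 0 := fun y hy => by
    have e : inner ℝ (gradient P y) (e3 2) = fderiv ℝ P y (e3 2) := by
      rw [gradient, InnerProductSpace.toDual_symm_apply]
    rw [← e, ← hlap y hy, inner_E3]
    have h0 : (∑ i, pd i (pd i u) y) 2 = 0 := by
      rw [sum_pd_pd_apply hB 2 hy]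
      have hc : EqOn (coord u 2) (fun _ => 0) B := fun z hz => h2 z (B_subset_Bbar hz)
      exact (lap_congr hc hy).trans (lap_zero_fun y)
    simp [h0]
  have hmem : ∀ y ∈ B, ∀ s : ℝ, s ≤ 0 → y + s • e3 2 ∈ B := fun y hy s hs => by
    have : y 2 < 0 := hy
    change (y + s • e3 2) 2 < 0
    simp only [PiLp.add_apply, PiLp.smul_apply, PiLp.single_apply, if_true, smul_eq_mul,
      mul_one]
    linarith
  have hPc : ∀ y ∈ B, ∀ s : ℝ, s ≤ 0 → P (y + s • e3 2) = P y := fun y hy s hs => by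
    have hd : ∀ r ∈ Iic (0:ℝ), HasDerivWithinAt (fun r : ℝ => P (y + r • e3 2)) 0 (Iic 0) r :=
      fun r hr => by
        have h1 : HasDerivAt (fun r : ℝ => y + r • e3 2) (e3 2) r := by
          simpa using ((hasDerivAt_id r).smul_const (e3 2)).const_add y
        have h3 := (hPd _ (hmem y hy r hr)).hasFDerivAt.comp_hasDerivAt r h1
        rw [hP2 _ (hmem y hy r hr)] at h3
        exact h3.hasDerivWithinAt
    have hle := (convex_Iic (0:ℝ)).norm_image_sub_le_of_norm_hasDerivWithin_le (C := 0) hd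
      (fun _ _ => by simp) (mem_Iic.2 (le_refl (0:ℝ))) (mem_Iic.2 hs)
    simpa [sub_eq_zero] using hle
  -- Translation downwards leaves P unchanged near `x`, hence also its gradient, which is Δu.
  have hconst : ∀ s : ℝ, s ≤ 0 →
      ∑ i, pd i (pd i u) (x + s • e3 2) = ∑ i, pd i (pd i u) x := fun s hs => by
    rw [hlap x hx, hlap _ (hmem x hx s hs), gradient, gradient]
    congr 1
    rw [← fderiv_comp_add_right]
    have he : (fun y => P (y + s • e3 2)) =ᶠ[𝓝 x] P := by
      filter_upwards [B_mem_nhds hx] with y hy using hPc y hy s hs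
    exact he.fderiv_eq
  obtain ⟨C, R, hC⟩ := hu.decay_B 2
  have hnorm : Tendsto (fun n : ℕ => ‖x + (-(n : ℝ)) • e3 2‖) atTop atTop := by
    refine tendsto_atTop_mono (fun n => ?_)
      (tendsto_atTop_add_const_right _ (-‖x‖) tendsto_natCast_atTop_atTop)
    have h1 := norm_sub_norm_le ((n : ℝ) • e3 2) x
    rw [norm_smul, PiLp.norm_single, Real.norm_natCast, norm_one, mul_one] at h1
    have h3 : ‖x + (-(n : ℝ)) • e3 2‖ = ‖(n : ℝ) • e3 2 - x‖ := by
      rw [← norm_neg]; congr 1; module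
    rw [h3]; linarith
  have hlim : Tendsto (fun n : ℕ => 3 * (C / (1 + ‖x + (-(n : ℝ)) • e3 2‖) ^ 2)) atTop (𝓝 0) := by
    have h1 : Tendsto (fun r : ℝ => C / (1 + r) ^ 2) atTop (𝓝 0) :=
      tendsto_const_nhds.div_atTop ((tendsto_pow_atTop two_ne_zero).comp
        (tendsto_atTop_add_const_left _ 1 tendsto_id))
    simpa using (h1.comp hnorm).const_mul 3
  refine norm_le_zero_iff.1 (ge_of_tendsto hlim ?_)
  filter_upwards [hnorm.eventually_ge_atTop R] with n hn
  have hn0 : -(n : ℝ) ≤ 0 := by simp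
  have hyB := hmem x hx _ hn0
  rw [← hconst _ hn0]
  refine (norm_sum_le _ _).trans ((Finset.sum_le_sum fun i _ =>
    (norm_pd_pd_le (contDiffAt_of_mem_B hB hyB two_le_infty) i i).trans (hC _ hyB hn)).trans ?_)
  simp

/-! ### The motion of the phase domain -/

namespace IsConstrainedDiffeo

lemma inv_mem (hφ : IsConstrainedDiffeo γ φ) {x : E3} (hx : x ∈ Bbar) : inv φ x ∈ Bbar :=
  hφ.bijOn.surjOn.mapsTo_invFunOn hx

lemma apply_inv (hφ : IsConstrainedDiffeo γ φ) {x : E3} (hx : x ∈ Bbar) : φ (inv φ x) = x :=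
  hφ.bijOn.surjOn.rightInvOn_invFunOn hx

lemma inv_apply (hφ : IsConstrainedDiffeo γ φ) {x : E3} (hx : x ∈ Bbar) : inv φ (φ x) = x :=
  hφ.bijOn.injOn.leftInvOn_invFunOn hx

/-- Both the map and its inverse preserve heights, so the trace of the inverse inverts the trace. -/
lemma isHomeomorph_surf (hφ : IsConstrainedDiffeo γ φ) : IsHomeomorph (surf φ) := by
  have hc : ∀ {f : E3 → E3}, ContinuousOn f Bbar → Continuous (surf f) := fun hf =>
    continuous_hor.comp (continuousOn_univ.1
      (hf.comp continuous_emb.continuousOn fun p _ => emb_mem_Bbar p))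
  have hinv : ∀ p, emb (surf (inv φ) p) = inv φ (emb p) := fun p => by
    refine emb_hor ?_
    have h := hφ.planes _ (hφ.inv_mem (emb_mem_Bbar p))
    rw [hφ.apply_inv (emb_mem_Bbar p)] at h
    simpa using h.symm
  refine isHomeomorph_iff_exists_inverse.2 ⟨hc hφ.continuousOn, surf (inv φ), fun p => ?_,
    fun p => ?_, hc hφ.continuousOn_inv⟩
  · rw [surf, hφ.emb_surf, hφ.inv_apply (emb_mem_Bbar p), hor_emb]
  · rw [surf, hinv, hφ.apply_inv (emb_mem_Bbar p), hor_emb]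

lemma interface_eq (γ : Fin m → ℝ → E2) (φ : E3 → E3) :
    interface (fun i s => surf φ (γ i s)) = surf φ '' interface γ := by
  simp only [interface, image_iUnion, ← range_comp]
  rfl

lemma isPhaseDomain (hφ : IsConstrainedDiffeo γ φ) (hΩ : IsPhaseDomain Ω₀ γ) :
    IsPhaseDomain (surf φ '' Ω₀) (fun i s => surf φ (γ i s)) := by
  have h := hφ.isHomeomorph_surf
  refine ⟨h.isOpenMap _ hΩ.isOpen, ?_, hφ.curve, fun i j hij => ?_, ?_⟩
  · rw [← h.image_closure, ← h.image_interior, hΩ.one_sided]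
  · have e : ∀ i, range (fun s => surf φ (γ i s)) = surf φ '' range (γ i) := fun i =>
      range_comp (surf φ) (γ i)
    rw [e, e, disjoint_image_iff h.injective]
    exact hΩ.disjoint i j hij
  · rw [← h.image_frontier, hΩ.frontier_eq, interface_eq]

lemma comp_inv_eqOn (hφ : IsConstrainedDiffeo γ φ) (hξ : EqOn ξ (u ∘ φ) Bbar) :
    EqOn (ξ ∘ inv φ) u Bbar := fun x hx => by
  rw [Function.comp_apply, hξ (hφ.inv_mem hx), Function.comp_apply, hφ.apply_inv hx]

lemma metric_eq (hφ : IsConstrainedDiffeo γ φ) (hξ : EqOn ξ (u ∘ φ) Bbar)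
    (hη : EqOn η (w ∘ φ) Bbar) : metric φ ξ η = dirichlet u w := by
  refine setIntegral_congr_fun isOpen_B.measurableSet fun x hx => ?_
  have h1 : ∀ i, pd i (ξ ∘ inv φ) x = pd i u x := fun i =>
    pd_congr isOpen_B ((hφ.comp_inv_eqOn hξ).mono B_subset_Bbar) i hx
  have h2 : ∀ i, pd i (η ∘ inv φ) x = pd i w x := fun i =>
    pd_congr isOpen_B ((hφ.comp_inv_eqOn hη).mono B_subset_Bbar) i hx
  have e : gradInner u w x = gradInner (ξ ∘ inv φ) (η ∘ inv φ) x := by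
    simp only [gradInner, h1, h2]
  rw [e]
  simp only [gradInner, inner_E3, Fin.sum_univ_three, pd]

lemma eqOn_of_comp (hφ : IsConstrainedDiffeo γ φ) (h : EqOn (u ∘ φ) (w ∘ φ) Bbar) :
    EqOn u w Bbar := fun x hx => by
  have := h (hφ.inv_mem hx)
  simpa [hφ.apply_inv hx] using this

end IsConstrainedDiffeo

lemma IsTangentField.congr (hw : IsTangentField S w) (hu : IsRegularField S u)
    (h : EqOn u w Bbar) : IsTangentField S u where
  regular := hu
  div_free x hx := by
    have := hw.div_free x hx
    rw [div3_eq] at this ⊢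
    simpa only [pd_congr isOpen_B (h.mono B_subset_Bbar) _ hx] using this
  surface_div_free p hp := by
    have e : surf u = surf w := funext fun p => congrArg hor (h (emb_mem_Bbar p))
    rw [e]
    exact hw.surface_div_free p hp
  horizontal x hx := by
    rw [h hx]
    exact hw.horizontal x hx

/-- `u` is the gradient of the length of the curves `c` among the tangent fields. -/
def IsLengthGradient (D : Set E2) (c : Fin m → ℝ → E2) (u : E3 → E3) : Prop :=
  IsTangentField (interface c) u ∧
    ∀ v, IsTangentField ∅ v → dirichlet u v = lineTension D c (surf v)

namespace IsLengthGradient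
variable {c : Fin m → ℝ → E2}

/-- The line tension sees only the trace, so the field is orthogonal to every test field that
vanishes on the surface. -/
lemma sum_pd_pd_eq_zero (h : IsLengthGradient D c u) (hc : ∀ i, IsClosedCurve (c i)) {x : E3}
    (hx : x ∈ B) : ∑ i, pd i (pd i u) x = 0 :=
  sum_pd_pd_eq_zero_of_orthogonal h.1 (fun v hv h0 => by
    rw [h.2 v hv, lineTension_eq hc, h0]; simp) hx

lemma laplacian_eq_zero (h : IsLengthGradient D c u) (hc : ∀ i, IsClosedCurve (c i)) {x : E3}
    (hx : x ∈ B) : Laplacian.laplacian u x = 0 := by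
  rw [laplacian_eq (contDiffAt_of_mem_B h.1.regular.contDiffOn_B hx two_le_infty),
    h.sum_pd_pd_eq_zero hc hx]

lemma harmonicOnNhd (h : IsLengthGradient D c u) (hc : ∀ i, IsClosedCurve (c i)) :
    HarmonicOnNhd u B := fun x hx =>
  ⟨contDiffAt_of_mem_B h.1.regular.contDiffOn_B hx two_le_infty, by
    filter_upwards [B_mem_nhds hx] with y hy using h.laplacian_eq_zero hc hy⟩

lemma exists_forceBalance (h : IsLengthGradient D c u) (hc : ∀ i, IsClosedCurve (c i)) :
    ∃ q, ForceBalance D c u q :=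
  Langmuir.exists_forceBalance hc h.1.regular (fun _ hx => h.sum_pd_pd_eq_zero hc hx) h.2

end IsLengthGradient

section Flow
variable {T : ℝ} {φ u : ℝ → E3 → E3}

lemma velocity_eqOn (hflow : ∀ t ∈ Ico 0 T, ∀ x ∈ Bbar,
      HasDerivWithinAt (fun s => φ s x) (u t (φ t x)) (Ico 0 T) t) {t : ℝ} (ht : t ∈ Ico 0 T) :
    EqOn (velocity T φ t) (u t ∘ φ t) Bbar := fun x hx =>
  (hflow t ht x hx).derivWithin (uniqueDiffOn_Ico 0 T t ht)

/-- Composition with the inverse of φ brings everything to Eulerian form: the tangent field must be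
u, the metric is the Dirichlet form, and the energy derivative is minus the line tension on the
moved curves. -/
lemma isGradientFlow_iff (D : ℝ → Set E2) (hφ : ∀ t ∈ Ico 0 T, IsConstrainedDiffeo γ (φ t))
    (hu : ∀ t ∈ Ico 0 T, IsRegularField (surf (φ t) '' interface γ) (u t))
    (hflow : ∀ t ∈ Ico 0 T, ∀ x ∈ Bbar,
      HasDerivWithinAt (fun s => φ s x) (u t (φ t x)) (Ico 0 T) t) :
    IsGradientFlow γ T φ ↔
      ∀ t ∈ Ico 0 T, IsLengthGradient (D t) (fun i s => surf (φ t) (γ i s)) (u t) := by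
  refine forall₂_congr fun t ht => ?_
  have hvel := velocity_eqOn hflow ht
  rw [IsLengthGradient, IsConstrainedDiffeo.interface_eq]
  refine and_congr ⟨?_, fun h => ⟨u t, h, hvel⟩⟩ (forall₂_congr fun v hv => ?_)
  · rintro ⟨w, hw, he⟩
    exact hw.congr (hu t ht) ((hφ t ht).eqOn_of_comp (hvel.symm.trans he))
  · rw [hasEnergyVariation_iff (D t) (hφ t ht) hv, neg_inj,
      (hφ t ht).metric_eq hvel (w := v) fun _ _ => rfl]

lemma isConstrainedILLSS_of_isLengthGradient (hΩ : IsPhaseDomain Ω₀ γ)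
    (hφ : ∀ t ∈ Ico 0 T, IsConstrainedDiffeo γ (φ t))
    (hflow : ∀ t ∈ Ico 0 T, ∀ x ∈ Bbar,
      HasDerivWithinAt (fun s => φ s x) (u t (φ t x)) (Ico 0 T) t)
    (h : ∀ t ∈ Ico 0 T,
      IsLengthGradient (surf (φ t) '' Ω₀) (fun i s => surf (φ t) (γ i s)) (u t)) :
    ∃ q : ℝ → E2 → ℝ, IsConstrainedILLSS T (fun t => surf (φ t) '' Ω₀)
      (fun i t s => surf (φ t) (γ i s)) u (fun _ _ => 0) q := by
  have hq : ∀ t, ∃ q, t ∈ Ico 0 T →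
      ForceBalance (surf (φ t) '' Ω₀) (fun i s => surf (φ t) (γ i s)) (u t) q := fun t => by
    by_cases ht : t ∈ Ico 0 T
    · obtain ⟨q, hq⟩ := (h t ht).exists_forceBalance (hφ t ht).curve
      exact ⟨q, fun _ => hq⟩
    -- Outside the time interval the surface pressure is an arbitrary default.
    · exact ⟨0, fun h => absurd h ht⟩
  choose q hq using hq
  exact ⟨q, {
    domain := fun t ht => (hφ t ht).isPhaseDomain hΩ
    regular := fun t ht => (h t ht).1.regular
    incompressible := fun t ht => (h t ht).1.div_free
    pressure := fun t ht => differentiableOn_const _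
    stokes := fun t ht x hx => by
      rw [(h t ht).laplacian_eq_zero (hφ t ht).curve hx, gradient_fun_const]
    horizontal := fun t ht => (h t ht).1.horizontal
    surface_incompressible := fun t ht => (h t ht).1.surface_div_free
    balance := hq
    kinematic := fun t ht i s => by
      have h1 := horL.hasFDerivAt.comp_hasDerivWithinAt t
        (hflow t ht (emb (γ i s)) (emb_mem_Bbar _))
      have e : surf (u t) (surf (φ t) (γ i s)) = horL (u t (φ t (emb (γ i s)))) := by
        rw [surf, (hφ t ht).emb_surf]; rfl
      rw [e]
      exact h1 }⟩

lemma IsConstrainedILLSS.isLengthGradient {D : ℝ → Set E2} {Γ : Fin m → ℝ → ℝ → E2}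
    {P : ℝ → E3 → ℝ} {q : ℝ → E2 → ℝ} (h : IsConstrainedILLSS T D Γ u P q) {t : ℝ}
    (ht : t ∈ Ico 0 T) : IsLengthGradient (D t) (fun i => Γ i t) (u t) :=
  ⟨⟨h.regular t ht, h.incompressible t ht, h.surface_incompressible t ht, h.horizontal t ht⟩,
    fun _ hv => dirichlet_eq_lineTension (h.domain t ht).curve (h.regular t ht)
      (fun _ hx => sum_pd_pd_eq_zero_of_stokes (h.regular t ht) (h.horizontal t ht)
        (h.pressure t ht) (h.stokes t ht) hx) (h.balance t ht) hv⟩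

end Flow

end
end Langmuir
end

theorem mainTheorem2 {m : ℕ} (Ω₀ : Set Langmuir.E2) (γ : Fin m → ℝ → Langmuir.E2)
    (hΩ : Langmuir.IsPhaseDomain Ω₀ γ)
    (T : ℝ) (hT : 0 < T)
    (φ u : ℝ → Langmuir.E3 → Langmuir.E3)
    (hφ : ∀ t ∈ Set.Ico 0 T, Langmuir.IsConstrainedDiffeo γ (φ t))
    (hu : ∀ t ∈ Set.Ico 0 T,
      Langmuir.IsRegularField (Langmuir.surf (φ t) '' Langmuir.interface γ) (u t))
    (hflow : ∀ t ∈ Set.Ico 0 T, ∀ x ∈ Langmuir.Bbar,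
      HasDerivWithinAt (fun s => φ s x) (u t (φ t x)) (Set.Ico 0 T) t)
    (hinit : ∀ x ∈ Langmuir.Bbar, φ 0 x = x) :
    (Langmuir.IsGradientFlow γ T φ ↔
      ∃ (P : ℝ → Langmuir.E3 → ℝ) (q : ℝ → Langmuir.E2 → ℝ),
        Langmuir.IsConstrainedILLSS T (fun t => Langmuir.surf (φ t) '' Ω₀)
          (fun i t s => Langmuir.surf (φ t) (γ i s)) u P q) ∧
    (Langmuir.IsGradientFlow γ T φ →
      (∀ t ∈ Set.Ico 0 T, InnerProductSpace.HarmonicOnNhd (u t) Langmuir.B) ∧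
      ∃ q : ℝ → Langmuir.E2 → ℝ,
        Langmuir.IsConstrainedILLSS T (fun t => Langmuir.surf (φ t) '' Ω₀)
          (fun i t s => Langmuir.surf (φ t) (γ i s)) u (fun _ _ => 0) q) := by
  rw [Langmuir.isGradientFlow_iff (fun t => Langmuir.surf (φ t) '' Ω₀) hφ hu hflow]
  refine ⟨⟨fun h => ?_, fun ⟨P, q, h⟩ t ht => h.isLengthGradient ht⟩, fun h => ⟨fun t ht =>
    (h t ht).harmonicOnNhd (hφ t ht).curve,
    Langmuir.isConstrainedILLSS_of_isLengthGradient hΩ hφ hflow h⟩⟩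
  obtain ⟨q, hq⟩ := Langmuir.isConstrainedILLSS_of_isLengthGradient hΩ hφ hflow h
  exact ⟨_, q, hq⟩
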